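/- Let $d\ge 1$, $\alpha\in(0,2)$ with $d>\alpha$, $\lambda>0$, $\gamma>0$ and $C_1>0$. Let $E$ be the set of unordered pairs of distinct points of $\mathbb Z^d$, and let $\{w_{x,y}\}_{(x,y)\in E}$ be i.i.d. nonnegative random variables on a probability space, with $w_{x,y}=w_{y,x}$, $\mathbb E[w_{x,y}]=1$ and $w_{x,y}\le C_1$. For $k\in\{1,2,\dots\}$ let $\mu^k$ be $k^{-d}$ times the counting measure on $k^{-1}\mathbb Z^d$, and $$\mathcal L^{k,\omega}u(x)=k^{-d}\sum_{y\in k^{-1}\mathbb Z^d,\,y\ne x}(u(y)-u(x))\frac{w_{kx,ky}(\omega)}{|x-y|^{d+\alpha}},\qquad u\in L^2(k^{-1}\mathbb Z^d;\mu^k).$$ For $g\in C_c^\infty(\mathbb R^d)$ let $$\bar{\mathcal L}g(x)=\lim_{\varepsilon\downarrow0}\int_{\{|y-x|\ge\varepsilon\}}\frac{g(y)-g(x)}{|x-y|^{d+\alpha}}\,dy,$$ and let $\mathscr S_0^\lambda=\{(\lambda-\bar{\mathcal L})g: g\in C_c^\infty(\mathbb R^d)\}$. For $f\in\mathscr S_0^\lambda$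 let $R_\lambda^{k,\omega}f$ be the unique $u\in L^2(k^{-1}\mathbb Z^d;\mu^k)$ with $(\lambda-\mathcal L^{k,\omega})u=f$ on $k^{-1}\mathbb Z^d$ (it exists for all $k\ge1$, almost surely), extended to $\mathbb R^d$ by the constant value $u(z)$ on $\prod_{i=1}^d(z_i,z_i+k^{-1}]$ for each $z\in k^{-1}\mathbb Z^d$. Let $\bar R_\lambda f$ be the $L^2(\mathbb R^d)$-resolvent of $\bar{\mathcal L}$ at $\lambda$ applied to $f$, that is, the (existing and a.e. unique) function $u$ in $$\mathcal F=\Big\{v\in L^2(\mathbb R^d):\iint\frac{(v(x)-v(y))^2}{|x-y|^{d+\alpha}}\,dx\,dy<\infty\Big\}$$ such that for all $v\in\mathcal F$ $$\lambda\int uv\,dx+\frac12\iint\frac{(u(x)-u(y))(v(x)-v(y))}{|x-y|^{d+\alpha}}\,dx\,dy=\int fv\,dx .$$ Then there are constants $C_0(f)>0$, $f\in\mathscr S_0^\lambda$, depending only on $f,\gamma,\alpha,\lambda$ (and on $d$, $C_1$), and a random variable $k_0(\omega)\ge1$ that does not depend on $f$, such that almost surely, for all $f\in\mathscr S_0^\lambda$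 and all integers $k>k_0(\omega)$, $$\|R_\lambda^{k,\omega}f-\bar R_\lambda f\|_{L^2(\mathbb R^d;dx)}\le C_0(f)\begin{cases}\min\Big\{k^{-\alpha/2}(\log k)^{\frac{\alpha(1+\gamma)}{(4(d-\alpha))\wedge(2d)}},\;k^{-((1-\alpha)\wedge(d/2))}(\log k)^{1/2}\Big\},&\alpha\in(0,1),\\[1ex] k^{-1/2}(\log k)^{1+\frac{1+\gamma}{(4(d-1))\wedge(2d)}},&\alpha=1,\\[1ex] k^{-(2-\alpha)/2}(\log k)^{\frac{\alpha(1+\gamma)}{(4(d-\alpha))\wedge(2d)}},&\alpha\in(1,2).\end{cases}$$ -/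

import Mathlib

open MeasureTheory ProbabilityTheory Filter Topology

noncomputable section

/-- `ℝ^d` with its Euclidean norm. -/
abbrev Space (d : ℕ) : Type := EuclideanSpace ℝ (Fin d)

/-- The vertex set `ℤ^d`. -/
abbrev Vertex (d : ℕ) : Type := Fin d → ℤ

/-- The unordered pairs of distinct vertices of `ℤ^d`. -/
abbrev Edge (d : ℕ) : Type := {e : Sym2 (Vertex d) // ¬ e.IsDiag}

/-- The conductances `w_{x,y} = w s(x, y)`, `x ≠ y`, are i.i.d., nonnegative, bounded by `C₁`, and
of mean one. Symmetry in `x, y` is built into the index set of unordered pairs; the values of `w`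
on the diagonal play no role. -/
structure AssumptionH1 {d : ℕ} {Ω : Type*} [MeasurableSpace Ω] (P : Measure Ω) (C₁ : ℝ)
    (w : Sym2 (Vertex d) → Ω → ℝ) : Prop where
  measurable : ∀ e : Edge d, Measurable (w e)
  indep : iIndepFun (fun e : Edge d => w e) P
  identDistrib : ∀ e e' : Edge d, IdentDistrib (w e) (w e') P P
  nonneg : ∀ e : Edge d, ∀ᵐ ω ∂P, 0 ≤ w e ω
  mean : ∀ e : Edge d, ∫ ω, w e ω ∂P = 1
  bounded : ∀ e : Edge d, ∀ᵐ ω ∂P, w e ω ≤ C₁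

/-- The point `k⁻¹ z` of the scaled lattice `k⁻¹ ℤ^d`. Functions on `k⁻¹ ℤ^d` are written as
functions of `z ∈ ℤ^d`. -/
def latticePoint {d : ℕ} (k : ℕ) (z : Vertex d) : Space d :=
  WithLp.toLp 2 fun i => (z i : ℝ) / (k : ℝ)

/-- The scaled operator
`L^k u (x) = k^{-d} ∑_{y ∈ k⁻¹ℤ^d, y ≠ x} (u y - u x) w_{kx,ky} / |x - y|^{d+α}`
in the environment `a` (the summand with `y = x` vanishes). -/
def latticeOp {d : ℕ} (α : ℝ) (a : Sym2 (Vertex d) → ℝ) (k : ℕ) (u : Vertex d → ℝ)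
    (z : Vertex d) : ℝ :=
  ((k : ℝ) ^ d)⁻¹ * ∑' y : Vertex d,
    (u y - u z) * a s(z, y) / ‖latticePoint k z - latticePoint k y‖ ^ ((d : ℝ) + α)

/-- `u ∈ L²(k⁻¹ℤ^d; μ^k)` solves `(lam - L^k) u = f` on `k⁻¹ ℤ^d`. -/
def IsLatticeResolvent {d : ℕ} (α lam : ℝ) (a : Sym2 (Vertex d) → ℝ) (k : ℕ) (f : Space d → ℝ)
    (u : Vertex d → ℝ) : Prop :=
  (Summable fun z => u z ^ 2) ∧ ∀ z, lam * u z - latticeOp α a k u z = f (latticePoint k z)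

/-- The solution of `(lam - L^k) u = f`. The theorem asserts that it exists and is unique in the
cases where this definition is used. -/
def latticeResolvent {d : ℕ} (α lam : ℝ) (a : Sym2 (Vertex d) → ℝ) (k : ℕ) (f : Space d → ℝ) :
    Vertex d → ℝ :=
  Classical.epsilon (IsLatticeResolvent α lam a k f)

/-- The extension of a function on `k⁻¹ ℤ^d` to `ℝ^d` that is constant on each cell
`∏ i, (z i / k, (z i + 1) / k]`. -/
def cellExtend {d : ℕ} (k : ℕ) (u : Vertex d → ℝ) (x : Space d) : ℝ :=
  u fun i => ⌈(k : ℝ) * x i⌉ - 1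

/-- The limit operator
`L̄ g (x) = lim_{ε ↓ 0} ∫_{|y - x| ≥ ε} (g y - g x) / |x - y|^{d+α} dy`. -/
def fracLap {d : ℕ} (α : ℝ) (g : Space d → ℝ) (x : Space d) : ℝ :=
  limUnder (𝓝[>] (0 : ℝ)) fun ε =>
    ∫ y in {y : Space d | ε ≤ ‖y - x‖}, (g y - g x) / ‖x - y‖ ^ ((d : ℝ) + α)

/-- The class of all `f = (lam - L̄) g` with `g ∈ C_c^∞(ℝ^d)`. -/
def testClass (d : ℕ) (α lam : ℝ) : Set (Space d → ℝ) :=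
  {f | ∃ g : Space d → ℝ, ContDiff ℝ (⊤ : ℕ∞) g ∧ HasCompactSupport g ∧
    f = fun x => lam * g x - fracLap α g x}

/-- The domain of the Dirichlet form of `L̄`: square integrable functions of finite energy. -/
def InFracDomain {d : ℕ} (α : ℝ) (u : Space d → ℝ) : Prop :=
  MemLp u 2 volume ∧
    Integrable (fun p : Space d × Space d =>
      (u p.1 - u p.2) ^ 2 / ‖p.1 - p.2‖ ^ ((d : ℝ) + α)) volume

/-- The Dirichlet form of `L̄`. -/
def fracForm {d : ℕ} (α : ℝ) (u v : Space d → ℝ) : ℝ :=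
  (1 / 2) * ∫ p : Space d × Space d,
    (u p.1 - u p.2) * (v p.1 - v p.2) / ‖p.1 - p.2‖ ^ ((d : ℝ) + α)

/-- `u` is the `L²(ℝ^d)`-resolvent of `L̄` at `lam`, applied to `f`. -/
def IsFracResolvent {d : ℕ} (α lam : ℝ) (f u : Space d → ℝ) : Prop :=
  InFracDomain α u ∧ ∀ v : Space d → ℝ, InFracDomain α v →
    lam * (∫ x, u x * v x) + fracForm α u v = ∫ x, f x * v x

/-- The resolvent `R̄_lam f` of `L̄`. The theorem asserts that it exists and is unique up to null
sets in the cases where this definition is used. -/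
def fracResolvent {d : ℕ} (α lam : ℝ) (f : Space d → ℝ) : Space d → ℝ :=
  Classical.epsilon (IsFracResolvent α lam f)

/-- The rate of convergence. -/
def rate (d : ℕ) (α γ : ℝ) (k : ℕ) : ℝ :=
  if α < 1 then
    min ((k : ℝ) ^ (-(α / 2)) *
          Real.log k ^ (α * (1 + γ) / min (4 * ((d : ℝ) - α)) (2 * (d : ℝ))))
        ((k : ℝ) ^ (-(min (1 - α) ((d : ℝ) / 2))) * Real.log k ^ (1 / 2 : ℝ))
  else if α = 1 then
    (k : ℝ) ^ (-(1 / 2) : ℝ) *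
      Real.log k ^ (1 + (1 + γ) / min (4 * ((d : ℝ) - 1)) (2 * (d : ℝ)))
  else
    (k : ℝ) ^ (-((2 - α) / 2)) *
      Real.log k ^ (α * (1 + γ) / min (4 * ((d : ℝ) - α)) (2 * (d : ℝ)))

end

/-! No corrector is needed. For f = (λ - L̄)g the limit resolvent is g itself, and the lattice
solution u is compared directly with the restriction G of g to the lattice. The difference v = u - G
solves (λ - L^k)v = L^k G - L̄g. Pairing with v in the unnormalised ℓ²(ℤ^d) gives λ‖v‖² + k^α E(v) =
⟨L^k G - L̄g, v⟩, where E is the Dirichlet energy at scale one (`energy`). It remains to control the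
right side by the two quantities on the left.

Jumps are split at a lattice length r of order (log k)^(1/d). Shorter jumps need only w ≤ C₁:
Cauchy–Schwarz against the energy and the Lipschitz bound for g suffice
(`exists_abs_tsum_nearTerm_le`). For longer jumps w = 1 + (w - 1). The part with weight 1 differs
from L̄ by a Riemann sum error and the missing integral near the origin, both small because the
second differences of g are small (`TestBounds.exists_sum_sq_discError_le`).

The part with weight w - 1 is the random one. It is cut into dyadic jump lengths, and each of these
into cubes of comparable side. On a cube K, Hoeffding's inequality and a count of integer points
show that the matrix of centred weights has operator norm O(√#K) outside an event of probability
exp(-c #K). With concentrated row sums this gives the weighted complete graph on K a spectral gap of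
order #K (`poincareOn_of_opNormBound`). After constants are subtracted from G and v on the cube, the
operator norm pairs the oscillation of G with that of v, and the Poincaré inequality turns the
latter into energy. Lengths beyond k are paired with ‖v‖ instead. The dyadic sums are geometric
(`exists_abs_tsum_farTerm_le`).

The failure probability exp(-c r^d) beats the number of cubes, polynomial in k, once r^d exceeds a
large multiple of log k. By Borel–Cantelli there is a random scale beyond which all cubes in boxes
of exponential size are good (`AssumptionH1.exists_goodFrom`). This event does not involve f, which
is why k₀ does not either.

Altogether ‖v‖ ≤ A (k^(d/2) (r/k)^(1-α/2) + 1) (`TestBounds.exists_sqrt_sum_sq_le`). Normalised by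
k^(-d/2), the error is k^(-(1-α/2)) (log k)^((1-α/2)/d) + k^(-d/2), which the claimed rate dominates
in each of its three regimes (`exists_error_le_rate`). -/

/-! ### Concentration of weighted sums of centred conductances. -/

theorem ProbabilityTheory.HasSubgaussianMGF.mono {Ω : Type*} {mΩ : MeasurableSpace Ω}
    {P : Measure Ω} {X : Ω → ℝ} {c c' : NNReal} (h : HasSubgaussianMGF X c P) (hc : c ≤ c') :
    HasSubgaussianMGF X c' P :=
  ⟨h.integrable_exp_mul, fun t => (h.mgf_le t).trans (by
    have : (c : ℝ) ≤ c' := hc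
    gcongr)⟩

/-- An injective numbering of the vertices selects one ordered pair from each unordered one. The
terms on the right therefore involve distinct edges, hence independent conductances. -/
theorem Finset.sum_offDiag_eq_sum_lt {V : Type*} [DecidableEq V] (f : V → ℕ)
    (hf : Function.Injective f) (K : Finset V) (F : V → V → ℝ) :
    ∑ x ∈ K, ∑ y ∈ K, (if x = y then 0 else F x y) =
      ∑ p ∈ K ×ˢ K with f p.1 < f p.2, (F p.1 p.2 + F p.2 p.1) := by
  rw [← Finset.sum_product', Finset.sum_add_distrib]
  have h1 : ∑ p ∈ K ×ˢ K with f p.1 < f p.2, F p.2 p.1 =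
      ∑ p ∈ K ×ˢ K with f p.2 < f p.1, F p.1 p.2 := by
    refine Finset.sum_nbij' Prod.swap Prod.swap ?_ ?_ ?_ ?_ ?_ <;> simp +contextual
  rw [h1, Finset.sum_filter, Finset.sum_filter, ← Finset.sum_add_distrib]
  refine Finset.sum_congr rfl fun p _ => ?_
  by_cases hp : p.1 = p.2
  · simp [hp]
  · have : f p.1 ≠ f p.2 := fun h => hp (hf h)
    rcases lt_or_gt_of_ne this with h | h
    · simp [hp, h, h.not_gt]
    · simp [hp, h, h.not_gt]

theorem AssumptionH1.one_le_bound {d : ℕ} (hd : 0 < d) {Ω : Type*} [MeasurableSpace Ω]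
    {P : Measure Ω} [IsProbabilityMeasure P] {C₁ : ℝ} {w : Sym2 (Vertex d) → Ω → ℝ}
    (h : AssumptionH1 P C₁ w) : 1 ≤ C₁ := by
  let e : Edge d := ⟨s(0, fun _ => 1), by
    simp only [Sym2.mk_isDiag_iff]
    intro h
    have := congrFun h ⟨0, hd⟩
    simp at this⟩
  have hi : Integrable (w e) P := by
    -- A non-integrable function has Bochner integral 0, so mean one forces integrability.
    by_contra hn
    have := h.mean e
    rw [integral_undef hn] at this
    norm_num at this
  have := integral_mono_ae hi (integrable_const C₁) (h.bounded e)
  simpa [h.mean e] using this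

/-- Hoeffding's inequality. An edge enters with coefficient b x y + b y x and values in an interval
of length C₁, so its variance proxy is at most (C₁²/2)(b x y² + b y x²). The total proxy is C₁² S /
2, whence the exponent t² / (C₁² S). -/
theorem AssumptionH1.measure_sum_ge_le {d : ℕ} {Ω : Type*} [MeasurableSpace Ω]
    {P : Measure Ω} [IsProbabilityMeasure P] {C₁ : ℝ} {w : Sym2 (Vertex d) → Ω → ℝ}
    (h : AssumptionH1 P C₁ w) (K : Finset (Vertex d)) (b : Vertex d → Vertex d → ℝ) {S t : ℝ}
    (hS : ∑ x ∈ K, ∑ y ∈ K, b x y ^ 2 ≤ S) (ht : 0 ≤ t) :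
    P.real {ω | t ≤ ∑ x ∈ K, ∑ y ∈ K, if x = y then 0 else (w s(x, y) ω - 1) * b x y} ≤
      Real.exp (-t ^ 2 / (C₁ ^ 2 * S)) := by
  obtain ⟨f, hf⟩ := Countable.exists_injective_nat (Vertex d)
  let e : {p : Vertex d × Vertex d // f p.1 < f p.2} → Edge d := fun p =>
    ⟨s(p.1.1, p.1.2), by
      simp only [Sym2.mk_isDiag_iff]
      intro h
      have := p.2
      rw [h] at this
      exact lt_irrefl _ this⟩
  have he : Function.Injective e := by
    rintro ⟨⟨x, y⟩, hp⟩ ⟨⟨x', y'⟩, hq⟩ hpq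
    have : s(x, y) = s(x', y') := congrArg Subtype.val hpq
    rw [Sym2.eq_iff] at this
    rcases this with ⟨h1, h2⟩ | ⟨h1, h2⟩
    · subst h1; subst h2; rfl
    · subst h1; subst h2
      exact absurd hp (not_lt.2 (le_of_lt hq))
  let c : {p : Vertex d × Vertex d // f p.1 < f p.2} → ℝ := fun p =>
    b p.1.1 p.1.2 + b p.1.2 p.1.1
  let X : {p : Vertex d × Vertex d // f p.1 < f p.2} → Ω → ℝ := fun p ω =>
    c p * (w (e p) ω - 1)
  have hX : iIndepFun X P :=
    (h.indep.precomp he).comp (fun p x => c p * (x - 1)) (fun p => by fun_prop)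
  let s : Finset {p : Vertex d × Vertex d // f p.1 < f p.2} := (K ×ˢ K).subtype _
  have hsub : ∀ p, HasSubgaussianMGF (X p)
      (Real.toNNReal (C₁ ^ 2 / 2 * (b p.1.1 p.1.2 ^ 2 + b p.1.2 p.1.1 ^ 2))) P := by
    intro p
    have h1 := (hasSubgaussianMGF_of_mem_Icc (X := w (e p)) (a := 0) (b := C₁)
      (h.measurable (e p)).aemeasurable (by
        filter_upwards [h.nonneg (e p), h.bounded (e p)] with ω h1 h2 using ⟨h1, h2⟩)).const_mul
          (c p)
    rw [h.mean (e p)] at h1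
    refine h1.mono ?_
    rw [← NNReal.coe_le_coe, Real.coe_toNNReal _ (by positivity)]
    have : (c p) ^ 2 ≤ 2 * (b p.1.1 p.1.2 ^ 2 + b p.1.2 p.1.1 ^ 2) := by
      simp only [c]
      nlinarith [sq_nonneg (b p.1.1 p.1.2 - b p.1.2 p.1.1)]
    have h2 : ∀ q : NNReal, (q : ℝ) = c p ^ 2 →
        ((q * (‖C₁ - 0‖₊ / 2) ^ 2 : NNReal) : ℝ) = c p ^ 2 * (C₁ ^ 2 / 4) := by
      intro q hq
      rw [NNReal.coe_mul, NNReal.coe_pow, NNReal.coe_div, coe_nnnorm, sub_zero, div_pow,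
        Real.norm_eq_abs, sq_abs, hq]
      norm_num
    refine (h2 _ rfl).le.trans ?_
    nlinarith [sq_nonneg C₁]
  have hsum := HasSubgaussianMGF.sum_of_iIndepFun hX (s := s) (fun p _ => hsub p)
  have hle : ∑ p ∈ s, Real.toNNReal (C₁ ^ 2 / 2 * (b p.1.1 p.1.2 ^ 2 + b p.1.2 p.1.1 ^ 2)) ≤
      Real.toNNReal (C₁ ^ 2 / 2 * S) := by
    have hS0 : 0 ≤ S := le_trans (Finset.sum_nonneg fun _ _ => Finset.sum_nonneg fun _ _ =>
      sq_nonneg _) hS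
    rw [← NNReal.coe_le_coe, Real.coe_toNNReal _ (by positivity), NNReal.coe_sum]
    calc ∑ p ∈ s, ((Real.toNNReal (C₁ ^ 2 / 2 * (b p.1.1 p.1.2 ^ 2 + b p.1.2 p.1.1 ^ 2)) : NNReal)
          : ℝ) = ∑ p ∈ s, C₁ ^ 2 / 2 * (b p.1.1 p.1.2 ^ 2 + b p.1.2 p.1.1 ^ 2) :=
          Finset.sum_congr rfl fun p _ => Real.coe_toNNReal _ (by positivity)
      _ = C₁ ^ 2 / 2 * ∑ p ∈ K ×ˢ K with f p.1 < f p.2, (b p.1 p.2 ^ 2 + b p.2 p.1 ^ 2) := by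
          rw [← Finset.mul_sum, Finset.sum_subtype_eq_sum_filter
            (f := fun p : Vertex d × Vertex d => b p.1 p.2 ^ 2 + b p.2 p.1 ^ 2)]
      _ ≤ _ := by
          rw [← Finset.sum_offDiag_eq_sum_lt f hf K (fun x y => b x y ^ 2)]
          gcongr
          refine le_trans (Finset.sum_le_sum fun x _ => Finset.sum_le_sum fun y _ => ?_) hS
          split_ifs
          · positivity
          · exact le_rfl
  have hfin := (hsum.mono hle).measure_ge_le ht
  have hS0 : 0 ≤ S := le_trans (Finset.sum_nonneg fun _ _ => Finset.sum_nonneg fun _ _ =>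
      sq_nonneg _) hS
  rw [Real.coe_toNNReal _ (by positivity)] at hfin
  have hset : ∀ ω, ∑ x ∈ K, ∑ y ∈ K, (if x = y then 0 else (w s(x, y) ω - 1) * b x y) =
      ∑ p ∈ s, X p ω := by
    intro ω
    rw [Finset.sum_offDiag_eq_sum_lt f hf K (fun x y => (w s(x, y) ω - 1) * b x y),
      Finset.sum_subtype_eq_sum_filter (s := K ×ˢ K)
        (f := fun p : Vertex d × Vertex d => (b p.1 p.2 + b p.2 p.1) * (w s(p.1, p.2) ω - 1))]
    refine Finset.sum_congr rfl fun p _ => ?_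
    rw [Sym2.eq_swap (a := p.2)]
    ring
  simp only [hset]
  convert hfin using 2
  ring


/-! ### Reducing bilinear bounds to integer vectors. -/

section Rounding

variable {V : Type*}

/-- A linear functional on `ℝ^K` that is bounded by `T` on the integer points of the ball of radius
`√#K` is bounded by `2 * T` on the whole ball. -/
theorem abs_sum_mul_le_two_mul_of_int (K : Finset V) (l : V → ℝ) {T : ℝ}
    (h : ∀ m : V → ℤ, ∑ x ∈ K, (m x : ℝ) ^ 2 ≤ K.card → |∑ x ∈ K, l x * m x| ≤ T)
    (τ : V → ℝ) (hτ : ∑ x ∈ K, τ x ^ 2 ≤ K.card) : |∑ x ∈ K, l x * τ x| ≤ 2 * T := by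
  -- Rounding towards zero keeps the point inside the ball. The remainder has coordinates at most 1,
  -- so it contributes at most ∑ |l x|, which is the value of the functional at the sign vector `s`,
  -- again an integer point of the ball.
  let m : V → ℤ := fun x => if 0 ≤ τ x then ⌊τ x⌋ else ⌈τ x⌉
  let s : V → ℤ := fun x => if 0 ≤ l x then 1 else -1
  have hm : ∀ x, (m x : ℝ) ^ 2 ≤ τ x ^ 2 ∧ |τ x - m x| ≤ 1 := by
    intro x
    simp only [m]
    split_ifs with hx
    · have h1 := Int.floor_le (τ x)
      have h2 := Int.lt_floor_add_one (τ x)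
      have h3 : (0 : ℝ) ≤ ⌊τ x⌋ := by exact_mod_cast Int.floor_nonneg.2 hx
      exact ⟨by gcongr, by rw [abs_le]; constructor <;> linarith⟩
    · push Not at hx
      have h1 := Int.le_ceil (τ x)
      have h2 := Int.ceil_lt_add_one (τ x)
      have h3 : ((⌈τ x⌉ : ℤ) : ℝ) ≤ 0 := by exact_mod_cast Int.ceil_le.2 (by simpa using hx.le)
      exact ⟨by nlinarith, by rw [abs_le]; constructor <;> linarith⟩
  have h1 := h m ((Finset.sum_le_sum fun x _ => (hm x).1).trans hτ)
  have hs : ∀ x, l x * s x = |l x| := by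
    intro x
    simp only [s]
    split_ifs with hx
    · simp [abs_of_nonneg hx]
    · push Not at hx
      simp [abs_of_neg hx]
  have h2 := h s (by
    have : ∀ x, (s x : ℝ) ^ 2 = 1 := by
      intro x
      simp only [s]
      split_ifs <;> simp
    simp [this])
  simp only [hs] at h2
  have h3 : ∑ x ∈ K, l x * τ x = ∑ x ∈ K, l x * m x + ∑ x ∈ K, l x * (τ x - m x) := by
    rw [← Finset.sum_add_distrib]
    exact Finset.sum_congr rfl fun x _ => by ring
  have h4 : |∑ x ∈ K, l x * (τ x - m x)| ≤ ∑ x ∈ K, |l x| := by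
    refine (Finset.abs_sum_le_sum_abs _ _).trans (Finset.sum_le_sum fun x _ => ?_)
    rw [abs_mul]
    exact mul_le_of_le_one_right (abs_nonneg _) (hm x).2
  have h5 := (le_abs_self _).trans h2
  rw [h3]
  refine (abs_add_le _ _).trans ?_
  linarith

/-- The rounding bound is applied in each variable separately, at the cost of a factor 2 each time.
-/
theorem abs_sum_sum_mul_le_of_int (K : Finset V) (M : V → V → ℝ) {T : ℝ}
    (h : ∀ m m' : V → ℤ, ∑ x ∈ K, (m x : ℝ) ^ 2 ≤ K.card → ∑ x ∈ K, (m' x : ℝ) ^ 2 ≤ K.card →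
      |∑ x ∈ K, ∑ y ∈ K, M x y * m x * m' y| ≤ T)
    (τ τ' : V → ℝ) (hτ : ∑ x ∈ K, τ x ^ 2 ≤ K.card) (hτ' : ∑ x ∈ K, τ' x ^ 2 ≤ K.card) :
    |∑ x ∈ K, ∑ y ∈ K, M x y * τ x * τ' y| ≤ 4 * T := by
  have h1 : ∀ m' : V → ℤ, ∑ x ∈ K, (m' x : ℝ) ^ 2 ≤ K.card →
      |∑ x ∈ K, ∑ y ∈ K, M x y * τ x * m' y| ≤ 2 * T := by
    intro m' hm'
    have := abs_sum_mul_le_two_mul_of_int K (fun x => ∑ y ∈ K, M x y * m' y) (T := T) (by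
      intro m hm
      convert h m m' hm hm' using 4 with x hx
      rw [Finset.sum_mul]
      exact Finset.sum_congr rfl fun y _ => by ring) τ hτ
    convert this using 4 with x hx
    rw [Finset.sum_mul]
    exact Finset.sum_congr rfl fun y _ => by ring
  have := abs_sum_mul_le_two_mul_of_int K (fun y => ∑ x ∈ K, M x y * τ x) (T := 2 * T) (by
      intro m hm
      convert h1 m hm using 2
      rw [Finset.sum_comm]
      exact Finset.sum_congr rfl fun y _ => by rw [Finset.sum_mul]) τ' hτ'
  rw [Finset.sum_comm]
  calc _ = |∑ x ∈ K, (∑ y ∈ K, M y x * τ y) * τ' x| := by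
        congr 1
        exact Finset.sum_congr rfl fun y _ => by rw [Finset.sum_mul]
    _ ≤ _ := this.trans (by linarith)

theorem abs_sum_sum_mul_le_sqrt_of_int (K : Finset V) (M : V → V → ℝ) {T : ℝ}
    (h : ∀ m m' : V → ℤ, ∑ x ∈ K, (m x : ℝ) ^ 2 ≤ K.card → ∑ x ∈ K, (m' x : ℝ) ^ 2 ≤ K.card →
      |∑ x ∈ K, ∑ y ∈ K, M x y * m x * m' y| ≤ K.card * T)
    (τ τ' : V → ℝ) :
    |∑ x ∈ K, ∑ y ∈ K, M x y * τ x * τ' y| ≤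
      4 * T * √(∑ x ∈ K, τ x ^ 2) * √(∑ x ∈ K, τ' x ^ 2) := by
  have hzero : ∀ σ : V → ℝ, ∑ x ∈ K, σ x ^ 2 = 0 → ∀ x ∈ K, σ x = 0 := by
    intro σ hσ x hx
    have := (Finset.sum_eq_zero_iff_of_nonneg (fun _ _ => sq_nonneg _)).1 hσ x hx
    exact pow_eq_zero_iff (two_ne_zero) |>.1 this
  rcases eq_or_ne (∑ x ∈ K, τ x ^ 2) 0 with h0 | h0
  · rw [h0]
    have : ∑ x ∈ K, ∑ y ∈ K, M x y * τ x * τ' y = 0 :=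
      Finset.sum_eq_zero fun x hx => Finset.sum_eq_zero fun y _ => by simp [hzero τ h0 x hx]
    simp [this]
  rcases eq_or_ne (∑ x ∈ K, τ' x ^ 2) 0 with h0' | h0'
  · rw [h0']
    have : ∑ x ∈ K, ∑ y ∈ K, M x y * τ x * τ' y = 0 :=
      Finset.sum_eq_zero fun x hx => Finset.sum_eq_zero fun y hy => by simp [hzero τ' h0' y hy]
    simp [this]
  set A := ∑ x ∈ K, τ x ^ 2 with hA
  set A' := ∑ x ∈ K, τ' x ^ 2 with hA'
  have hApos : 0 < A := lt_of_le_of_ne (Finset.sum_nonneg fun _ _ => sq_nonneg _) h0.symm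
  have hA'pos : 0 < A' := lt_of_le_of_ne (Finset.sum_nonneg fun _ _ => sq_nonneg _) h0'.symm
  have hK : 0 < (K.card : ℝ) := by
    rcases K.eq_empty_or_nonempty with hK | hK
    · simp [hA, hK] at h0
    · exact_mod_cast hK.card_pos
  set n : ℝ := (K.card : ℝ)
  -- By homogeneity both vectors are rescaled to norm √#K, the radius for which integer points
  -- suffice.
  have key := abs_sum_sum_mul_le_of_int K M h (fun x => √n / √A * τ x) (fun x => √n / √A' * τ' x)
    (by
      simp only [mul_pow, div_pow, Real.sq_sqrt hK.le, Real.sq_sqrt hApos.le, ← Finset.mul_sum]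
      rw [← hA, div_mul_cancel₀ _ h0])
    (by
      simp only [mul_pow, div_pow, Real.sq_sqrt hK.le, Real.sq_sqrt hA'pos.le, ← Finset.mul_sum]
      rw [← hA', div_mul_cancel₀ _ h0'])
  have e1 : ∑ x ∈ K, ∑ y ∈ K, M x y * (√n / √A * τ x) * (√n / √A' * τ' y) =
      n / (√A * √A') * ∑ x ∈ K, ∑ y ∈ K, M x y * τ x * τ' y := by
    simp only [Finset.mul_sum]
    refine Finset.sum_congr rfl fun x _ => Finset.sum_congr rfl fun y _ => ?_
    have : n = √n * √n := (Real.mul_self_sqrt hK.le).symm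
    rw [show n / (√A * √A') = (√n * √n) / (√A * √A') by rw [← this]]
    ring
  rw [e1, abs_mul, abs_of_pos (by positivity)] at key
  have hs : 0 < √A * √A' := by positivity
  rw [div_mul_eq_mul_div, div_le_iff₀ hs] at key
  have : n * |∑ x ∈ K, ∑ y ∈ K, M x y * τ x * τ' y| ≤ n * (4 * T * √A * √A') := by
    linarith
  exact le_of_mul_le_mul_left this hK

end Rounding

/-! ### Counting integer points in a ball of radius √n in dimension n. -/

section Counting

theorem sum_Icc_exp_neg_sq_le (N : ℕ) :
    ∑ j ∈ Finset.Icc (-(N : ℤ)) N, Real.exp (-(j : ℝ) ^ 2) ≤ 4 := by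
  classical
  have hsub : Finset.Icc (-(N : ℤ)) N ⊆ (Finset.range (N + 1)).image (fun j : ℕ => (j : ℤ)) ∪
      (Finset.range (N + 1)).image (fun j : ℕ => -(j : ℤ)) := by
    intro j hj
    rw [Finset.mem_Icc] at hj
    rw [Finset.mem_union, Finset.mem_image, Finset.mem_image]
    rcases le_total 0 j with h | h
    · exact Or.inl ⟨j.toNat, by rw [Finset.mem_range]; omega, by simp; omega⟩
    · exact Or.inr ⟨(-j).toNat, by rw [Finset.mem_range]; omega, by simp; omega⟩
  have hexp : ∀ j : ℕ, Real.exp (-(j : ℝ) ^ 2) ≤ (1 / 2) ^ j := by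
    intro j
    have h1 : Real.exp (-(j : ℝ) ^ 2) ≤ Real.exp (-(j : ℝ)) := by
      apply Real.exp_le_exp.2
      have : (j : ℝ) ≤ (j : ℝ) ^ 2 := by exact_mod_cast Nat.le_self_pow two_ne_zero j
      linarith
    refine h1.trans ?_
    rw [← mul_neg_one, Real.exp_nat_mul]
    gcongr
    rw [Real.exp_neg]
    have := Real.add_one_le_exp (1 : ℝ)
    rw [one_div]
    gcongr
    linarith
  have hgeo : ∑ j ∈ Finset.range (N + 1), ((1 : ℝ) / 2) ^ j ≤ 2 := by
    have := Summable.sum_le_tsum (Finset.range (N + 1)) (fun j _ => by positivity)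
      summable_geometric_two
    rwa [tsum_geometric_two] at this
  have hhalf : ∑ j ∈ Finset.range (N + 1), Real.exp (-(j : ℝ) ^ 2) ≤ 2 :=
    (Finset.sum_le_sum fun j _ => hexp j).trans hgeo
  refine (Finset.sum_le_sum_of_subset_of_nonneg hsub fun _ _ _ => by positivity).trans ?_
  have hun := Finset.sum_union_inter (f := fun j : ℤ => Real.exp (-(j : ℝ) ^ 2))
    (s₁ := (Finset.range (N + 1)).image (fun j : ℕ => (j : ℤ)))
    (s₂ := (Finset.range (N + 1)).image (fun j : ℕ => -(j : ℤ)))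
  have hin : 0 ≤ ∑ j ∈ (Finset.range (N + 1)).image (fun j : ℕ => (j : ℤ)) ∩
      (Finset.range (N + 1)).image (fun j : ℕ => -(j : ℤ)), Real.exp (-(j : ℝ) ^ 2) :=
    Finset.sum_nonneg fun _ _ => by positivity
  rw [Finset.sum_image (fun a _ b _ h => by simpa using h),
    Finset.sum_image (fun a _ b _ h => by simpa using h)] at hun
  simp only [Int.cast_neg, Int.cast_natCast, neg_sq] at hun
  linarith

/-- The integer points of the ball of radius `√#K` in `ℝ^K`. -/
noncomputable def intBall {V : Type*} (K : Finset V) : Finset (K → ℤ) :=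
  open Classical in
  (Fintype.piFinset fun _ : K => Finset.Icc (-(K.card : ℤ)) K.card).filter
    fun m => ∑ x, (m x : ℝ) ^ 2 ≤ K.card

theorem mem_intBall {V : Type*} {K : Finset V} {m : K → ℤ} :
    m ∈ intBall K ↔ ∑ x, (m x : ℝ) ^ 2 ≤ K.card := by
  classical
  simp only [intBall, Finset.mem_filter, Fintype.mem_piFinset, and_iff_right_iff_imp]
  intro h x
  have h1 : (m x : ℝ) ^ 2 ≤ K.card := (Finset.single_le_sum (f := fun x => (m x : ℝ) ^ 2)
    (fun _ _ => sq_nonneg _) (Finset.mem_univ x)).trans h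
  have h2 : (m x) ^ 2 ≤ (K.card : ℤ) := by exact_mod_cast h1
  rw [Finset.mem_Icc]
  constructor <;> nlinarith

/-- Exponential weighting: on the ball 1 ≤ exp(n) ∏ exp(-m x²) with n = #K, and the sum of the right
side factorises into one-dimensional sums, each at most 4 ≤ exp 2. -/
theorem card_intBall_le {V : Type*} (K : Finset V) :
    ((intBall K).card : ℝ) ≤ Real.exp (3 * K.card) := by
  classical
  calc ((intBall K).card : ℝ) = ∑ m ∈ intBall K, (1 : ℝ) := by simp
    _ ≤ ∑ m ∈ intBall K, Real.exp K.card * ∏ x, Real.exp (-(m x : ℝ) ^ 2) := by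
        refine Finset.sum_le_sum fun m hm => ?_
        rw [← Real.exp_sum, ← Real.exp_add, Finset.sum_neg_distrib]
        apply Real.one_le_exp
        have := mem_intBall.1 hm
        linarith
    _ ≤ ∑ m ∈ Fintype.piFinset fun _ : K => Finset.Icc (-(K.card : ℤ)) K.card,
          Real.exp K.card * ∏ x, Real.exp (-(m x : ℝ) ^ 2) :=
        Finset.sum_le_sum_of_subset_of_nonneg (Finset.filter_subset _ _)
          fun _ _ _ => by positivity
    _ = Real.exp K.card *
          ∏ _x : K, ∑ j ∈ Finset.Icc (-(K.card : ℤ)) K.card, Real.exp (-(j : ℝ) ^ 2) := by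
        rw [Finset.prod_univ_sum, Finset.mul_sum]
    _ ≤ Real.exp K.card * ∏ _x : K, (4 : ℝ) := by
        gcongr
        exact sum_Icc_exp_neg_sq_le _
    _ ≤ Real.exp K.card * Real.exp 2 ^ K.card := by
        rw [Finset.prod_const, Finset.card_univ, Fintype.card_coe]
        gcongr
        have := Real.add_one_le_exp (1 : ℝ)
        rw [show (2 : ℝ) = 1 + 1 by norm_num, Real.exp_add]
        nlinarith
    _ = _ := by
        rw [← Real.exp_nat_mul, ← Real.exp_add]
        congr 1
        ring

end Counting

/-! ### Operator norm of the centred conductance matrix. -/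

section OperatorNorm

/-- The off-diagonal bilinear form of the centred conductances with weights `b` on a finite set. -/
noncomputable def centeredForm {d : ℕ} (a : Sym2 (Vertex d) → ℝ) (b : Vertex d → Vertex d → ℝ)
    (K : Finset (Vertex d)) (τ τ' : Vertex d → ℝ) : ℝ :=
  ∑ x ∈ K, ∑ y ∈ K, (if x = y then 0 else (a s(x, y) - 1) * b x y) * τ x * τ' y

/-- The operator norm of the matrix of centred conductances is at most `12 * C₁ * √#K`. -/
def OpNormBound {d : ℕ} (C₁ : ℝ) (a : Sym2 (Vertex d) → ℝ) (b : Vertex d → Vertex d → ℝ)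
    (K : Finset (Vertex d)) : Prop :=
  ∀ τ τ' : Vertex d → ℝ, |centeredForm a b K τ τ'| ≤
    12 * C₁ * √K.card * √(∑ x ∈ K, τ x ^ 2) * √(∑ x ∈ K, τ' x ^ 2)

theorem centeredForm_congr {d : ℕ} (a : Sym2 (Vertex d) → ℝ) (b : Vertex d → Vertex d → ℝ)
    (K : Finset (Vertex d)) {τ τ' σ σ' : Vertex d → ℝ} (h : ∀ x ∈ K, τ x = σ x)
    (h' : ∀ x ∈ K, τ' x = σ' x) : centeredForm a b K τ τ' = centeredForm a b K σ σ' :=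
  Finset.sum_congr rfl fun x hx => Finset.sum_congr rfl fun y hy => by rw [h x hx, h' y hy]

/-- A union bound over pairs of integer points. With n = #K, S = n² and T = 3 C₁ n √n, Hoeffding
gives exp(-9n) for each pair and sign; there are at most exp(6n) pairs, which leaves 2 exp(-3n).
Passing from integer to real vectors costs a factor 4, whence 12 = 4 * 3 in `OpNormBound`. -/
theorem AssumptionH1.measure_not_opNormBound_le {d : ℕ} (hd : 0 < d) {Ω : Type*}
    [MeasurableSpace Ω] {P : Measure Ω} [IsProbabilityMeasure P] {C₁ : ℝ}
    {w : Sym2 (Vertex d) → Ω → ℝ} (h : AssumptionH1 P C₁ w) (K : Finset (Vertex d))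
    (b : Vertex d → Vertex d → ℝ) (hb : ∀ x y, |b x y| ≤ 1) :
    P.real {ω | ¬ OpNormBound C₁ (fun e => w e ω) b K} ≤ 2 * Real.exp (-3 * K.card) := by
  classical
  have hC := h.one_le_bound hd
  rcases K.eq_empty_or_nonempty with hK | hK
  · subst hK
    refine (measureReal_le_one).trans ?_
    simp
  have hn : (0 : ℝ) < K.card := by exact_mod_cast hK.card_pos
  let ex : (K → ℤ) → Vertex d → ℝ := fun m x => if hx : x ∈ K then (m ⟨x, hx⟩ : ℝ) else 0
  have hex : ∀ m : K → ℤ, ∑ x ∈ K, ex m x ^ 2 = ∑ x, (m x : ℝ) ^ 2 := by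
    intro m
    rw [← Finset.sum_coe_sort]
    exact Finset.sum_congr rfl fun x _ => by simp [ex]
  set T : ℝ := K.card * (3 * C₁ * √K.card) with hT
  have hT0 : 0 ≤ T := by positivity
  let B : Ω → (K → ℤ) → (K → ℤ) → ℝ := fun ω m m' =>
    centeredForm (fun e => w e ω) b K (ex m) (ex m')
  have hprob : ∀ s : ℝ, |s| = 1 → ∀ m ∈ intBall K, ∀ m' ∈ intBall K,
      P.real {ω | T ≤ s * B ω m m'} ≤ Real.exp (-9 * K.card) := by
    intro s hs m hm m' hm'
    have h1 := h.measure_sum_ge_le K (fun x y => s * (b x y * ex m x * ex m' y))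
      (S := (K.card : ℝ) ^ 2) (t := T) (by
        calc ∑ x ∈ K, ∑ y ∈ K, (s * (b x y * ex m x * ex m' y)) ^ 2
            ≤ ∑ x ∈ K, ∑ y ∈ K, ex m x ^ 2 * ex m' y ^ 2 := by
              refine Finset.sum_le_sum fun x _ => Finset.sum_le_sum fun y _ => ?_
              have h1 : s ^ 2 = 1 := by rw [← sq_abs, hs, one_pow]
              have h2 : b x y ^ 2 ≤ 1 := by
                rw [← sq_abs]
                exact pow_le_one₀ (abs_nonneg _) (hb x y)
              rw [mul_pow, h1, mul_pow, mul_pow, one_mul, mul_assoc]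
              exact mul_le_of_le_one_left (by positivity) h2
          _ = (∑ x ∈ K, ex m x ^ 2) * ∑ y ∈ K, ex m' y ^ 2 := by
              rw [Finset.sum_mul_sum]
          _ ≤ (K.card : ℝ) * K.card := by
              rw [hex, hex]
              gcongr
              · exact mem_intBall.1 hm
              · exact mem_intBall.1 hm'
          _ = _ := by ring) hT0
    have e1 : ∀ ω, ∑ x ∈ K, ∑ y ∈ K, (if x = y then 0 else
        (w s(x, y) ω - 1) * (s * (b x y * ex m x * ex m' y))) = s * B ω m m' := by
      intro ω
      simp only [B, centeredForm, Finset.mul_sum]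
      refine Finset.sum_congr rfl fun x _ => Finset.sum_congr rfl fun y _ => ?_
      split_ifs <;> ring
    simp only [e1] at h1
    refine h1.trans (Real.exp_le_exp.2 (le_of_eq ?_))
    have : T ^ 2 = 9 * C₁ ^ 2 * (K.card : ℝ) ^ 3 := by
      rw [hT, mul_pow, mul_pow, Real.sq_sqrt hn.le]
      ring
    rw [neg_div, this]
    field_simp
  have hsub : {ω | ¬ OpNormBound C₁ (fun e => w e ω) b K} ⊆
      ⋃ q ∈ intBall K ×ˢ intBall K, ({ω | T ≤ 1 * B ω q.1 q.2} ∪ {ω | T ≤ -1 * B ω q.1 q.2}) := by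
    intro ω hω
    by_contra hcon
    refine hω fun τ τ' => ?_
    have key := abs_sum_sum_mul_le_sqrt_of_int K
      (fun x y => if x = y then 0 else (w s(x, y) ω - 1) * b x y) (T := 3 * C₁ * √K.card) (by
        intro m m' hm hm'
        by_contra hlt
        apply hcon
        rw [Set.mem_iUnion₂]
        refine ⟨(fun x => m x, fun x => m' x), Finset.mem_product.2 ⟨mem_intBall.2 ?_,
          mem_intBall.2 ?_⟩, ?_⟩
        · rwa [← Finset.sum_coe_sort] at hm
        · rwa [← Finset.sum_coe_sort] at hm'
        have hB : B ω (fun x => m x) (fun x => m' x) =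
            ∑ x ∈ K, ∑ y ∈ K, (if x = y then 0 else (w s(x, y) ω - 1) * b x y) * m x * m' y :=
          centeredForm_congr _ _ _ (fun x hx => by simp [ex, hx]) (fun x hx => by simp [ex, hx])
        rw [← hB] at hlt
        push Not at hlt
        rcases lt_abs.1 hlt with h | h
        · left
          change T ≤ 1 * B ω (fun x => m x) (fun x => m' x)
          linarith
        · right
          change T ≤ -1 * B ω (fun x => m x) (fun x => m' x)
          linarith) τ τ'
    refine key.trans (le_of_eq ?_)
    ring
  refine (measureReal_mono hsub (measure_ne_top _ _)).trans ((measureReal_biUnion_finset_le _ _).trans ?_)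
  calc ∑ q ∈ intBall K ×ˢ intBall K,
        P.real ({ω | T ≤ 1 * B ω q.1 q.2} ∪ {ω | T ≤ -1 * B ω q.1 q.2})
      ≤ ∑ q ∈ intBall K ×ˢ intBall K, 2 * Real.exp (-9 * K.card) := by
        refine Finset.sum_le_sum fun q hq => ?_
        rw [Finset.mem_product] at hq
        refine (measureReal_union_le _ _).trans ?_
        have h1 := hprob 1 (by simp) q.1 hq.1 q.2 hq.2
        have h2 := hprob (-1) (by simp) q.1 hq.1 q.2 hq.2
        linarith
    _ = ((intBall K).card : ℝ) * (intBall K).card * (2 * Real.exp (-9 * K.card)) := by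
        rw [Finset.sum_const, Finset.card_product]
        simp
    _ ≤ Real.exp (3 * K.card) * Real.exp (3 * K.card) * (2 * Real.exp (-9 * K.card)) := by
        gcongr <;> exact card_intBall_le K
    _ = 2 * (Real.exp (3 * K.card) * Real.exp (3 * K.card) * Real.exp (-9 * K.card)) := by ring
    _ = _ := by
        rw [← Real.exp_add, ← Real.exp_add]
        congr 2
        ring

end OperatorNorm


/-! ### A spectral gap from the operator norm and the row sums. -/

section Poincare

/-- The Poincaré (spectral gap) inequality for the complete graph on `K` with weights `a`. -/
def PoincareOn {d : ℕ} (a : Sym2 (Vertex d) → ℝ) (K : Finset (Vertex d)) : Prop :=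
  ∀ v : Vertex d → ℝ, K.card * ∑ x ∈ K, (v x - (∑ z ∈ K, v z) / K.card) ^ 2 ≤
    ∑ x ∈ K, ∑ y ∈ K, if x = y then 0 else a s(x, y) * (v x - v y) ^ 2

/-- With u = v minus its mean, n = #K and U = ∑ u², unit weights give exactly 2nU. The centred
weights contribute twice a row-sum term, at least -nU/8, minus twice a bilinear term, at most 3nU/8
because 12 C₁ √n ≤ 3n/8. At least 2nU - nU/4 - 3nU/4 = nU survives. -/
theorem poincareOn_of_opNormBound {d : ℕ} {C₁ : ℝ} {a : Sym2 (Vertex d) → ℝ}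
    {K : Finset (Vertex d)} (hop : OpNormBound C₁ a (fun _ _ => 1) K)
    (hrow : ∀ x ∈ K, |∑ y ∈ K, if x = y then 0 else (a s(x, y) - 1)| ≤ K.card / 8)
    (hK : 32 * C₁ ≤ √K.card) : PoincareOn a K := by
  intro v
  rcases K.eq_empty_or_nonempty with hK0 | hK0
  · simp [hK0]
  have hn : (0 : ℝ) < K.card := by exact_mod_cast hK0.card_pos
  set n : ℝ := (K.card : ℝ) with hndef
  set u : Vertex d → ℝ := fun x => v x - (∑ z ∈ K, v z) / n with hu
  have hu0 : ∑ x ∈ K, u x = 0 := by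
    simp only [hu, Finset.sum_sub_distrib, Finset.sum_const, nsmul_eq_mul]
    field_simp
    ring
  set U : ℝ := ∑ x ∈ K, u x ^ 2 with hU
  have hU0 : 0 ≤ U := Finset.sum_nonneg fun _ _ => sq_nonneg _
  set M : Vertex d → Vertex d → ℝ := fun x y => if x = y then 0 else (a s(x, y) - 1) with hM
  have hMs : ∀ x y, M x y = M y x := by
    intro x y
    simp only [hM, eq_comm (a := x), Sym2.eq_swap (a := x)]
  have hsplit : ∑ x ∈ K, ∑ y ∈ K, (if x = y then 0 else a s(x, y) * (v x - v y) ^ 2) =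
      ∑ x ∈ K, ∑ y ∈ K, (u x - u y) ^ 2 + ∑ x ∈ K, ∑ y ∈ K, M x y * (u x - u y) ^ 2 := by
    rw [← Finset.sum_add_distrib]
    refine Finset.sum_congr rfl fun x _ => ?_
    rw [← Finset.sum_add_distrib]
    refine Finset.sum_congr rfl fun y _ => ?_
    simp only [hM, hu]
    split_ifs with hxy
    · simp [hxy]
    · ring
  have h1 : ∑ x ∈ K, ∑ y ∈ K, (u x - u y) ^ 2 = 2 * n * U := by
    have : ∀ x y, (u x - u y) ^ 2 = u x ^ 2 + u y ^ 2 - 2 * (u x * u y) := fun x y => by ring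
    simp only [this, Finset.sum_add_distrib, Finset.sum_sub_distrib, ← Finset.mul_sum,
      Finset.sum_const, nsmul_eq_mul, ← Finset.sum_mul, hu0]
    simp only [← hU, ← hndef]
    ring
  have h2 : ∑ x ∈ K, ∑ y ∈ K, M x y * (u x - u y) ^ 2 =
      2 * ∑ x ∈ K, u x ^ 2 * ∑ y ∈ K, M x y - 2 * centeredForm a (fun _ _ => 1) K u u := by
    have e1 : ∑ x ∈ K, ∑ y ∈ K, M x y * u y ^ 2 = ∑ x ∈ K, u x ^ 2 * ∑ y ∈ K, M x y := by
      rw [Finset.sum_comm]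
      refine Finset.sum_congr rfl fun x _ => ?_
      rw [Finset.mul_sum]
      exact Finset.sum_congr rfl fun y _ => by rw [hMs]; ring
    have e2 : ∑ x ∈ K, ∑ y ∈ K, M x y * u x ^ 2 = ∑ x ∈ K, u x ^ 2 * ∑ y ∈ K, M x y := by
      refine Finset.sum_congr rfl fun x _ => ?_
      rw [Finset.mul_sum]
      exact Finset.sum_congr rfl fun y _ => by ring
    have e3 : centeredForm a (fun _ _ => 1) K u u = ∑ x ∈ K, ∑ y ∈ K, M x y * u x * u y := by
      simp only [centeredForm, hM, mul_one]
    rw [two_mul (∑ x ∈ K, u x ^ 2 * ∑ y ∈ K, M x y)]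
    nth_rw 1 [← e1]
    rw [← e2, e3, Finset.mul_sum, ← Finset.sum_add_distrib, ← Finset.sum_sub_distrib]
    refine Finset.sum_congr rfl fun x _ => ?_
    rw [Finset.mul_sum, ← Finset.sum_add_distrib, ← Finset.sum_sub_distrib]
    exact Finset.sum_congr rfl fun y _ => by ring
  have h3 : -(n / 8 * U) ≤ ∑ x ∈ K, u x ^ 2 * ∑ y ∈ K, M x y := by
    rw [hU, Finset.mul_sum, ← Finset.sum_neg_distrib]
    refine Finset.sum_le_sum fun x hx => ?_
    have := (abs_le.1 (hrow x hx)).1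
    nlinarith [sq_nonneg (u x)]
  have h4 : centeredForm a (fun _ _ => 1) K u u ≤ 3 / 8 * n * U := by
    have := (le_abs_self _).trans (hop u u)
    rw [mul_assoc, Real.mul_self_sqrt hU0] at this
    refine this.trans ?_
    have h5 : √n * √n = n := Real.mul_self_sqrt hn.le
    have h6 : 12 * C₁ * √n ≤ 3 / 8 * n := by nlinarith [Real.sqrt_nonneg n]
    gcongr
  rw [hsplit, h1, h2]
  nlinarith

end Poincare

/-! ### Cubes, the cubes shared by two points, and normalised kernels. -/

section Cubes

/-- The cube of side length `4 * r` with lowest corner `c`. -/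
noncomputable def cube {d : ℕ} (r : ℕ) (c : Vertex d) : Finset (Vertex d) :=
  Finset.Icc c fun i => c i + 4 * r

theorem mem_cube {d : ℕ} {r : ℕ} {c x : Vertex d} :
    x ∈ cube r c ↔ ∀ i, c i ≤ x i ∧ x i ≤ c i + 4 * r := by
  simp only [cube, Finset.mem_Icc, Pi.le_def, ← forall_and]

theorem card_cube {d : ℕ} (r : ℕ) (c : Vertex d) : (cube r c).card = (4 * r + 1) ^ d := by
  simp only [cube, Pi.card_Icc, Int.card_Icc]
  rw [Finset.prod_congr rfl (g := fun _ => 4 * r + 1) (fun i _ => by omega)]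
  simp

/-- The lower corners of the cubes of side length `4 * r` that contain both `x` and `y`. -/
noncomputable def commonCorners {d : ℕ} (r : ℕ) (x y : Vertex d) : Finset (Vertex d) :=
  Finset.Icc (fun i => max (x i) (y i) - 4 * r) fun i => min (x i) (y i)

theorem mem_commonCorners {d : ℕ} {r : ℕ} {x y c : Vertex d} :
    c ∈ commonCorners r x y ↔ x ∈ cube r c ∧ y ∈ cube r c := by
  simp only [commonCorners, Finset.mem_Icc, Pi.le_def, mem_cube, ← forall_and]
  refine forall_congr' fun i => ?_
  omega

theorem card_commonCorners_le {d : ℕ} (r : ℕ) (x y : Vertex d) :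
    (commonCorners r x y).card ≤ (4 * r + 1) ^ d := by
  simp only [commonCorners, Pi.card_Icc, Int.card_Icc]
  calc _ ≤ ∏ _i : Fin d, (4 * r + 1) := Finset.prod_le_prod' fun i _ => by omega
    _ = _ := by simp

theorem abs_coord_le_norm {d : ℕ} (x : Vertex d) (i : Fin d) : |(x i : ℝ)| ≤ ‖x‖ := by
  have := norm_le_pi_norm x i
  rwa [Int.norm_eq_abs] at this

/-- The side 4r is twice the maximal jump length 2r, so each coordinate of the corner retains at
least 2r choices. A jump is thus seen by a fixed proportion of the maximal number (4r+1)^d of cubes.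
-/
theorem le_card_commonCorners {d : ℕ} {r : ℕ} {x y : Vertex d} (h : ‖x - y‖ < 2 * r) :
    (2 * r) ^ d ≤ (commonCorners r x y).card := by
  simp only [commonCorners, Pi.card_Icc, Int.card_Icc]
  calc (2 * r) ^ d = ∏ _i : Fin d, (2 * r) := by simp
    _ ≤ _ := Finset.prod_le_prod' fun i _ => by
      have h1 := (abs_coord_le_norm (x - y) i).trans_lt h
      have h2 : |x i - y i| < 2 * r := by exact_mod_cast h1
      rw [abs_lt] at h2
      omega

/-- The Euclidean norm of a lattice vector. -/
noncomputable def eucl {d : ℕ} (z : Vertex d) : ℝ := ‖latticePoint 1 z‖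

theorem norm_le_eucl {d : ℕ} (z : Vertex d) : ‖z‖ ≤ eucl z := by
  refine (pi_norm_le_iff_of_nonneg (norm_nonneg _)).2 fun i => ?_
  have := PiLp.norm_apply_le (latticePoint 1 z) i
  rw [Int.norm_eq_abs]
  simpa [latticePoint, eucl] using this

theorem eucl_le {d : ℕ} (z : Vertex d) : eucl z ≤ d * ‖z‖ := by
  have h := norm_sum_le (Finset.univ : Finset (Fin d))
    (fun i => EuclideanSpace.single i ((z i : ℝ)))
  have e : ∑ i, EuclideanSpace.single i ((z i : ℝ)) = latticePoint 1 z := by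
    ext j
    simp [latticePoint, Finset.sum_apply]
  rw [e] at h
  refine h.trans ?_
  calc ∑ i, ‖EuclideanSpace.single i ((z i : ℝ))‖ ≤ ∑ _i : Fin d, ‖z‖ := by
        refine Finset.sum_le_sum fun i _ => ?_
        rw [PiLp.norm_single, Real.norm_eq_abs]
        exact abs_coord_le_norm z i
    _ = _ := by simp

theorem eucl_nonneg {d : ℕ} (z : Vertex d) : 0 ≤ eucl z := norm_nonneg _

/-- The jump kernel `|z|^{-(d+α)}` on `ℤ^d` (equal to `0` at the origin). -/
noncomputable def jumpKernel {d : ℕ} (α : ℝ) (z : Vertex d) : ℝ := (eucl z ^ ((d : ℝ) + α))⁻¹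

theorem jumpKernel_nonneg {d : ℕ} (α : ℝ) (z : Vertex d) : 0 ≤ jumpKernel α z :=
  inv_nonneg.2 (Real.rpow_nonneg (eucl_nonneg z) _)

theorem eucl_neg {d : ℕ} (z : Vertex d) : eucl (-z) = eucl z := by
  have : latticePoint 1 (-z) = -latticePoint 1 z := by
    ext i; simp [latticePoint]
  rw [eucl, this, norm_neg, eucl]

theorem jumpKernel_sub_comm {d : ℕ} (α : ℝ) (x y : Vertex d) :
    jumpKernel α (x - y) = jumpKernel α (y - x) := by
  rw [jumpKernel, ← eucl_neg, neg_sub, jumpKernel]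

/-- The normalised kernel of the jumps of length between `r` and `2 * r`, divided by the number of
cubes that see the jump. -/
noncomputable def scaleWeight {d : ℕ} (α : ℝ) (r : ℕ) (x y : Vertex d) : ℝ :=
  if (r : ℝ) ≤ ‖x - y‖ ∧ ‖x - y‖ < 2 * r then
    (r : ℝ) ^ ((d : ℝ) + α) * (2 * r) ^ d * jumpKernel α (x - y) / (commonCorners r x y).card
  else 0

/-- Two factors are at most 1: r^(d+α) times the kernel, as the jump has length at least r, and
(2r)^d over the number of common cubes. Unit-bounded weights are what the operator norm estimate
requires. -/
theorem abs_scaleWeight_le {d : ℕ} {α : ℝ} (hα : 0 < α) {r : ℕ} (hr : 0 < r) (x y : Vertex d) :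
    |scaleWeight α r x y| ≤ 1 := by
  have hr' : (0 : ℝ) < r := by exact_mod_cast hr
  rw [scaleWeight]
  split_ifs with h
  · have hc : ((2 * r : ℝ)) ^ d ≤ (commonCorners r x y).card := by
      exact_mod_cast le_card_commonCorners h.2
    have hc0 : (0 : ℝ) < (commonCorners r x y).card := lt_of_lt_of_le (by positivity) hc
    have hj := jumpKernel_nonneg α (x - y)
    rw [abs_of_nonneg (by positivity), div_le_one hc0]
    have hj2 : (r : ℝ) ^ ((d : ℝ) + α) * jumpKernel α (x - y) ≤ 1 := by
      have he : (r : ℝ) ≤ eucl (x - y) := h.1.trans (norm_le_eucl _)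
      have hp : 0 < eucl (x - y) ^ ((d : ℝ) + α) := Real.rpow_pos_of_pos (hr'.trans_le he) _
      rw [jumpKernel, ← div_eq_mul_inv, div_le_one hp]
      exact Real.rpow_le_rpow hr'.le he (by positivity)
    calc _ = ((r : ℝ) ^ ((d : ℝ) + α) * jumpKernel α (x - y)) * (2 * r) ^ d := by ring
      _ ≤ 1 * (2 * r) ^ d := by gcongr
      _ ≤ _ := by rw [one_mul]; exact hc
  · simp

end Cubes

/-! ### Good cubes: probability estimate and Borel–Cantelli. -/

section GoodCubes

/-- The environment `a` is well behaved on the cube `cube r c`. -/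
structure GoodCube {d : ℕ} (α C₁ : ℝ) (a : Sym2 (Vertex d) → ℝ) (r : ℕ) (c : Vertex d) : Prop where
  opNorm : OpNormBound C₁ a (scaleWeight α r) (cube r c)
  poincare : PoincareOn a (cube r c)

theorem AssumptionH1.measure_not_goodCube_le {d : ℕ} (hd : 0 < d) {α : ℝ} (hα : 0 < α) {Ω : Type*}
    [MeasurableSpace Ω] {P : Measure Ω} [IsProbabilityMeasure P] {C₁ : ℝ}
    {w : Sym2 (Vertex d) → Ω → ℝ} (h : AssumptionH1 P C₁ w) {r : ℕ} (hr : (32 * C₁) ^ 2 ≤ r)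
    (c : Vertex d) :
    P.real {ω | ¬ GoodCube α C₁ (fun e => w e ω) r c} ≤
      (4 + 256 * C₁ ^ 2) * Real.exp (-(1 / (128 * C₁ ^ 2)) * ((4 * r + 1) ^ d : ℕ)) := by
  have hC := h.one_le_bound hd
  have hr0 : 0 < r := by
    have : (0 : ℝ) < r := lt_of_lt_of_le (by positivity) hr
    exact_mod_cast this
  set K := cube r c with hK
  have hcard : K.card = (4 * r + 1) ^ d := card_cube r c
  rw [← hcard]
  set n : ℝ := (K.card : ℝ) with hn
  have hrn : (r : ℝ) ≤ n := by
    have : r ≤ (4 * r + 1) ^ d := le_trans (by omega) (Nat.le_self_pow hd.ne' _)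
    rw [hn, hcard]
    exact_mod_cast this
  have hn0 : 0 < n := lt_of_lt_of_le (by exact_mod_cast hr0) hrn
  have hsqrt : 32 * C₁ ≤ √n := by
    apply Real.le_sqrt_of_sq_le
    exact hr.trans hrn
  let R : ℝ → Vertex d → Set Ω := fun s x =>
    {ω | n / 8 ≤ s * ∑ y ∈ K, if x = y then 0 else (w s(x, y) ω - 1)}
  have hR : ∀ s : ℝ, |s| = 1 → ∀ x ∈ K, P.real (R s x) ≤ Real.exp (-(n / (64 * C₁ ^ 2))) := by
    intro s hs x hx
    -- The weights isolate the row of `x`; S = n and t = n/8 give the exponent n / (64 C₁²).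
    have h1 := h.measure_sum_ge_le K (fun x' _ => if x' = x then s else 0) (S := n) (t := n / 8)
      (by
        have h1 : s ^ 2 = 1 := by rw [← sq_abs, hs, one_pow]
        simp only [ite_pow, h1]
        simp [hx, hn]) (by positivity)
    have e1 : ∀ ω, ∑ x' ∈ K, ∑ y ∈ K, (if x' = y then 0 else
        (w s(x', y) ω - 1) * if x' = x then s else 0) =
        s * ∑ y ∈ K, if x = y then 0 else (w s(x, y) ω - 1) := by
      intro ω
      rw [Finset.sum_eq_single x]
      · rw [Finset.mul_sum]
        refine Finset.sum_congr rfl fun y _ => ?_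
        simp only [if_true]
        split_ifs <;> ring
      · intro x' _ hx'
        simp [hx']
      · exact fun h => absurd hx h
    simp only [e1] at h1
    refine h1.trans (Real.exp_le_exp.2 (le_of_eq ?_))
    field_simp
    ring
  have hsub : {ω | ¬ GoodCube α C₁ (fun e => w e ω) r c} ⊆
      ({ω | ¬ OpNormBound C₁ (fun e => w e ω) (scaleWeight α r) K} ∪
        {ω | ¬ OpNormBound C₁ (fun e => w e ω) (fun _ _ => 1) K}) ∪
        ⋃ x ∈ K, (R 1 x ∪ R (-1) x) := by
    intro ω hω
    by_contra hcon
    rw [Set.mem_union, Set.mem_union, not_or, not_or] at hcon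
    obtain ⟨⟨h1, h2⟩, h3⟩ := hcon
    refine hω ⟨not_not.1 h1, poincareOn_of_opNormBound (not_not.1 h2) (fun x hx => ?_) hsqrt⟩
    by_contra hlt
    push Not at hlt
    apply h3
    rw [Set.mem_iUnion₂]
    refine ⟨x, hx, ?_⟩
    rcases lt_abs.1 hlt with h | h
    · left
      change n / 8 ≤ 1 * _
      rw [one_mul]
      exact h.le
    · right
      change n / 8 ≤ -1 * _
      rw [neg_one_mul]
      exact h.le
  have hop1 := h.measure_not_opNormBound_le hd K (scaleWeight α r)
    (fun x y => abs_scaleWeight_le hα hr0 x y)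
  have hop2 := h.measure_not_opNormBound_le hd K (fun _ _ => 1) (fun _ _ => by simp)
  have hrows : P.real (⋃ x ∈ K, (R 1 x ∪ R (-1) x)) ≤
      n * (2 * Real.exp (-(n / (64 * C₁ ^ 2)))) := by
    refine (measureReal_biUnion_finset_le _ _).trans ?_
    calc _ ≤ ∑ _x ∈ K, 2 * Real.exp (-(n / (64 * C₁ ^ 2))) := by
          refine Finset.sum_le_sum fun x hx => (measureReal_union_le _ _).trans ?_
          have h1 := hR 1 (by simp) x hx
          have h2 := hR (-1) (by simp) x hx
          linarith
      _ = _ := by rw [Finset.sum_const, nsmul_eq_mul]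
  refine (measureReal_mono hsub (measure_ne_top _ _)).trans ?_
  refine (measureReal_union_le _ _).trans ?_
  have hu := measureReal_union_le (μ := P)
    {ω | ¬ OpNormBound C₁ (fun e => w e ω) (scaleWeight α r) K}
    {ω | ¬ OpNormBound C₁ (fun e => w e ω) (fun _ _ => 1) K}
  set q : ℝ := 1 / (128 * C₁ ^ 2) with hq
  have hq0 : 0 < q := by positivity
  have hq3 : q ≤ 3 := by
    rw [hq, div_le_iff₀ (by positivity)]
    nlinarith
  have he1 : Real.exp (-3 * n) ≤ Real.exp (-q * n) := by
    apply Real.exp_le_exp.2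
    nlinarith
  -- The union over the n rows costs a factor n. Half of the exponent absorbs it, since n exp(-qn) ≤
  -- 1/q = 128 C₁².
  have he2 : n * Real.exp (-(n / (64 * C₁ ^ 2))) ≤ 128 * C₁ ^ 2 * Real.exp (-q * n) := by
    have e1 : -(n / (64 * C₁ ^ 2)) = -q * n + -q * n := by
      rw [hq]
      field_simp
      ring
    rw [e1, Real.exp_add, ← mul_assoc]
    refine mul_le_mul_of_nonneg_right ?_ (Real.exp_pos _).le
    have h2 := Real.add_one_le_exp (q * n)
    rw [neg_mul, Real.exp_neg, ← div_eq_mul_inv, div_le_iff₀ (Real.exp_pos _)]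
    have h3 : 128 * C₁ ^ 2 * (q * n) = n := by
      rw [hq]; field_simp
    have h4 : 128 * C₁ ^ 2 * (q * n) ≤ 128 * C₁ ^ 2 * Real.exp (q * n) := by
      gcongr
      linarith
    linarith
  nlinarith

/-- All cubes of side length at least `4 * L` that are not too far from the origin are good. -/
def GoodFrom {d : ℕ} (α C₁ : ℝ) (a : Sym2 (Vertex d) → ℝ) (L : ℕ) : Prop :=
  ∀ r : ℕ, L ≤ r → ∀ c : Vertex d,
    (∀ i, |(c i : ℝ)| ≤ Real.exp ((r : ℝ) ^ d / (128 * C₁ ^ 2 * d)) + 4 * r) →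
      GoodCube α C₁ a r c

/-- The first admissible index is measurable as a least natural number with a measurable property.
Where no index is admissible the value is 0, which keeps the function total. -/
theorem exists_measurable_forall_notMem {Ω : Type*} [MeasurableSpace Ω] (t : ℕ → Set Ω)
    (ht : ∀ n, MeasurableSet (t n)) :
    ∃ L : Ω → ℕ, Measurable L ∧ ∀ ω, (∀ᶠ n in atTop, ω ∉ t n) → ∀ r ≥ L ω, ω ∉ t r := by
  classical
  let q : Ω → Prop := fun ω => ∃ n, ∀ r ≥ n, ω ∉ t r
  let p : Ω → ℕ → Prop := fun ω N => (∀ r ≥ N, ω ∉ t r) ∨ ¬ q ω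
  have hp : ∀ ω, ∃ N, p ω N := by
    intro ω
    by_cases hq : q ω
    · exact hq.imp fun n hn => Or.inl hn
    · exact ⟨0, Or.inr hq⟩
  have hmeas1 : ∀ N, MeasurableSet {ω | ∀ r ≥ N, ω ∉ t r} := by
    intro N
    have : {ω | ∀ r ≥ N, ω ∉ t r} = ⋂ r, ⋂ (_ : r ≥ N), (t r)ᶜ := by
      ext ω; simp
    rw [this]
    exact MeasurableSet.iInter fun r => MeasurableSet.iInter fun _ => (ht r).compl
  have hmeas2 : MeasurableSet {ω | q ω} := by
    have : {ω | q ω} = ⋃ N, {ω | ∀ r ≥ N, ω ∉ t r} := by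
      ext ω; simp [q]
    rw [this]
    exact MeasurableSet.iUnion hmeas1
  refine ⟨fun ω => Nat.find (hp ω), measurable_find hp fun k => (hmeas1 k).union hmeas2.compl, ?_⟩
  intro ω hω r hr
  rcases Nat.find_spec (hp ω) with h | h
  · exact h r hr
  · exact absurd (eventually_atTop.1 hω) h

/-- The box of corners in `GoodFrom` has exponential size chosen so that its cardinality is at most
(11r)^d exp(q r^d) with q = 1/(128 C₁²). A cube is bad with probability O(exp(-q (4r+1)^d)), and
(4r+1)^d ≥ r^d + r leaves the summable bound r^d exp(-q r). -/
theorem AssumptionH1.exists_goodFrom {d : ℕ} (hd : 0 < d) {α : ℝ} (hα : 0 < α) {Ω : Type*}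
    [MeasurableSpace Ω] {P : Measure Ω} [IsProbabilityMeasure P] {C₁ : ℝ}
    {w : Sym2 (Vertex d) → Ω → ℝ} (h : AssumptionH1 P C₁ w) :
    ∃ L : Ω → ℕ, Measurable L ∧ ∀ᵐ ω ∂P, GoodFrom α C₁ (fun e => w e ω) (L ω) := by
  have hC := h.one_le_bound hd
  set q : ℝ := 1 / (128 * C₁ ^ 2) with hq
  have hq0 : 0 < q := by positivity
  let bound : ℕ → ℝ := fun r => Real.exp ((r : ℝ) ^ d / (128 * C₁ ^ 2 * d)) + 4 * r
  let N : ℕ → ℤ := fun r => ⌊bound r⌋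
  let box : ℕ → Finset (Vertex d) := fun r => Finset.Icc (fun _ => -N r) (fun _ => N r)
  let r₀ : ℕ := ⌈(32 * C₁) ^ 2⌉₊ + 1
  let bad : ℕ → Set Ω := fun r => ⋃ c ∈ box r, {ω | ¬ GoodCube α C₁ (fun e => w e ω) r c}
  have hbad : ∀ r, r₀ ≤ r → P.real (bad r) ≤
      (4 + 256 * C₁ ^ 2) * 11 ^ d * ((r : ℝ) ^ d * Real.exp (-q * r)) := by
    intro r hr
    have hr1 : 1 ≤ r := le_trans (by simp [r₀]) hr
    have hr1' : (1 : ℝ) ≤ r := by exact_mod_cast hr1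
    have hrC : (32 * C₁) ^ 2 ≤ r := (Nat.le_ceil _).trans
      (by exact_mod_cast (Nat.le_succ _).trans hr)
    have hb0 : 0 ≤ bound r := by positivity
    have hN0 : 0 ≤ N r := Int.floor_nonneg.2 hb0
    have hcard : ((box r).card : ℝ) ≤ (11 * r * Real.exp ((r : ℝ) ^ d / (128 * C₁ ^ 2 * d))) ^ d := by
      have e1 : (box r).card = (2 * N r + 1).toNat ^ d := by
        simp only [box, Pi.card_Icc, Int.card_Icc]
        rw [Finset.prod_congr rfl (g := fun _ => (2 * N r + 1).toNat) (fun i _ => by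
          congr 1; ring)]
        simp
      have e2 : (((2 * N r + 1).toNat : ℕ) : ℝ) = 2 * N r + 1 := by
        have : (((2 * N r + 1).toNat : ℤ)) = 2 * N r + 1 := Int.toNat_of_nonneg (by omega)
        exact_mod_cast congrArg (Int.cast (R := ℝ)) this
      rw [e1, Nat.cast_pow, e2]
      gcongr
      have h1 : (N r : ℝ) ≤ bound r := Int.floor_le _
      have h2 : 1 ≤ Real.exp ((r : ℝ) ^ d / (128 * C₁ ^ 2 * d)) := Real.one_le_exp (by positivity)
      have h3 : (r : ℝ) * 1 ≤ r * Real.exp ((r : ℝ) ^ d / (128 * C₁ ^ 2 * d)) := by gcongr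
      have h4 : 1 * Real.exp ((r : ℝ) ^ d / (128 * C₁ ^ 2 * d)) ≤
        r * Real.exp ((r : ℝ) ^ d / (128 * C₁ ^ 2 * d)) := by gcongr
      simp only [bound] at h1
      linarith
    have hexp : Real.exp ((r : ℝ) ^ d / (128 * C₁ ^ 2 * d)) ^ d = Real.exp (q * (r : ℝ) ^ d) := by
      rw [← Real.exp_nat_mul]
      congr 1
      have : (d : ℝ) ≠ 0 := by exact_mod_cast hd.ne'
      rw [hq]
      field_simp
    have hpow : (r : ℝ) ^ d + r ≤ (((4 * r + 1) ^ d : ℕ) : ℝ) := by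
      have h1 : r ≤ r ^ d := Nat.le_self_pow hd.ne' _
      have h2 : r ^ d + r ≤ (4 * r + 1) ^ d := by
        calc r ^ d + r ≤ 2 * r ^ d := by omega
          _ ≤ 2 ^ d * r ^ d := by
            gcongr
            exact Nat.le_self_pow hd.ne' _
          _ = (2 * r) ^ d := by rw [mul_pow]
          _ ≤ _ := Nat.pow_le_pow_left (by omega) _
      exact_mod_cast h2
    calc P.real (bad r) ≤ ∑ c ∈ box r, P.real {ω | ¬ GoodCube α C₁ (fun e => w e ω) r c} :=
          measureReal_biUnion_finset_le _ _
      _ ≤ ∑ _c ∈ box r, (4 + 256 * C₁ ^ 2) * Real.exp (-q * ((4 * r + 1) ^ d : ℕ)) :=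
          Finset.sum_le_sum fun c _ => h.measure_not_goodCube_le hd hα hrC c
      _ = ((box r).card : ℝ) * ((4 + 256 * C₁ ^ 2) * Real.exp (-q * ((4 * r + 1) ^ d : ℕ))) := by
          rw [Finset.sum_const, nsmul_eq_mul]
      _ ≤ (11 * r * Real.exp ((r : ℝ) ^ d / (128 * C₁ ^ 2 * d))) ^ d *
            ((4 + 256 * C₁ ^ 2) * Real.exp (-q * ((r : ℝ) ^ d + r))) := by
          gcongr ?_ * (_ * Real.exp ?_)
          nlinarith
      _ = (4 + 256 * C₁ ^ 2) * 11 ^ d * ((r : ℝ) ^ d *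
            (Real.exp (q * (r : ℝ) ^ d) * Real.exp (-q * ((r : ℝ) ^ d + r)))) := by
          rw [mul_pow, mul_pow, hexp]
          ring
      _ = _ := by
          rw [← Real.exp_add]
          congr 4
          ring
  -- The bad events quantify over uncountably many vectors; measurable hulls of equal measure make
  -- their measurability irrelevant. The shift by `r₀` leaves only scales at which the probability
  -- bound holds.
  let t : ℕ → Set Ω := fun r => toMeasurable P (bad (r + r₀))
  obtain ⟨L, hL, hLt⟩ := exists_measurable_forall_notMem t fun r => measurableSet_toMeasurable _ _
  have hsum : ∑' r, P (t r) ≠ ⊤ := by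
    have hs : Summable fun r : ℕ =>
        (4 + 256 * C₁ ^ 2) * 11 ^ d * ((r : ℝ) ^ d * Real.exp (-q * r)) :=
      (Real.summable_pow_mul_exp_neg_nat_mul d hq0).mul_left _
    have hs' := (summable_nat_add_iff r₀).2 hs
    have hle : ∀ r, P (t r) ≤ ENNReal.ofReal ((4 + 256 * C₁ ^ 2) * 11 ^ d *
        (((r + r₀ : ℕ) : ℝ) ^ d * Real.exp (-q * (r + r₀ : ℕ)))) := by
      intro r
      simp only [t, measure_toMeasurable]
      rw [← ENNReal.ofReal_toReal (measure_ne_top P _)]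
      exact ENNReal.ofReal_le_ofReal (hbad _ (by omega))
    refine ne_top_of_le_ne_top ?_ (ENNReal.tsum_le_tsum hle)
    rw [← ENNReal.ofReal_tsum_of_nonneg (fun r => by positivity) hs']
    exact ENNReal.ofReal_ne_top
  refine ⟨fun ω => L ω + r₀, (hL.add_const _), ?_⟩
  filter_upwards [ae_eventually_notMem hsum] with ω hω r hr c hc
  by_contra hnot
  have h1 := hLt ω hω (r - r₀) (by omega)
  apply h1
  apply subset_toMeasurable
  rw [show r - r₀ + r₀ = r by omega]
  refine Set.mem_iUnion₂.2 ⟨c, ?_, hnot⟩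
  simp only [box, Finset.mem_Icc, Pi.le_def, ← forall_and]
  intro i
  have h2 : |c i| ≤ N r := Int.le_floor.2 (by rw [Int.cast_abs]; exact hc i)
  exact abs_le.1 h2

end GoodCubes


/-! ### Scaling of integrals of powers near the origin and near infinity. -/

section Radial

theorem lintegral_comp_smul_space {d : ℕ} {ρ : ℝ} (hρ : 0 < ρ) {f : Space d → ENNReal}
    (hf : Measurable f) :
    ∫⁻ ζ, f ζ = ENNReal.ofReal (ρ ^ d) * ∫⁻ η : Space d, f (ρ • η) := by
  have h := Measure.map_addHaar_smul (volume : Measure (Space d)) hρ.ne'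
  have h1 : ∫⁻ η : Space d, f (ρ • η) = ∫⁻ ζ, f ζ ∂(Measure.map (fun x => ρ • x) volume) :=
    (lintegral_map hf (measurable_const_smul ρ)).symm
  rw [h1, h, lintegral_smul_measure, smul_eq_mul, ← mul_assoc, ← ENNReal.ofReal_mul (by positivity)]
  have : ρ ^ d * |(ρ ^ Module.finrank ℝ (Space d))⁻¹| = 1 := by
    rw [finrank_euclideanSpace_fin, abs_of_pos (by positivity)]
    exact mul_inv_cancel₀ (by positivity)
  rw [this]
  simp

/-- Polar coordinates give finiteness on the unit ball, and homogeneity gives the dependence on the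
radius. -/
theorem exists_lintegral_near_le {d : ℕ} (hd : 0 < d) {β : ℝ} (hβ : β < d) :
    ∃ C : ℝ, 0 < C ∧ ∀ ρ : ℝ, 0 < ρ →
      ∫⁻ ζ : Space d in {ζ | ‖ζ‖ < ρ}, ENNReal.ofReal (‖ζ‖ ^ (-β)) ≤
        ENNReal.ofReal (C * ρ ^ ((d : ℝ) - β)) := by
  have : Nonempty (Fin d) := ⟨⟨0, hd⟩⟩
  have hball : ∀ ρ : ℝ, {ζ : Space d | ‖ζ‖ < ρ} = Metric.ball 0 ρ := by
    intro ρ; ext; simp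
  have hint : IntegrableOn (fun ζ : Space d => ‖ζ‖ ^ (-β)) (Metric.ball 0 1) := by
    rw [integrableOn_fun_norm_addHaar volume (f := fun y => y ^ (-β))]
    have h1 := (intervalIntegral.integrableOn_Ioo_rpow_iff (s := (d : ℝ) - 1 - β)
      zero_lt_one).2 (by linarith)
    refine h1.congr_fun (fun y hy => ?_) measurableSet_Ioo
    change y ^ ((d : ℝ) - 1 - β) = _
    rw [finrank_euclideanSpace_fin, smul_eq_mul, ← Real.rpow_natCast, ← Real.rpow_add hy.1,
      Nat.cast_sub hd, Nat.cast_one, ← sub_eq_add_neg]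
  have hfin : ∫⁻ ζ : Space d in {ζ | ‖ζ‖ < 1}, ENNReal.ofReal (‖ζ‖ ^ (-β)) ≠ ⊤ := by
    rw [hball]
    exact hint.lintegral_lt_top.ne
  set c := (∫⁻ ζ : Space d in {ζ | ‖ζ‖ < 1}, ENNReal.ofReal (‖ζ‖ ^ (-β))).toReal with hc
  refine ⟨c + 1, by positivity, fun ρ hρ => ?_⟩
  have hm : ∀ ρ : ℝ, MeasurableSet {ζ : Space d | ‖ζ‖ < ρ} := fun ρ => by
    rw [hball]; exact measurableSet_ball
  rw [← lintegral_indicator (hm ρ), lintegral_comp_smul_space hρ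
    (Measurable.indicator (by fun_prop) (hm ρ))]
  have e1 : ∀ η : Space d, {ζ : Space d | ‖ζ‖ < ρ}.indicator
      (fun ζ => ENNReal.ofReal (‖ζ‖ ^ (-β))) (ρ • η) = ENNReal.ofReal (ρ ^ (-β)) *
      {ζ : Space d | ‖ζ‖ < 1}.indicator (fun ζ => ENNReal.ofReal (‖ζ‖ ^ (-β))) η := by
    intro η
    have hmem : ρ • η ∈ {ζ : Space d | ‖ζ‖ < ρ} ↔ η ∈ {ζ : Space d | ‖ζ‖ < 1} := by
      change ‖ρ • η‖ < ρ ↔ ‖η‖ < 1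
      rw [norm_smul, Real.norm_of_nonneg hρ.le]
      exact mul_lt_iff_lt_one_right hρ
    by_cases h : η ∈ {ζ : Space d | ‖ζ‖ < 1}
    · rw [Set.indicator_of_mem h, Set.indicator_of_mem (hmem.2 h),
        ← ENNReal.ofReal_mul (by positivity), norm_smul, Real.norm_of_nonneg hρ.le,
        Real.mul_rpow hρ.le (norm_nonneg _)]
    · rw [Set.indicator_of_notMem h, Set.indicator_of_notMem (fun h' => h (hmem.1 h')), mul_zero]
  simp only [e1]
  rw [lintegral_const_mul _ (Measurable.indicator (by fun_prop) (hm 1)),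
    lintegral_indicator (hm 1), ← ENNReal.ofReal_toReal hfin, ← hc,
    ← ENNReal.ofReal_mul (by positivity), ← ENNReal.ofReal_mul (by positivity)]
  apply ENNReal.ofReal_le_ofReal
  have e2 : ρ ^ ((d : ℝ) - β) = ρ ^ d * ρ ^ (-β) := by
    rw [← Real.rpow_natCast, ← Real.rpow_add hρ]
    congr 1
  rw [e2]
  have : 0 ≤ ρ ^ d * ρ ^ (-β) := by positivity
  nlinarith

theorem exists_lintegral_far_le {d : ℕ} {β : ℝ} (hβ : (d : ℝ) < β) :
    ∃ C : ℝ, 0 < C ∧ ∀ ρ : ℝ, 0 < ρ →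
      ∫⁻ ζ : Space d in {ζ | ρ ≤ ‖ζ‖}, ENNReal.ofReal (‖ζ‖ ^ (-β)) ≤
        ENNReal.ofReal (C * ρ ^ ((d : ℝ) - β)) := by
  have hm : ∀ ρ : ℝ, MeasurableSet {ζ : Space d | ρ ≤ ‖ζ‖} := fun ρ =>
    measurableSet_le measurable_const measurable_norm
  have hint : IntegrableOn (fun ζ : Space d => ‖ζ‖ ^ (-β)) {ζ | 1 ≤ ‖ζ‖} := by
    have h1 : Integrable (fun ζ : Space d => 2 ^ β * (1 + ‖ζ‖) ^ (-β)) :=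
      (integrable_one_add_norm (by rwa [finrank_euclideanSpace_fin])).const_mul _
    refine Integrable.mono' h1.integrableOn
      (measurable_norm.pow_const _).aestronglyMeasurable ?_
    filter_upwards [ae_restrict_mem (hm 1)] with ζ hζ
    have hζ' : 1 ≤ ‖ζ‖ := hζ
    have hβ0 : 0 ≤ β := (Nat.cast_nonneg d).trans hβ.le
    rw [Real.norm_of_nonneg (by positivity), Real.rpow_neg (by positivity),
      Real.rpow_neg (by positivity), ← div_eq_mul_inv, le_div_iff₀ (by positivity),
      inv_mul_le_iff₀ (by positivity), ← Real.mul_rpow (by positivity) (by positivity)]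
    exact Real.rpow_le_rpow (by positivity) (by linarith) hβ0
  have hfin : ∫⁻ ζ : Space d in {ζ | 1 ≤ ‖ζ‖}, ENNReal.ofReal (‖ζ‖ ^ (-β)) ≠ ⊤ :=
    hint.lintegral_lt_top.ne
  set c := (∫⁻ ζ : Space d in {ζ | 1 ≤ ‖ζ‖}, ENNReal.ofReal (‖ζ‖ ^ (-β))).toReal with hc
  refine ⟨c + 1, by positivity, fun ρ hρ => ?_⟩
  rw [← lintegral_indicator (hm ρ), lintegral_comp_smul_space hρ
    (Measurable.indicator (by fun_prop) (hm ρ))]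
  have e1 : ∀ η : Space d, {ζ : Space d | ρ ≤ ‖ζ‖}.indicator
      (fun ζ => ENNReal.ofReal (‖ζ‖ ^ (-β))) (ρ • η) = ENNReal.ofReal (ρ ^ (-β)) *
      {ζ : Space d | 1 ≤ ‖ζ‖}.indicator (fun ζ => ENNReal.ofReal (‖ζ‖ ^ (-β))) η := by
    intro η
    have hmem : ρ • η ∈ {ζ : Space d | ρ ≤ ‖ζ‖} ↔ η ∈ {ζ : Space d | 1 ≤ ‖ζ‖} := by
      change ρ ≤ ‖ρ • η‖ ↔ 1 ≤ ‖η‖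
      rw [norm_smul, Real.norm_of_nonneg hρ.le]
      exact le_mul_iff_one_le_right hρ
    by_cases h : η ∈ {ζ : Space d | 1 ≤ ‖ζ‖}
    · rw [Set.indicator_of_mem h, Set.indicator_of_mem (hmem.2 h),
        ← ENNReal.ofReal_mul (by positivity), norm_smul, Real.norm_of_nonneg hρ.le,
        Real.mul_rpow hρ.le (norm_nonneg _)]
    · rw [Set.indicator_of_notMem h, Set.indicator_of_notMem (fun h' => h (hmem.1 h')), mul_zero]
  simp only [e1]
  rw [lintegral_const_mul _ (Measurable.indicator (by fun_prop) (hm 1)),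
    lintegral_indicator (hm 1), ← ENNReal.ofReal_toReal hfin, ← hc,
    ← ENNReal.ofReal_mul (by positivity), ← ENNReal.ofReal_mul (by positivity)]
  apply ENNReal.ofReal_le_ofReal
  have e2 : ρ ^ ((d : ℝ) - β) = ρ ^ d * ρ ^ (-β) := by
    rw [← Real.rpow_natCast, ← Real.rpow_add hρ]
    congr 1
  rw [e2]
  have : 0 ≤ ρ ^ d * ρ ^ (-β) := by positivity
  nlinarith

end Radial

/-! ### Lattice cells and the passage between sums and integrals. -/

section Cells

/-- The index of the cell `∏ i, (z i / k, (z i + 1) / k]` that contains `x`. -/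
noncomputable def cellIndex {d : ℕ} (k : ℕ) (x : Space d) : Vertex d :=
  fun i => ⌈(k : ℝ) * x i⌉ - 1

theorem measurable_cellIndex {d : ℕ} (k : ℕ) : Measurable (cellIndex (d := d) k) := by
  refine measurable_pi_lambda _ fun i => ?_
  have h1 : Measurable fun x : Space d => ⌈(k : ℝ) * x i⌉ :=
    Int.measurable_ceil.comp (by fun_prop)
  exact (measurable_of_countable (fun n : ℤ => n - 1)).comp h1

theorem volume_cellIndex_preimage {d : ℕ} {k : ℕ} (hk : 0 < k) (z : Vertex d) :
    volume (cellIndex k ⁻¹' {z}) = ENNReal.ofReal (((k : ℝ) ^ d)⁻¹) := by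
  have hk' : (0 : ℝ) < k := by exact_mod_cast hk
  have e : cellIndex k ⁻¹' {z} = (WithLp.ofLp : Space d → Fin d → ℝ) ⁻¹'
      (Set.univ.pi fun i => Set.Ioc ((z i : ℝ) / k) (((z i : ℝ) + 1) / k)) := by
    ext x
    simp only [Set.mem_preimage, Set.mem_singleton_iff, Set.mem_pi, Set.mem_univ, true_imp_iff,
      Set.mem_Ioc, funext_iff, cellIndex]
    refine forall_congr' fun i => ?_
    rw [sub_eq_iff_eq_add, Int.ceil_eq_iff, div_lt_iff₀ hk', le_div_iff₀ hk']
    push_cast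
    rw [add_sub_cancel_right, mul_comm]
  rw [e, (PiLp.volume_preserving_ofLp (Fin d)).measure_preimage
    (MeasurableSet.univ_pi fun i => measurableSet_Ioc).nullMeasurableSet, Real.volume_pi_Ioc]
  have : ∀ i, ((z i : ℝ) + 1) / k - (z i : ℝ) / k = (k : ℝ)⁻¹ := by
    intro i; field_simp; ring
  simp only [this]
  rw [Finset.prod_const, ← ENNReal.ofReal_pow (by positivity)]
  simp

/-- All cells have volume k^(-d). This identity turns lattice sums into integrals, so that sums of
kernels and Riemann sum errors are estimated by integrals over space. -/
theorem lintegral_comp_cellIndex {d : ℕ} {k : ℕ} (hk : 0 < k) (ψ : Vertex d → ENNReal) :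
    ∫⁻ x, ψ (cellIndex k x) = ENNReal.ofReal (((k : ℝ) ^ d)⁻¹) * ∑' z, ψ z := by
  rw [← lintegral_map (measurable_of_countable ψ) (measurable_cellIndex k), lintegral_countable',
    ← ENNReal.tsum_mul_left]
  refine tsum_congr fun z => ?_
  rw [Measure.map_apply (measurable_cellIndex k) (measurableSet_singleton z),
    volume_cellIndex_preimage hk, mul_comm]

theorem norm_sub_latticePoint_cellIndex_le {d : ℕ} {k : ℕ} (hk : 0 < k) (x : Space d) :
    ‖x - latticePoint k (cellIndex k x)‖ ≤ d / k := by
  have hk' : (0 : ℝ) < k := by exact_mod_cast hk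
  have h := norm_sum_le (Finset.univ : Finset (Fin d))
    (fun i => EuclideanSpace.single i ((x - latticePoint k (cellIndex k x)) i))
  have e : ∑ i, EuclideanSpace.single i ((x - latticePoint k (cellIndex k x)) i) =
      x - latticePoint k (cellIndex k x) := by
    ext j
    simp [Finset.sum_apply]
  rw [e] at h
  refine h.trans ?_
  calc _ ≤ ∑ _i : Fin d, (1 : ℝ) / k := by
        refine Finset.sum_le_sum fun i _ => ?_
        rw [PiLp.norm_single, Real.norm_eq_abs]
        have h1 := Int.le_ceil ((k : ℝ) * x i)
        have h2 := Int.ceil_lt_add_one ((k : ℝ) * x i)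
        have h3 : (x - latticePoint k (cellIndex k x)) i =
            ((k : ℝ) * x i - ⌈(k : ℝ) * x i⌉ + 1) / k := by
          simp only [PiLp.sub_apply, latticePoint, cellIndex]
          push_cast
          field_simp
          ring
        rw [h3, abs_of_nonneg (div_nonneg (by linarith) hk'.le)]
        gcongr
        linarith
    _ = _ := by simp [div_eq_mul_inv]

theorem norm_latticePoint {d : ℕ} (k : ℕ) (z : Vertex d) : ‖latticePoint k z‖ = eucl z / k := by
  have : latticePoint k z = (k : ℝ)⁻¹ • latticePoint 1 z := by
    ext i; simp [latticePoint, div_eq_inv_mul]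
  rw [this, norm_smul, eucl, norm_inv, Real.norm_natCast, inv_mul_eq_div]

theorem latticePoint_sub {d : ℕ} (k : ℕ) (x y : Vertex d) :
    latticePoint k x - latticePoint k y = latticePoint k (x - y) := by
  ext i; simp [latticePoint, sub_div]

theorem one_le_norm_of_ne_zero {d : ℕ} {z : Vertex d} (hz : z ≠ 0) : 1 ≤ ‖z‖ := by
  obtain ⟨i, hi⟩ := Function.ne_iff.1 hz
  refine le_trans ?_ (abs_coord_le_norm z i)
  have : 1 ≤ |z i| := Int.one_le_abs hi
  exact_mod_cast this

theorem one_le_eucl_of_ne_zero {d : ℕ} {z : Vertex d} (hz : z ≠ 0) : 1 ≤ eucl z :=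
  (one_le_norm_of_ne_zero hz).trans (norm_le_eucl z)

@[simp] theorem eucl_zero {d : ℕ} : eucl (0 : Vertex d) = 0 := by
  have : latticePoint 1 (0 : Vertex d) = 0 := by ext i; simp [latticePoint]
  simp [eucl, this]

theorem jumpKernel_zero {d : ℕ} {α : ℝ} (hα : 0 < α) : jumpKernel α (0 : Vertex d) = 0 := by
  rw [jumpKernel, eucl_zero, Real.zero_rpow (by positivity), inv_zero]

/-- Away from the cell of the origin the lattice point has norm at least 1, which absorbs the cell
diameter; lattice kernels are then dominated pointwise by continuous ones. -/
theorem norm_le_mul_eucl_cellIndex {d : ℕ} {ζ : Space d} (h : cellIndex 1 ζ ≠ 0) :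
    1 + ‖ζ‖ ≤ (2 + d) * eucl (cellIndex 1 ζ) := by
  have h1 := norm_sub_latticePoint_cellIndex_le one_pos ζ
  have h2 := one_le_eucl_of_ne_zero h
  have h3 : ‖ζ‖ ≤ ‖ζ - latticePoint 1 (cellIndex 1 ζ)‖ + eucl (cellIndex 1 ζ) := by
    rw [eucl]
    simpa using norm_add_le (ζ - latticePoint 1 (cellIndex 1 ζ)) (latticePoint 1 (cellIndex 1 ζ))
  have h4 : (d : ℝ) * 1 ≤ d * eucl (cellIndex 1 ζ) := by gcongr
  simp only [Nat.cast_one, div_one] at h1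
  linarith

theorem summable_jumpKernel {d : ℕ} {α : ℝ} (hα : 0 < α) :
    Summable fun z : Vertex d => jumpKernel α z := by
  have hβ : 0 < (d : ℝ) + α := by positivity
  have key : ∑' z : Vertex d, ENNReal.ofReal (jumpKernel α z) ≠ ⊤ := by
    have h1 := lintegral_comp_cellIndex (d := d) one_pos
      (fun z => ENNReal.ofReal (jumpKernel α z))
    simp only [Nat.cast_one, one_pow, inv_one, ENNReal.ofReal_one, one_mul] at h1
    rw [← h1]
    have h2 : Integrable (fun ζ : Space d =>
        (2 + d : ℝ) ^ ((d : ℝ) + α) * (1 + ‖ζ‖) ^ (-((d : ℝ) + α))) :=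
      (integrable_one_add_norm (by rw [finrank_euclideanSpace_fin]; linarith)).const_mul _
    refine ne_top_of_le_ne_top h2.lintegral_lt_top.ne (lintegral_mono fun ζ => ?_)
    apply ENNReal.ofReal_le_ofReal
    by_cases hz : cellIndex 1 ζ = 0
    · rw [hz, jumpKernel_zero hα]
      positivity
    · have h3 := norm_le_mul_eucl_cellIndex hz
      have h4 := one_le_eucl_of_ne_zero hz
      rw [jumpKernel, Real.rpow_neg (by positivity), ← div_eq_mul_inv,
        le_div_iff₀ (by positivity), inv_mul_le_iff₀ (by positivity), mul_comm,
        ← Real.mul_rpow (by positivity) (by positivity)]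
      exact Real.rpow_le_rpow (by positivity) h3 hβ.le
  have := ENNReal.summable_toReal key
  refine this.congr fun z => ?_
  rw [ENNReal.toReal_ofReal (jumpKernel_nonneg α z)]

end Cells


/-! ### Sums of the jump kernel and summation by parts. -/

section KernelSums

theorem exists_sum_near_le {d : ℕ} (hd : 0 < d) {α : ℝ} (hα : 0 < α) (hα2 : α < 2) :
    ∃ C : ℝ, 0 < C ∧ ∀ M : ℝ, 0 < M → ∀ s : Finset (Vertex d), (∀ z ∈ s, ‖z‖ < M) →
      ∑ z ∈ s, eucl z ^ 2 * jumpKernel α z ≤ C * M ^ (2 - α) := by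
  have hd' : (1 : ℝ) ≤ d := by exact_mod_cast hd
  have : Nonempty (Fin d) := ⟨⟨0, hd⟩⟩
  -- The summand is |z|^(2-d-α), whose exponent may have either sign. It is split as |z|^(1-α/2)
  -- |z|^(-β): the first factor is at most its value at the maximal radius, and β > 0 allows
  -- comparison of the second with the integral cell by cell.
  set β : ℝ := d - (1 - α / 2) with hβ
  have hβ0 : 0 < β := by rw [hβ]; linarith
  obtain ⟨C, hC, hCb⟩ := exists_lintegral_near_le hd (β := β) (by rw [hβ]; linarith)
  set D : ℝ := (2 + d) * d with hD
  have hD0 : 0 < D := by positivity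
  refine ⟨(d : ℝ) ^ (1 - α / 2) * (2 + d) ^ β * (C * D ^ (1 - α / 2)), by positivity,
    fun M hM s hs => ?_⟩
  have key : ∑' z : Vertex d, ENNReal.ofReal
      (if z ∈ s then eucl z ^ 2 * jumpKernel α z else 0) ≤
      ENNReal.ofReal ((d : ℝ) ^ (1 - α / 2) * (2 + d) ^ β * (C * D ^ (1 - α / 2)) *
        M ^ (2 - α)) := by
    have h1 := lintegral_comp_cellIndex (d := d) one_pos
      (fun z => ENNReal.ofReal (if z ∈ s then eucl z ^ 2 * jumpKernel α z else 0))
    simp only [Nat.cast_one, one_pow, inv_one, ENNReal.ofReal_one, one_mul] at h1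
    rw [← h1]
    have h0 : ∀ᵐ ζ : Space d, ζ ≠ 0 := by
      have := measure_singleton (μ := (volume : Measure (Space d))) 0
      exact compl_mem_ae_iff.2 this
    have hm : MeasurableSet {ζ : Space d | ‖ζ‖ < D * M} :=
      measurableSet_lt measurable_norm measurable_const
    calc ∫⁻ ζ : Space d, ENNReal.ofReal (if cellIndex 1 ζ ∈ s then
          eucl (cellIndex 1 ζ) ^ 2 * jumpKernel α (cellIndex 1 ζ) else 0)
        ≤ ∫⁻ ζ : Space d, ENNReal.ofReal ((d * M) ^ (1 - α / 2) * (2 + d) ^ β) *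
            {ζ : Space d | ‖ζ‖ < D * M}.indicator (fun ζ => ENNReal.ofReal (‖ζ‖ ^ (-β))) ζ := by
          refine lintegral_mono_ae ?_
          filter_upwards [h0] with ζ hζ
          split_ifs with hzs
          · by_cases hz : cellIndex 1 ζ = 0
            · rw [hz]; simp
            have h3 := norm_le_mul_eucl_cellIndex hz
            have h4 := one_le_eucl_of_ne_zero hz
            have h5 : eucl (cellIndex 1 ζ) ≤ d * M := (eucl_le _).trans (by
              gcongr
              exact (hs _ hzs).le)
            have h6 : ‖ζ‖ < D * M := by
              have : (2 + d : ℝ) * eucl (cellIndex 1 ζ) ≤ (2 + d) * (d * M) := by gcongr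
              rw [hD]
              linarith
            have h7 : 0 < ‖ζ‖ := norm_pos_iff.2 hζ
            rw [Set.indicator_of_mem (show ζ ∈ {ζ : Space d | ‖ζ‖ < D * M} from h6),
              ← ENNReal.ofReal_mul (by positivity)]
            apply ENNReal.ofReal_le_ofReal
            set e := eucl (cellIndex 1 ζ)
            have he : 0 < e := by linarith
            have e1 : e ^ 2 * jumpKernel α (cellIndex 1 ζ) = e ^ (1 - α / 2) * e ^ (-β) := by
              rw [jumpKernel, ← Real.rpow_natCast, ← Real.rpow_neg he.le, ← Real.rpow_add he,
                ← Real.rpow_add he, hβ]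
              congr 1
              push_cast
              ring
            rw [e1, mul_assoc]
            have e2 : e ^ (1 - α / 2) ≤ (d * M) ^ (1 - α / 2) :=
              Real.rpow_le_rpow he.le h5 (by linarith)
            have e3 : e ^ (-β) ≤ (2 + d) ^ β * ‖ζ‖ ^ (-β) := by
              rw [Real.rpow_neg he.le, Real.rpow_neg h7.le, ← div_eq_mul_inv,
                le_div_iff₀ (by positivity), inv_mul_le_iff₀ (by positivity), mul_comm,
                ← Real.mul_rpow (by positivity) (by positivity)]
              exact Real.rpow_le_rpow h7.le (by linarith) hβ0.le
            gcongr
          · simp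
      _ ≤ ENNReal.ofReal ((d * M) ^ (1 - α / 2) * (2 + d) ^ β) *
            ENNReal.ofReal (C * (D * M) ^ ((d : ℝ) - β)) := by
          rw [lintegral_const_mul _ (Measurable.indicator (by fun_prop) hm),
            lintegral_indicator hm]
          gcongr
          exact hCb _ (by positivity)
      _ = _ := by
          rw [← ENNReal.ofReal_mul (by positivity)]
          congr 1
          have e4 : (d : ℝ) - β = 1 - α / 2 := by rw [hβ]; ring
          have e5 : M ^ (2 - α) = M ^ (1 - α / 2) * M ^ (1 - α / 2) := by
            rw [← Real.rpow_add hM]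
            congr 1
            ring
          rw [e4, e5, Real.mul_rpow (by positivity) hM.le, Real.mul_rpow hD0.le hM.le]
          ring
  have h2 : ∑ z ∈ s, ENNReal.ofReal (eucl z ^ 2 * jumpKernel α z) ≤
      ∑' z : Vertex d, ENNReal.ofReal (if z ∈ s then eucl z ^ 2 * jumpKernel α z else 0) := by
    refine le_trans (le_of_eq (Finset.sum_congr rfl fun z hz => ?_)) (ENNReal.sum_le_tsum s)
    rw [if_pos hz]
  have h3 := h2.trans key
  rw [← ENNReal.ofReal_sum_of_nonneg fun z _ =>
    mul_nonneg (sq_nonneg _) (jumpKernel_nonneg α z)] at h3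
  exact (ENNReal.ofReal_le_ofReal_iff (by positivity)).1 h3

variable {d : ℕ} {α : ℝ}

/-- The shear `(x, y) ↦ (x, x - y)`. -/
def shearEquiv (d : ℕ) : Vertex d × Vertex d ≃ Vertex d × Vertex d :=
  (Equiv.refl _).prodShear fun x => Equiv.subLeft x

theorem hasSum_kernel_fst (hα : 0 < α) {u : Vertex d → ℝ} (hu : Summable fun z => u z ^ 2) :
    HasSum (fun p : Vertex d × Vertex d => u p.1 ^ 2 * jumpKernel α (p.1 - p.2))
      ((∑' z, u z ^ 2) * ∑' z : Vertex d, jumpKernel α z) := by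
  have h := hu.mul_of_nonneg (summable_jumpKernel (d := d) hα) (fun _ => sq_nonneg _)
    (fun z => jumpKernel_nonneg α z)
  have h1 : HasSum (fun p : Vertex d × Vertex d => u p.1 ^ 2 * jumpKernel α p.2)
      ((∑' z, u z ^ 2) * ∑' z : Vertex d, jumpKernel α z) :=
    hu.hasSum.mul (summable_jumpKernel (d := d) hα).hasSum h
  have h2 := (shearEquiv d).hasSum_iff.2 h1
  exact h2

theorem hasSum_kernel_snd (hα : 0 < α) {u : Vertex d → ℝ} (hu : Summable fun z => u z ^ 2) :
    HasSum (fun p : Vertex d × Vertex d => u p.2 ^ 2 * jumpKernel α (p.1 - p.2))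
      ((∑' z, u z ^ 2) * ∑' z : Vertex d, jumpKernel α z) := by
  have h0 := hasSum_kernel_fst hα hu
  have h := (Equiv.prodComm (Vertex d) (Vertex d)).hasSum_iff.2 h0
  refine h.congr_fun fun p => ?_
  simp [jumpKernel_sub_comm α p.1 p.2]

/-- The single criterion behind the double series below: a shear of ℤ^d × ℤ^d turns the majorant
into a product of an ℓ¹ function and the summable kernel. -/
theorem summable_of_kernel_bound (hα : 0 < α) {u v : Vertex d → ℝ}
    (hu : Summable fun z => u z ^ 2) (hv : Summable fun z => v z ^ 2)
    {F : Vertex d × Vertex d → ℝ} {C : ℝ}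
    (hF : ∀ p, |F p| ≤ C * ((u p.1 ^ 2 + u p.2 ^ 2 + v p.1 ^ 2 + v p.2 ^ 2) *
      jumpKernel α (p.1 - p.2))) : Summable F := by
  have h := ((((hasSum_kernel_fst hα hu).add (hasSum_kernel_snd hα hu)).add
    (hasSum_kernel_fst hα hv)).add (hasSum_kernel_snd hα hv)).summable.mul_left C
  refine Summable.of_norm_bounded h fun p => ?_
  rw [Real.norm_eq_abs]
  refine (hF p).trans (le_of_eq ?_)
  ring

/-- Summation by parts for a symmetric kernel. -/
theorem tsum_mul_tsum_sub_eq (hα : 0 < α) {b : Vertex d → Vertex d → ℝ} {C : ℝ}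
    (hb : ∀ x y, |b x y| ≤ C * jumpKernel α (x - y)) (hsymm : ∀ x y, b x y = b y x)
    {u v : Vertex d → ℝ} (hu : Summable fun z => u z ^ 2) (hv : Summable fun z => v z ^ 2) :
    HasSum (fun x => v x * ∑' y, (u y - u x) * b x y)
      (-(1 / 2) * ∑' p : Vertex d × Vertex d, b p.1 p.2 * ((u p.2 - u p.1) * (v p.2 - v p.1))) := by
  set F : Vertex d × Vertex d → ℝ := fun p => v p.1 * ((u p.2 - u p.1) * b p.1 p.2) with hF
  have hFs : Summable F := by
    refine summable_of_kernel_bound (C := C) hα hu hv fun p => ?_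
    rw [hF, abs_mul, abs_mul]
    calc |v p.1| * (|u p.2 - u p.1| * |b p.1 p.2|)
        ≤ |v p.1| * (|u p.2 - u p.1| * (C * jumpKernel α (p.1 - p.2))) := by
          gcongr; exact hb _ _
      _ = (|v p.1| * |u p.2 - u p.1|) * (C * jumpKernel α (p.1 - p.2)) := by ring
      _ ≤ (u p.1 ^ 2 + u p.2 ^ 2 + v p.1 ^ 2 + v p.2 ^ 2) * (C * jumpKernel α (p.1 - p.2)) := by
          have h0 : 0 ≤ C * jumpKernel α (p.1 - p.2) := (abs_nonneg _).trans (hb p.1 p.2)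
          refine mul_le_mul_of_nonneg_right ?_ h0
          rw [← abs_mul, abs_le]
          constructor <;> nlinarith [sq_nonneg (v p.1 - u p.2), sq_nonneg (v p.1 + u p.2),
            sq_nonneg (v p.1 - u p.1), sq_nonneg (v p.1 + u p.1), sq_nonneg (v p.2)]
      _ = _ := by ring
  have hsw : ∑' p : Vertex d × Vertex d, F p.swap = ∑' p, F p := (Equiv.prodComm (Vertex d) (Vertex d)).tsum_eq F
  have hsws : Summable fun p : Vertex d × Vertex d => F p.swap := by
    have h := (Equiv.prodComm (Vertex d) (Vertex d)).summable_iff.2 hFs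
    exact h
  -- By the symmetry of b, the symmetric form is minus the sum of `F` and its swap, and these have
  -- equal sums.
  have h2 : -(1 / 2) * ∑' p : Vertex d × Vertex d,
      b p.1 p.2 * ((u p.2 - u p.1) * (v p.2 - v p.1)) = ∑' p, F p := by
    have : ∑' p : Vertex d × Vertex d, b p.1 p.2 * ((u p.2 - u p.1) * (v p.2 - v p.1)) =
        -(∑' p : Vertex d × Vertex d, F p.swap + ∑' p, F p) := by
      rw [← hsws.tsum_add hFs, ← tsum_neg]
      refine tsum_congr fun p => ?_
      simp only [hF, Prod.fst_swap, Prod.snd_swap, hsymm p.2 p.1]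
      ring
    rw [this, hsw]
    ring
  rw [h2]
  have h3 := hFs.prod
  have h4 := hFs.tsum_prod
  have h5 : ∀ x, ∑' y, F (x, y) = v x * ∑' y, (u y - u x) * b x y := fun x => by
    simp only [hF]
    exact tsum_mul_left
  simp only [h5] at h3 h4
  rw [h4]
  exact h3.hasSum

end KernelSums

/-! ### The lattice operator, its energy identity, and uniqueness. -/

section LatticeOperator

/-- Off the diagonal, the environment `a` takes values in `[0, C₁]`. -/
structure BoundedEnv {d : ℕ} (C₁ : ℝ) (a : Sym2 (Vertex d) → ℝ) : Prop where
  nonneg : ∀ x y, x ≠ y → 0 ≤ a s(x, y)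
  le : ∀ x y, x ≠ y → a s(x, y) ≤ C₁

variable {d : ℕ} {α C₁ : ℝ} {a : Sym2 (Vertex d) → ℝ}

/-- The jump rates in the environment `a`. -/
noncomputable def jumpRate (α : ℝ) (a : Sym2 (Vertex d) → ℝ) (x y : Vertex d) : ℝ :=
  a s(x, y) * jumpKernel α (x - y)

theorem jumpRate_comm (x y : Vertex d) : jumpRate α a x y = jumpRate α a y x := by
  rw [jumpRate, jumpRate, Sym2.eq_swap, jumpKernel_sub_comm]

theorem BoundedEnv.jumpRate_nonneg (ha : BoundedEnv C₁ a) (hα : 0 < α) (x y : Vertex d) :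
    0 ≤ jumpRate α a x y := by
  rw [jumpRate]
  rcases eq_or_ne x y with rfl | h
  · rw [sub_self, jumpKernel_zero hα, mul_zero]
  · exact mul_nonneg (ha.nonneg x y h) (jumpKernel_nonneg _ _)

theorem BoundedEnv.jumpRate_le (ha : BoundedEnv C₁ a) (hα : 0 < α) (x y : Vertex d) :
    jumpRate α a x y ≤ C₁ * jumpKernel α (x - y) := by
  rw [jumpRate]
  rcases eq_or_ne x y with rfl | h
  · rw [sub_self, jumpKernel_zero hα, mul_zero, mul_zero]
  · exact mul_le_mul_of_nonneg_right (ha.le x y h) (jumpKernel_nonneg _ _)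

theorem BoundedEnv.abs_jumpRate_le (ha : BoundedEnv C₁ a) (hα : 0 < α) (x y : Vertex d) :
    |jumpRate α a x y| ≤ C₁ * jumpKernel α (x - y) := by
  rw [abs_of_nonneg (ha.jumpRate_nonneg hα x y)]
  exact ha.jumpRate_le hα x y

/-- The Dirichlet energy of `v` in the environment `a`, at scale one. -/
noncomputable def energy (α : ℝ) (a : Sym2 (Vertex d) → ℝ) (v : Vertex d → ℝ) : ℝ :=
  (1 / 2) * ∑' p : Vertex d × Vertex d, jumpRate α a p.1 p.2 * (v p.2 - v p.1) ^ 2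

theorem BoundedEnv.energy_nonneg (ha : BoundedEnv C₁ a) (hα : 0 < α) (v : Vertex d → ℝ) :
    0 ≤ energy α a v :=
  mul_nonneg (by norm_num) (tsum_nonneg fun p =>
    mul_nonneg (ha.jumpRate_nonneg hα _ _) (sq_nonneg _))

theorem BoundedEnv.summable_energy (ha : BoundedEnv C₁ a) (hα : 0 < α) {v : Vertex d → ℝ}
    (hv : Summable fun z => v z ^ 2) :
    Summable fun p : Vertex d × Vertex d => jumpRate α a p.1 p.2 * (v p.2 - v p.1) ^ 2 := by
  refine summable_of_kernel_bound (C := C₁) hα hv hv fun p => ?_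
  have h1 := ha.abs_jumpRate_le hα p.1 p.2
  rw [abs_mul, abs_of_nonneg (sq_nonneg (v p.2 - v p.1))]
  calc |jumpRate α a p.1 p.2| * (v p.2 - v p.1) ^ 2
      ≤ C₁ * jumpKernel α (p.1 - p.2) * (v p.2 - v p.1) ^ 2 := by gcongr
    _ ≤ C₁ * jumpKernel α (p.1 - p.2) * (v p.1 ^ 2 + v p.2 ^ 2 + v p.1 ^ 2 + v p.2 ^ 2) := by
        refine mul_le_mul_of_nonneg_left ?_ ((abs_nonneg _).trans h1)
        nlinarith [sq_nonneg (v p.2 + v p.1)]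
    _ = _ := by ring

/-- Rescaling to the unit lattice: k^(-d) times the factor k^(d+α) from the kernel. All later
estimates take place on ℤ^d with the factor k^α kept explicit. -/
theorem latticeOp_eq {k : ℕ} (hk : 0 < k) (u : Vertex d → ℝ) (x : Vertex d) :
    latticeOp α a k u x = (k : ℝ) ^ α * ∑' y, (u y - u x) * jumpRate α a x y := by
  have hk' : (0 : ℝ) < k := by exact_mod_cast hk
  rw [latticeOp, ← tsum_mul_left, ← tsum_mul_left]
  refine tsum_congr fun y => ?_
  rw [latticePoint_sub, norm_latticePoint, Real.div_rpow (eucl_nonneg _) hk'.le,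
    Real.rpow_add hk', Real.rpow_natCast, jumpRate, jumpKernel]
  have : (k : ℝ) ^ d ≠ 0 := by positivity
  have : (k : ℝ) ^ α ≠ 0 := by positivity
  rw [div_div_eq_mul_div]
  field_simp

/-- The energy identity. -/
theorem BoundedEnv.hasSum_mul_latticeOp (ha : BoundedEnv C₁ a) (hα : 0 < α) {k : ℕ} (hk : 0 < k)
    {u v : Vertex d → ℝ} (hu : Summable fun z => u z ^ 2) (hv : Summable fun z => v z ^ 2) :
    HasSum (fun x => v x * latticeOp α a k u x)
      ((k : ℝ) ^ α * (-(1 / 2) * ∑' p : Vertex d × Vertex d,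
        jumpRate α a p.1 p.2 * ((u p.2 - u p.1) * (v p.2 - v p.1)))) := by
  have h := (tsum_mul_tsum_sub_eq hα (ha.abs_jumpRate_le hα) jumpRate_comm hu hv).mul_left
    ((k : ℝ) ^ α)
  refine h.congr_fun fun x => ?_
  rw [latticeOp_eq hk]
  ring

theorem BoundedEnv.hasSum_mul_latticeOp_self (ha : BoundedEnv C₁ a) (hα : 0 < α) {k : ℕ}
    (hk : 0 < k) {u : Vertex d → ℝ} (hu : Summable fun z => u z ^ 2) :
    HasSum (fun x => u x * latticeOp α a k u x) (-((k : ℝ) ^ α * energy α a u)) := by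
  have h := ha.hasSum_mul_latticeOp hα hk hu hu
  convert h using 1
  rw [energy]
  simp only [← pow_two]
  ring

theorem summable_mul_of_sq {ι : Type*} {u v : ι → ℝ} (hu : Summable fun z => u z ^ 2)
    (hv : Summable fun z => v z ^ 2) : Summable fun z => u z * v z := by
  refine Summable.of_norm_bounded (hu.add hv) fun z => ?_
  rw [Real.norm_eq_abs, abs_le]
  constructor <;> nlinarith [sq_nonneg (u z - v z), sq_nonneg (u z + v z)]

theorem summable_sq_sub {ι : Type*} {u v : ι → ℝ} (hu : Summable fun z => u z ^ 2)
    (hv : Summable fun z => v z ^ 2) : Summable fun z => (u z - v z) ^ 2 := by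
  refine Summable.of_nonneg_of_le (fun _ => sq_nonneg _) (fun z => ?_)
    ((hu.mul_left 2).add (hv.mul_left 2))
  nlinarith [sq_nonneg (u z + v z)]

theorem BoundedEnv.summable_row (ha : BoundedEnv C₁ a) (hα : 0 < α) {u : Vertex d → ℝ}
    (hu : Summable fun z => u z ^ 2) (x : Vertex d) :
    Summable fun y => (u y - u x) * jumpRate α a x y := by
  have h1 : Summable fun y => jumpKernel α (x - y) := by
    have h := (Equiv.subLeft x).summable_iff.2 (summable_jumpKernel (d := d) hα)
    exact h
  have h2 : Summable fun y => jumpKernel α (x - y) * u y ^ 2 := by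
    have := ((hasSum_kernel_snd hα hu).summable).prod_factor x
    exact this.congr fun y => mul_comm _ _
  refine Summable.of_norm_bounded ((h2.mul_left C₁).add (h1.mul_left (C₁ * (1 + |u x|)))) fun y => ?_
  have h3 := ha.abs_jumpRate_le hα x y
  rw [Real.norm_eq_abs, abs_mul]
  calc |u y - u x| * |jumpRate α a x y| ≤ |u y - u x| * (C₁ * jumpKernel α (x - y)) := by gcongr
    _ ≤ (u y ^ 2 + (1 + |u x|)) * (C₁ * jumpKernel α (x - y)) := by
        refine mul_le_mul_of_nonneg_right ?_ ((abs_nonneg _).trans h3)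
        refine (abs_sub _ _).trans ?_
        have : |u y| ≤ u y ^ 2 + 1 := by
          rw [← sq_abs]; nlinarith [sq_nonneg (|u y| - 1), abs_nonneg (u y)]
        linarith
    _ = _ := by ring

theorem BoundedEnv.latticeOp_sub (ha : BoundedEnv C₁ a) (hα : 0 < α) {k : ℕ} (hk : 0 < k)
    {u v : Vertex d → ℝ} (hu : Summable fun z => u z ^ 2) (hv : Summable fun z => v z ^ 2)
    (x : Vertex d) : latticeOp α a k (fun z => u z - v z) x =
      latticeOp α a k u x - latticeOp α a k v x := by
  rw [latticeOp_eq hk, latticeOp_eq hk, latticeOp_eq hk, ← mul_sub,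
    ← (ha.summable_row hα hu x).tsum_sub (ha.summable_row hα hv x)]
  congr 1
  exact tsum_congr fun y => by ring

/-- The a priori identity for the resolvent equation. -/
theorem BoundedEnv.resolvent_identity (ha : BoundedEnv C₁ a) (hα : 0 < α) {lam : ℝ} {k : ℕ}
    (hk : 0 < k) {u h : Vertex d → ℝ} (hu : Summable fun z => u z ^ 2)
    (heq : ∀ z, lam * u z - latticeOp α a k u z = h z) :
    HasSum (fun z => h z * u z) (lam * ∑' z, u z ^ 2 + (k : ℝ) ^ α * energy α a u) := by
  have h1 := (hu.hasSum.mul_left lam).sub (ha.hasSum_mul_latticeOp_self hα hk hu)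
  rw [sub_neg_eq_add] at h1
  refine h1.congr_fun fun z => ?_
  rw [← heq z]
  ring

theorem BoundedEnv.isLatticeResolvent_unique (ha : BoundedEnv C₁ a) (hα : 0 < α) {lam : ℝ}
    (hlam : 0 < lam) {k : ℕ} (hk : 0 < k) {f : Space d → ℝ} {u v : Vertex d → ℝ}
    (hu : IsLatticeResolvent α lam a k f u) (hv : IsLatticeResolvent α lam a k f v) : u = v := by
  have hs := summable_sq_sub hu.1 hv.1
  have h := ha.resolvent_identity hα (lam := lam) hk (h := fun _ => 0) hs (fun z => by
    rw [ha.latticeOp_sub hα hk hu.1 hv.1]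
    have h1 := hu.2 z
    have h2 := hv.2 z
    linarith)
  simp only [zero_mul] at h
  have h0 := h.unique hasSum_zero
  have h1 : 0 ≤ (k : ℝ) ^ α * energy α a fun z => u z - v z :=
    mul_nonneg (by positivity) (ha.energy_nonneg hα _)
  have h2 : ∑' z, (u z - v z) ^ 2 = 0 := by
    have : 0 ≤ ∑' z, (u z - v z) ^ 2 := tsum_nonneg fun _ => sq_nonneg _
    nlinarith
  rw [← hs.hasSum_iff, hasSum_zero_iff_of_nonneg (fun _ => sq_nonneg _)] at h2
  funext z
  have h3 := congrFun h2 z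
  simp only [Pi.zero_apply] at h3
  exact sub_eq_zero.1 (pow_eq_zero_iff two_ne_zero |>.1 h3)

end LatticeOperator


/-! ### Existence of the lattice resolvent. -/

section Existence

variable {d : ℕ} {α C₁ : ℝ} {a : Sym2 (Vertex d) → ℝ}

theorem memℓp_two_iff {ι : Type*} {u : ι → ℝ} : Memℓp u 2 ↔ Summable fun z => u z ^ 2 := by
  rw [memℓp_gen_iff (by norm_num)]
  simp

theorem lp_two_summable_sq {ι : Type*} (u : lp (fun _ : ι => ℝ) 2) : Summable fun z => u z ^ 2 :=
  memℓp_two_iff.1 (lp.memℓp u)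

theorem lp_two_tsum_sq {ι : Type*} (u : lp (fun _ : ι => ℝ) 2) : ∑' z, u z ^ 2 = ‖u‖ ^ 2 := by
  rw [← real_inner_self_eq_norm_sq, lp.inner_eq_tsum]
  simp [pow_two]

theorem BoundedEnv.abs_tsum_mul_latticeOp_le (ha : BoundedEnv C₁ a) (hα : 0 < α) {k : ℕ}
    (hk : 0 < k) (u v : lp (fun _ : Vertex d => ℝ) 2) :
    |∑' x, v x * latticeOp α a k u x| ≤
      (k : ℝ) ^ α * (2 * C₁ * ∑' z : Vertex d, jumpKernel α z) * ‖u‖ * ‖v‖ := by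
  have hu := lp_two_summable_sq u
  have hv := lp_two_summable_sq v
  rcases eq_or_ne u 0 with rfl | hu0
  · have : ∀ x, latticeOp α a k (⇑(0 : lp (fun _ : Vertex d => ℝ) 2)) x = 0 := by
      intro x
      simp [latticeOp]
    simp only [this]
    simp
  rcases eq_or_ne v 0 with rfl | hv0
  · simp
  have hun : 0 < ‖u‖ := norm_pos_iff.2 hu0
  have hvn : 0 < ‖v‖ := norm_pos_iff.2 hv0
  set S := ∑' z : Vertex d, jumpKernel α z with hS
  have h := (ha.hasSum_mul_latticeOp hα hk hu hv).tsum_eq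
  rw [h, abs_mul, abs_of_nonneg (show (0 : ℝ) ≤ (k : ℝ) ^ α by positivity), abs_mul]
  -- Young's inequality with the optimal parameter t equalises the two terms, t‖u‖² = t⁻¹‖v‖² =
  -- ‖u‖‖v‖, and so replaces Cauchy–Schwarz for the double sum.
  set t : ℝ := ‖v‖ / ‖u‖ with ht
  have ht0 : 0 < t := by positivity
  set b := fun p : Vertex d × Vertex d =>
    C₁ * (t * (u p.1 ^ 2 * jumpKernel α (p.1 - p.2)) + t * (u p.2 ^ 2 * jumpKernel α (p.1 - p.2)) +
      (t⁻¹ * (v p.1 ^ 2 * jumpKernel α (p.1 - p.2)) +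
        t⁻¹ * (v p.2 ^ 2 * jumpKernel α (p.1 - p.2)))) with hb
  have hbs : HasSum b (C₁ * (t * (‖u‖ ^ 2 * S) + t * (‖u‖ ^ 2 * S) +
      (t⁻¹ * (‖v‖ ^ 2 * S) + t⁻¹ * (‖v‖ ^ 2 * S)))) := by
    have h1 := hasSum_kernel_fst hα hu
    have h2 := hasSum_kernel_snd hα hu
    have h3 := hasSum_kernel_fst hα hv
    have h4 := hasSum_kernel_snd hα hv
    rw [lp_two_tsum_sq] at h1 h2 h3 h4
    exact (((h1.mul_left t).add (h2.mul_left t)).add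
      ((h3.mul_left t⁻¹).add (h4.mul_left t⁻¹))).mul_left C₁
  have hle : ∀ p : Vertex d × Vertex d,
      ‖jumpRate α a p.1 p.2 * ((u p.2 - u p.1) * (v p.2 - v p.1))‖ ≤ b p := by
    intro p
    have h3 := ha.abs_jumpRate_le hα p.1 p.2
    rw [Real.norm_eq_abs, abs_mul]
    have h5 : ∀ X Y : ℝ, |X * Y| ≤ t * X ^ 2 / 2 + t⁻¹ * Y ^ 2 / 2 := by
      intro X Y
      have e1 : t * X ^ 2 / 2 + t⁻¹ * Y ^ 2 / 2 - X * Y = t⁻¹ / 2 * (t * X - Y) ^ 2 := by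
        field_simp; ring
      have e2 : t * X ^ 2 / 2 + t⁻¹ * Y ^ 2 / 2 + X * Y = t⁻¹ / 2 * (t * X + Y) ^ 2 := by
        field_simp; ring
      have e3 : 0 ≤ t⁻¹ / 2 * (t * X - Y) ^ 2 := by positivity
      have e4 : 0 ≤ t⁻¹ / 2 * (t * X + Y) ^ 2 := by positivity
      rw [abs_le]
      constructor <;> linarith
    calc |jumpRate α a p.1 p.2| * |(u p.2 - u p.1) * (v p.2 - v p.1)|
        ≤ (C₁ * jumpKernel α (p.1 - p.2)) * (t * (u p.1 ^ 2 + u p.2 ^ 2) +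
          t⁻¹ * (v p.1 ^ 2 + v p.2 ^ 2)) := by
          have h6 := h5 (u p.2 - u p.1) (v p.2 - v p.1)
          have h7 : (u p.2 - u p.1) ^ 2 ≤ 2 * (u p.1 ^ 2 + u p.2 ^ 2) := by
            nlinarith [sq_nonneg (u p.2 + u p.1)]
          have h8 : (v p.2 - v p.1) ^ 2 ≤ 2 * (v p.1 ^ 2 + v p.2 ^ 2) := by
            nlinarith [sq_nonneg (v p.2 + v p.1)]
          have h9 : t * (u p.2 - u p.1) ^ 2 ≤ t * (2 * (u p.1 ^ 2 + u p.2 ^ 2)) := by gcongr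
          have h10 : t⁻¹ * (v p.2 - v p.1) ^ 2 ≤ t⁻¹ * (2 * (v p.1 ^ 2 + v p.2 ^ 2)) := by gcongr
          refine mul_le_mul h3 (by linarith) (abs_nonneg _) ((abs_nonneg _).trans h3)
      _ = b p := by rw [hb]; ring
  have h6 := tsum_of_norm_bounded hbs hle
  rw [Real.norm_eq_abs] at h6
  have e1 : t * ‖u‖ ^ 2 = ‖u‖ * ‖v‖ := by rw [ht]; field_simp
  have e2 : t⁻¹ * ‖v‖ ^ 2 = ‖u‖ * ‖v‖ := by rw [ht]; field_simp
  have e3 : C₁ * (t * (‖u‖ ^ 2 * S) + t * (‖u‖ ^ 2 * S) +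
      (t⁻¹ * (‖v‖ ^ 2 * S) + t⁻¹ * (‖v‖ ^ 2 * S))) =
      C₁ * (2 * (t * ‖u‖ ^ 2) * S + 2 * (t⁻¹ * ‖v‖ ^ 2) * S) := by ring
  rw [e3, e1, e2] at h6
  rw [mul_assoc, mul_assoc]
  refine mul_le_mul_of_nonneg_left ?_ (by positivity)
  have e4 : |(-(1 / 2) : ℝ)| = 1 / 2 := by norm_num [abs_of_neg]
  rw [e4]
  linarith

theorem BoundedEnv.latticeOp_add (ha : BoundedEnv C₁ a) (hα : 0 < α) {k : ℕ} (hk : 0 < k)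
    {u v : Vertex d → ℝ} (hu : Summable fun z => u z ^ 2) (hv : Summable fun z => v z ^ 2)
    (x : Vertex d) : latticeOp α a k (fun z => u z + v z) x =
      latticeOp α a k u x + latticeOp α a k v x := by
  rw [latticeOp_eq hk, latticeOp_eq hk, latticeOp_eq hk, ← mul_add,
    ← (ha.summable_row hα hu x).tsum_add (ha.summable_row hα hv x)]
  congr 1
  exact tsum_congr fun y => by ring

theorem latticeOp_const_mul {k : ℕ} (hk : 0 < k) (c : ℝ) (u : Vertex d → ℝ) (x : Vertex d) :
    latticeOp α a k (fun z => c * u z) x = c * latticeOp α a k u x := by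
  have h : ∑' y, (c * u y - c * u x) * jumpRate α a x y =
      c * ∑' y, (u y - u x) * jumpRate α a x y := by
    rw [← tsum_mul_left]
    exact tsum_congr fun y => by ring
  rw [latticeOp_eq hk, latticeOp_eq hk, h]
  ring

/-- Lax–Milgram on ℓ²: the operator is bounded for each fixed k, and its energy has the sign that
makes λ a coercivity constant. -/
theorem BoundedEnv.exists_isLatticeResolvent (ha : BoundedEnv C₁ a) (hα : 0 < α) {lam : ℝ}
    (hlam : 0 < lam) {k : ℕ} (hk : 0 < k) {f : Space d → ℝ}
    (hf : Summable fun z : Vertex d => f (latticePoint k z) ^ 2) :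
    ∃ u, IsLatticeResolvent α lam a k f u := by
  let H := lp (fun _ : Vertex d => ℝ) 2
  have hs : ∀ u v : H, Summable fun x => v x * latticeOp α a k u x := fun u v =>
    (ha.hasSum_mul_latticeOp hα hk (lp_two_summable_sq u) (lp_two_summable_sq v)).summable
  let A : H →ₗ[ℝ] H →ₗ[ℝ] ℝ := LinearMap.mk₂ ℝ
    (fun u v => ∑' x, v x * latticeOp α a k u x)
    (by
      intro u u' v
      rw [← (hs u v).tsum_add (hs u' v)]
      refine tsum_congr fun x => ?_
      have := ha.latticeOp_add hα hk (lp_two_summable_sq u) (lp_two_summable_sq u') x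
      rw [← mul_add, ← this]
      rfl)
    (by
      intro c u v
      rw [smul_eq_mul, ← tsum_mul_left]
      refine tsum_congr fun x => ?_
      have := latticeOp_const_mul (α := α) (a := a) hk c (⇑u) x
      rw [mul_left_comm, ← this]
      rfl)
    (by
      intro u v v'
      rw [← (hs u v).tsum_add (hs u v')]
      refine tsum_congr fun x => ?_
      rw [lp.coeFn_add, Pi.add_apply, add_mul])
    (by
      intro c u v
      rw [smul_eq_mul, ← tsum_mul_left]
      refine tsum_congr fun x => ?_
      rw [lp.coeFn_smul, Pi.smul_apply, smul_eq_mul, mul_assoc])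
  let A' : H →L[ℝ] H →L[ℝ] ℝ := A.mkContinuous₂
    ((k : ℝ) ^ α * (2 * C₁ * ∑' z : Vertex d, jumpKernel α z))
    (fun u v => ha.abs_tsum_mul_latticeOp_le hα hk u v)
  let B : H →L[ℝ] H →L[ℝ] ℝ := lam • (innerₗ H).mkContinuous₂ 1 (fun u v => by
    rw [one_mul]; exact abs_real_inner_le_norm u v) - A'
  have hB : ∀ u v : H, B u v = lam * inner ℝ u v - ∑' x, v x * latticeOp α a k u x := fun u v => rfl
  have hco : IsCoercive B := by
    refine ⟨lam, hlam, fun u => ?_⟩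
    rw [hB, real_inner_self_eq_norm_sq,
      (ha.hasSum_mul_latticeOp_self hα hk (lp_two_summable_sq u)).tsum_eq]
    have : 0 ≤ (k : ℝ) ^ α * energy α a u := mul_nonneg (by positivity) (ha.energy_nonneg hα _)
    nlinarith
  let F : H := ⟨fun z => f (latticePoint k z), memℓp_two_iff.2 hf⟩
  let u : H := hco.continuousLinearEquivOfBilin.symm F
  have hu : ∀ v, B u v = inner ℝ F v := by
    intro v
    rw [← hco.continuousLinearEquivOfBilin_apply, ContinuousLinearEquiv.apply_symm_apply]
  refine ⟨u, lp_two_summable_sq u, fun z => ?_⟩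
  -- Testing with a unit vector recovers the equation at a point.
  have h1 := hu (lp.single 2 z (1 : ℝ))
  rw [hB, lp.inner_single_right, lp.inner_single_right, tsum_eq_single z] at h1
  · simp only [lp.single_apply_self, one_mul] at h1
    have e1 : ∀ t : ℝ, inner ℝ t (1 : ℝ) = t := fun t => by simp
    rw [e1, e1] at h1
    exact h1
  · intro y hy
    rw [lp.single_apply_ne _ _ _ hy, zero_mul]

end Existence


/-! ### One dyadic jump length: localisation to cubes. -/

section Scales

variable {d : ℕ} {α C₁ : ℝ} {a : Sym2 (Vertex d) → ℝ}

/-- The part of the centred bilinear form that comes from jumps of length between `r` and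
`2 * r`. -/
noncomputable def scaleTerm (α : ℝ) (a : Sym2 (Vertex d) → ℝ) (r : ℕ) (G v : Vertex d → ℝ)
    (p : Vertex d × Vertex d) : ℝ :=
  if (r : ℝ) ≤ ‖p.1 - p.2‖ ∧ ‖p.1 - p.2‖ < 2 * r then
    (a s(p.1, p.2) - 1) * jumpKernel α (p.1 - p.2) * ((G p.2 - G p.1) * (v p.2 - v p.1))
  else 0

/-- The localisation of the centred bilinear form to the cube `cube r c`. -/
noncomputable def localForm (α : ℝ) (a : Sym2 (Vertex d) → ℝ) (r : ℕ) (G v : Vertex d → ℝ)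
    (c : Vertex d) : ℝ :=
  ∑ x ∈ cube r c, ∑ y ∈ cube r c, (if x = y then 0 else (a s(x, y) - 1) * scaleWeight α r x y) *
    ((G y - G x) * (v y - v x))

/-- The box of sup-norm radius `ρ`. -/
noncomputable def box (d ρ : ℕ) : Finset (Vertex d) :=
  Finset.Icc (fun _ => -(ρ : ℤ)) fun _ => (ρ : ℤ)

theorem mem_box {ρ : ℕ} {x : Vertex d} : x ∈ box d ρ ↔ ∀ i, |x i| ≤ ρ := by
  simp only [box, Finset.mem_Icc, Pi.le_def, ← forall_and, abs_le]

theorem mem_box_iff_norm {ρ : ℕ} {x : Vertex d} : x ∈ box d ρ ↔ ‖x‖ ≤ ρ := by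
  rw [mem_box, pi_norm_le_iff_of_nonneg (Nat.cast_nonneg ρ)]
  refine forall_congr' fun i => ?_
  rw [Int.norm_eq_abs]
  exact_mod_cast Iff.rfl

theorem card_box (ρ : ℕ) : (box d ρ).card = (2 * ρ + 1) ^ d := by
  simp only [box, Pi.card_Icc, Int.card_Icc]
  rw [Finset.prod_congr rfl (g := fun _ => 2 * ρ + 1) (fun i _ => by omega)]
  simp

/-- Double counting: a pair lies in at most (4r+1)^d cubes of the family. -/
theorem sum_cubes_le {E : Vertex d × Vertex d → ℝ} (hE : ∀ p, 0 ≤ E p) (hs : Summable E) (r : ℕ)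
    (T : Finset (Vertex d)) :
    ∑ c ∈ T, ∑ x ∈ cube r c, ∑ y ∈ cube r c, E (x, y) ≤ ((4 * r + 1) ^ d : ℕ) * ∑' p, E p := by
  classical
  set S : Finset (Vertex d × Vertex d) := T.biUnion fun c => cube r c ×ˢ cube r c with hS
  have h1 : ∀ c ∈ T, ∑ x ∈ cube r c, ∑ y ∈ cube r c, E (x, y) =
      ∑ p ∈ S, if p ∈ cube r c ×ˢ cube r c then E p else 0 := by
    intro c hc
    rw [← Finset.sum_product', Finset.sum_ite_mem, Finset.inter_eq_right.2]
    exact Finset.subset_biUnion_of_mem (fun c => cube r c ×ˢ cube r c) hc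
  rw [Finset.sum_congr rfl h1, Finset.sum_comm]
  calc ∑ p ∈ S, ∑ c ∈ T, (if p ∈ cube r c ×ˢ cube r c then E p else 0)
      ≤ ∑ p ∈ S, ((4 * r + 1) ^ d : ℕ) * E p := by
        refine Finset.sum_le_sum fun p _ => ?_
        rw [← Finset.sum_filter, Finset.sum_const, nsmul_eq_mul]
        refine mul_le_mul_of_nonneg_right ?_ (hE p)
        have : (T.filter fun c => p ∈ cube r c ×ˢ cube r c) ⊆ commonCorners r p.1 p.2 := by
          intro c hc
          rw [Finset.mem_filter, Finset.mem_product] at hc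
          exact mem_commonCorners.2 hc.2
        exact_mod_cast (Finset.card_le_card this).trans (card_commonCorners_le r p.1 p.2)
    _ = ((4 * r + 1) ^ d : ℕ) * ∑ p ∈ S, E p := by rw [Finset.mul_sum]
    _ ≤ _ := by
        gcongr
        exact hs.sum_le_tsum _ fun p _ => hE p

theorem sum_cubes_single_le {E : Vertex d → ℝ} (hE : ∀ p, 0 ≤ E p) (hs : Summable E) (r : ℕ)
    (T : Finset (Vertex d)) :
    ∑ c ∈ T, ∑ x ∈ cube r c, E x ≤ ((4 * r + 1) ^ d : ℕ) * ∑' p, E p := by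
  classical
  set S : Finset (Vertex d) := T.biUnion fun c => cube r c with hS
  have h1 : ∀ c ∈ T, ∑ x ∈ cube r c, E x = ∑ p ∈ S, if p ∈ cube r c then E p else 0 := by
    intro c hc
    rw [Finset.sum_ite_mem, Finset.inter_eq_right.2]
    exact Finset.subset_biUnion_of_mem (fun c => cube r c) hc
  rw [Finset.sum_congr rfl h1, Finset.sum_comm]
  calc ∑ p ∈ S, ∑ c ∈ T, (if p ∈ cube r c then E p else 0)
      ≤ ∑ p ∈ S, ((4 * r + 1) ^ d : ℕ) * E p := by
        refine Finset.sum_le_sum fun p _ => ?_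
        rw [← Finset.sum_filter, Finset.sum_const, nsmul_eq_mul]
        refine mul_le_mul_of_nonneg_right ?_ (hE p)
        have : (T.filter fun c => p ∈ cube r c) ⊆ commonCorners r p p := by
          intro c hc
          rw [Finset.mem_filter] at hc
          exact mem_commonCorners.2 ⟨hc.2, hc.2⟩
        exact_mod_cast (Finset.card_le_card this).trans (card_commonCorners_le r p p)
    _ = ((4 * r + 1) ^ d : ℕ) * ∑ p ∈ S, E p := by rw [Finset.mul_sum]
    _ ≤ _ := by
        gcongr
        exact hs.sum_le_tsum _ fun p _ => hE p

theorem norm_le_of_mem_cube {r : ℕ} {c x : Vertex d} {ρ : ℝ} (hρ : 0 ≤ ρ) (hx : x ∈ cube r c)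
    (h : ‖x‖ ≤ ρ) : ‖c‖ ≤ ρ + 4 * r := by
  refine (pi_norm_le_iff_of_nonneg (by positivity)).2 fun i => ?_
  have h1 := mem_cube.1 hx i
  have h2 := (abs_le.1 ((abs_coord_le_norm x i).trans h))
  have h3 : (c i : ℝ) ≤ x i := by exact_mod_cast h1.1
  have h4 : (x i : ℝ) ≤ c i + 4 * r := by exact_mod_cast h1.2
  rw [Int.norm_eq_abs, abs_le]
  constructor <;> linarith

/-- A jump shorter than 2r lies in exactly as many cubes as it has common corners. `scaleWeight`
divides by this number, so the cubes together count the jump once. Since G is supported in the ball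
of radius ρ, all relevant corners lie in the box of radius ρ + 4r. -/
theorem tsum_scaleTerm_eq {r ρ : ℕ} (hr : 0 < r) {G : Vertex d → ℝ}
    (hG : ∀ x, (ρ : ℝ) < ‖x‖ → G x = 0) (v : Vertex d → ℝ) :
    ∑' p, scaleTerm α a r G v p =
      ((r : ℝ) ^ ((d : ℝ) + α) * (2 * r) ^ d)⁻¹ *
        ∑ c ∈ box d (ρ + 4 * r), localForm α a r G v c := by
  classical
  have hr' : (0 : ℝ) < r := by exact_mod_cast hr
  set κ : ℝ := (r : ℝ) ^ ((d : ℝ) + α) * (2 * r) ^ d with hκ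
  have hκ0 : 0 < κ := by positivity
  set T := box d (ρ + 4 * r) with hT
  set S : Finset (Vertex d × Vertex d) := T.biUnion fun c => cube r c ×ˢ cube r c with hS
  have hcorner : ∀ p : Vertex d × Vertex d, scaleTerm α a r G v p ≠ 0 →
      commonCorners r p.1 p.2 ⊆ T ∧ ‖p.1 - p.2‖ < 2 * r ∧ (r : ℝ) ≤ ‖p.1 - p.2‖ := by
    intro p hp
    have hcond : (r : ℝ) ≤ ‖p.1 - p.2‖ ∧ ‖p.1 - p.2‖ < 2 * r := by
      by_contra h
      exact hp (by rw [scaleTerm, if_neg h])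
    refine ⟨fun c hc => ?_, hcond.2, hcond.1⟩
    rw [mem_commonCorners] at hc
    have hGne : G p.1 ≠ 0 ∨ G p.2 ≠ 0 := by
      by_contra h
      push Not at h
      exact hp (by rw [scaleTerm, h.1, h.2]; simp)
    rw [hT, mem_box_iff_norm]
    push_cast
    rcases hGne with h | h
    · exact norm_le_of_mem_cube (Nat.cast_nonneg ρ) hc.1 (not_lt.1 fun hlt => h (hG _ hlt))
    · exact norm_le_of_mem_cube (Nat.cast_nonneg ρ) hc.2 (not_lt.1 fun hlt => h (hG _ hlt))
  have hcard : ∀ p : Vertex d × Vertex d, ‖p.1 - p.2‖ < 2 * r →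
      0 < ((commonCorners r p.1 p.2).card : ℝ) := by
    intro p hp
    have h1 := le_card_commonCorners hp
    have h2 : 0 < (2 * r) ^ d := by positivity
    exact_mod_cast lt_of_lt_of_le h2 h1
  have hsum : ∀ p, scaleTerm α a r G v p = ∑ c ∈ T, if p ∈ cube r c ×ˢ cube r c then
      scaleTerm α a r G v p / (commonCorners r p.1 p.2).card else 0 := by
    intro p
    by_cases hp : scaleTerm α a r G v p = 0
    · simp [hp]
    obtain ⟨h1, h2, -⟩ := hcorner p hp
    rw [← Finset.sum_filter, Finset.sum_const, nsmul_eq_mul]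
    have h3 : (T.filter fun c => p ∈ cube r c ×ˢ cube r c) = commonCorners r p.1 p.2 := by
      ext c
      rw [Finset.mem_filter, Finset.mem_product, ← mem_commonCorners]
      exact ⟨fun h => h.2, fun h => ⟨h1 h, h⟩⟩
    rw [h3, mul_div_cancel₀ _ (hcard p h2).ne']
  rw [tsum_eq_sum (s := S)]
  · rw [Finset.sum_congr rfl fun p _ => hsum p, Finset.sum_comm, Finset.mul_sum]
    refine Finset.sum_congr rfl fun c hc => ?_
    rw [Finset.sum_ite_mem, Finset.inter_eq_right.2
      (Finset.subset_biUnion_of_mem (fun c => cube r c ×ˢ cube r c) hc), localForm,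
      ← Finset.sum_product', Finset.mul_sum]
    refine Finset.sum_congr rfl fun p _ => ?_
    rw [scaleTerm, scaleWeight]
    by_cases hxy : p.1 = p.2
    · simp [hxy]
    by_cases hc : (r : ℝ) ≤ ‖p.1 - p.2‖ ∧ ‖p.1 - p.2‖ < 2 * r
    · rw [if_neg hxy, if_pos hc, if_pos hc, ← hκ]
      have e : ∀ A J m g : ℝ, A * J * g / m = κ⁻¹ * (A * (κ * J / m) * g) := by
        intro A J m g
        rw [mul_div_assoc κ, mul_left_comm A, mul_assoc κ, inv_mul_cancel_left₀ hκ0.ne']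
        ring
      exact e _ _ _ _
    · rw [if_neg hxy, if_neg hc, if_neg hc]
      simp
  · intro p hp
    by_contra hne
    obtain ⟨h1, h2, -⟩ := hcorner p hne
    have h3 := hcard p h2
    obtain ⟨c, hc⟩ := Finset.card_pos.1 (by exact_mod_cast h3 : 0 < (commonCorners r p.1 p.2).card)
    apply hp
    rw [hS, Finset.mem_biUnion]
    exact ⟨c, h1 hc, Finset.mem_product.2 (mem_commonCorners.1 hc)⟩

/-- The local form on a good cube. -/
theorem abs_localForm_le {r : ℕ} {c : Vertex d} (hop : OpNormBound C₁ a (scaleWeight α r) (cube r c))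
    (hC : 0 ≤ C₁) {G v : Vertex d → ℝ} (g₁ v₁ : ℝ) {g₀ : ℝ} (hg₀ : 0 ≤ g₀)
    (hG : ∀ x ∈ cube r c, |G x - g₁| ≤ g₀) :
    |localForm α a r G v c| ≤
      48 * C₁ * ((4 * r + 1) ^ d : ℕ) * g₀ * √(∑ x ∈ cube r c, (v x - v₁) ^ 2) := by
  set K := cube r c with hK
  set n : ℝ := (((4 * r + 1) ^ d : ℕ) : ℝ) with hn
  have hcard : (K.card : ℝ) = n := by rw [hK, card_cube]
  set γ : Vertex d → ℝ := fun x => G x - g₁ with hγ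
  set φ : Vertex d → ℝ := fun x => v x - v₁ with hφ
  set B := fun τ τ' => centeredForm a (scaleWeight α r) K τ τ' with hB
  -- With γ = G - g₁ and φ = v - v₁, the product of increments expands into four separated terms, 1
  -- ⊗ γφ, φ ⊗ γ, γ ⊗ φ and γφ ⊗ 1. Each contributes at most 12 C₁ √n * √n g₀ * ‖φ‖, which explains
  -- 48.
  have hdec : localForm α a r G v c = B (fun _ => 1) (fun y => γ y * φ y) - B φ γ - B γ φ +
      B (fun x => γ x * φ x) (fun _ => 1) := by
    simp only [localForm, hB, centeredForm, ← Finset.sum_sub_distrib, ← Finset.sum_add_distrib]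
    refine Finset.sum_congr rfl fun x _ => Finset.sum_congr rfl fun y _ => ?_
    simp only [hγ, hφ]
    ring
  set V := √(∑ x ∈ K, φ x ^ 2) with hV
  have hn0 : 0 ≤ n := Nat.cast_nonneg _
  have h1 : √(∑ x ∈ K, (1 : ℝ) ^ 2) = √n := by simp [hcard]
  have hγ2 : √(∑ x ∈ K, γ x ^ 2) ≤ √n * g₀ := by
    rw [Real.sqrt_le_left (by positivity), mul_pow, Real.sq_sqrt hn0, ← hcard, ← nsmul_eq_mul]
    refine Finset.sum_le_card_nsmul _ _ _ fun x hx => ?_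
    rw [← sq_abs]
    exact pow_le_pow_left₀ (abs_nonneg _) (hG x hx) 2
  have hγφ : √(∑ x ∈ K, (γ x * φ x) ^ 2) ≤ g₀ * V := by
    rw [Real.sqrt_le_left (by positivity), mul_pow, hV, Real.sq_sqrt (Finset.sum_nonneg
      fun _ _ => sq_nonneg _), Finset.mul_sum]
    refine Finset.sum_le_sum fun x hx => ?_
    rw [mul_pow]
    refine mul_le_mul_of_nonneg_right ?_ (sq_nonneg _)
    rw [← sq_abs]
    exact pow_le_pow_left₀ (abs_nonneg _) (hG x hx) 2
  have hnn : √n * √n = n := Real.mul_self_sqrt hn0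
  have hV0 : 0 ≤ V := Real.sqrt_nonneg _
  have b1 : |B (fun _ => 1) (fun y => γ y * φ y)| ≤ 12 * C₁ * n * g₀ * V := by
    refine (hop _ _).trans ?_
    rw [h1, hcard, mul_assoc (12 * C₁), hnn, mul_assoc (12 * C₁ * n)]
    gcongr
  have b4 : |B (fun y => γ y * φ y) (fun _ => 1)| ≤ 12 * C₁ * n * g₀ * V := by
    refine (hop _ _).trans ?_
    rw [h1, hcard, mul_right_comm, mul_assoc (12 * C₁), hnn, mul_assoc (12 * C₁ * n)]
    gcongr
  have b2 : |B φ γ| ≤ 12 * C₁ * n * g₀ * V := by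
    refine (hop _ _).trans ?_
    rw [hcard]
    calc 12 * C₁ * √n * V * √(∑ x ∈ K, γ x ^ 2) ≤ 12 * C₁ * √n * V * (√n * g₀) := by gcongr
      _ = 12 * C₁ * (√n * √n) * g₀ * V := by ring
      _ = _ := by rw [hnn]
  have b3 : |B γ φ| ≤ 12 * C₁ * n * g₀ * V := by
    refine (hop _ _).trans ?_
    rw [hcard]
    calc 12 * C₁ * √n * √(∑ x ∈ K, γ x ^ 2) * V ≤ 12 * C₁ * √n * (√n * g₀) * V := by gcongr
      _ = 12 * C₁ * (√n * √n) * g₀ * V := by ring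
      _ = _ := by rw [hnn]
  rw [hdec]
  rw [abs_le] at *
  constructor <;> linarith [b1.1, b1.2, b2.1, b2.2, b3.1, b3.2, b4.1, b4.2]

theorem sum_sqrt_le_sqrt {ι : Type*} (T : Finset ι) (A : ι → ℝ) (hA : ∀ c ∈ T, 0 ≤ A c) {X : ℝ}
    (hX : ∑ c ∈ T, A c ≤ X) : ∑ c ∈ T, √(A c) ≤ √(T.card * X) := by
  apply Real.le_sqrt_of_sq_le
  refine sq_sum_le_card_mul_sum_sq.trans ?_
  gcongr
  refine le_trans (le_of_eq (Finset.sum_congr rfl fun c hc => Real.sq_sqrt (hA c hc))) hX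

theorem eucl_sub_le_of_mem_cube {r : ℕ} {c x y : Vertex d} (hx : x ∈ cube r c)
    (hy : y ∈ cube r c) : eucl (x - y) ≤ d * (4 * r) := by
  refine (eucl_le _).trans ?_
  gcongr
  refine (pi_norm_le_iff_of_nonneg (by positivity)).2 fun i => ?_
  have h1 := mem_cube.1 hx i
  have h2 := mem_cube.1 hy i
  have h3 : |(x - y) i| ≤ 4 * r := by
    rw [Pi.sub_apply, abs_le]
    omega
  rw [Int.norm_eq_abs]
  exact_mod_cast h3

/-- Within a cube the kernel is at least (4dr)^(-(d+α)), so the complete graph form of the Poincaré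
inequality is controlled by the energy inside the cube. The factor (4r+1)^d lost by the overlap of
the cubes cancels against the factor #K in the spectral gap. -/
theorem BoundedEnv.sum_poincare_le (ha : BoundedEnv C₁ a) (hα : 0 < α) {r : ℕ}
    {T : Finset (Vertex d)} (hgood : ∀ c ∈ T, PoincareOn a (cube r c)) {v : Vertex d → ℝ}
    (hv : Summable fun z => v z ^ 2) :
    ∑ c ∈ T, ∑ x ∈ cube r c, (v x - (∑ z ∈ cube r c, v z) / (cube r c).card) ^ 2 ≤
      (d * (4 * r)) ^ ((d : ℝ) + α) * (2 * energy α a v) := by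
  set n : ℝ := (((4 * r + 1) ^ d : ℕ) : ℝ) with hn
  have hn0 : 0 < n := by positivity
  set E : Vertex d × Vertex d → ℝ := fun p => jumpRate α a p.1 p.2 * (v p.2 - v p.1) ^ 2 with hE
  have hE0 : ∀ p, 0 ≤ E p := fun p => mul_nonneg (ha.jumpRate_nonneg hα _ _) (sq_nonneg _)
  set D : ℝ := (d * (4 * r)) ^ ((d : ℝ) + α) with hD
  have hD0 : 0 ≤ D := by positivity
  have h1 : ∀ c ∈ T, n * ∑ x ∈ cube r c, (v x - (∑ z ∈ cube r c, v z) / (cube r c).card) ^ 2 ≤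
      D * ∑ x ∈ cube r c, ∑ y ∈ cube r c, E (x, y) := by
    intro c hc
    have h2 := hgood c hc v
    have h3 : ((cube r c).card : ℝ) = n := by rw [card_cube]
    rw [h3] at h2 ⊢
    refine h2.trans ?_
    rw [Finset.mul_sum]
    refine Finset.sum_le_sum fun x hx => ?_
    rw [Finset.mul_sum]
    refine Finset.sum_le_sum fun y hy => ?_
    split_ifs with hxy
    · exact mul_nonneg hD0 (hE0 _)
    · have h4 : 0 < eucl (x - y) := lt_of_lt_of_le one_pos
        (one_le_eucl_of_ne_zero (sub_ne_zero.2 hxy))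
      have h5 : 1 ≤ D * jumpKernel α (x - y) := by
        rw [jumpKernel, ← div_eq_mul_inv, one_le_div (Real.rpow_pos_of_pos h4 _)]
        exact Real.rpow_le_rpow h4.le (eucl_sub_le_of_mem_cube hx hy) (by positivity)
      have h6 : 0 ≤ a s(x, y) * (v x - v y) ^ 2 :=
        mul_nonneg (ha.nonneg x y hxy) (sq_nonneg _)
      calc a s(x, y) * (v x - v y) ^ 2 ≤ (D * jumpKernel α (x - y)) *
            (a s(x, y) * (v x - v y) ^ 2) := le_mul_of_one_le_left h6 h5
        _ = D * E (x, y) := by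
          simp only [hE, jumpRate]
          ring
  have h2 := sum_cubes_le hE0 (ha.summable_energy hα hv) r T
  have h3 : n * ∑ c ∈ T, ∑ x ∈ cube r c, (v x - (∑ z ∈ cube r c, v z) / (cube r c).card) ^ 2 ≤
      n * (D * (2 * energy α a v)) := by
    rw [Finset.mul_sum]
    refine (Finset.sum_le_sum h1).trans ?_
    rw [← Finset.mul_sum]
    have e1 : 2 * energy α a v = ∑' p, E p := by rw [energy]; ring
    rw [e1]
    calc _ ≤ D * (n * ∑' p, E p) := by gcongr
      _ = _ := by ring
  exact le_of_mul_le_mul_left h3 hn0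

end Scales


/-! ### Truncated geometric series over dyadic lengths. -/

section GeometricSums

theorem sum_dyadic_le_of_pos {s : ℝ} (hs : 0 < s) {r k : ℝ} (hr : 0 < r) (hk : 0 < k) (N : ℕ) :
    ∑ j ∈ Finset.range N, (if 2 ^ j * r ≤ k then (2 ^ j * r) ^ s else 0) ≤
      k ^ s / (1 - 2 ^ (-s)) := by
  set t : ℝ := 2 ^ (-s) with ht
  have ht0 : 0 < t := by positivity
  have ht1 : 0 < 1 - t := by
    have : t < 1 := Real.rpow_lt_one_of_one_lt_of_neg one_lt_two (by linarith)
    linarith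
  set q : ℕ → ℝ := fun j => (2 ^ j * r) ^ s with hq
  have hq0 : ∀ j, 0 < q j := fun j => by positivity
  have hqs : ∀ j, q (j + 1) * t = q j := by
    intro j
    simp only [hq, ht]
    rw [pow_succ, mul_right_comm, Real.mul_rpow (by positivity) (by positivity), mul_assoc,
      ← Real.rpow_add two_pos]
    simp
  -- Both bounds must be carried through the induction: the geometric one makes the next step
  -- telescope while 2^N r ≤ k, and k^s is the bound that remains after the truncation.
  suffices h : ∀ N, (∑ j ∈ Finset.range N, (if 2 ^ j * r ≤ k then q j else 0)) * (1 - t) ≤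
      min (q N * t) (k ^ s) by
    rw [le_div_iff₀ ht1]
    exact (h N).trans (min_le_right _ _)
  intro N
  induction N with
  | zero => simp only [Finset.range_zero, Finset.sum_empty, zero_mul]; have := hq0 0; positivity
  | succ N ih =>
    rw [Finset.sum_range_succ, add_mul, hqs]
    have h1 := ih.trans (min_le_left _ _)
    have h2 := ih.trans (min_le_right _ _)
    split_ifs with hc
    · have h3 : q N ≤ k ^ s := Real.rpow_le_rpow (by positivity) hc hs.le
      refine le_min ?_ ?_ <;> nlinarith
    · rw [zero_mul, add_zero]
      refine le_min (h1.trans ?_) h2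
      have := hq0 N
      nlinarith

theorem sum_dyadic_le_of_neg {s : ℝ} (hs : s < 0) {r k : ℝ} (hr : 1 ≤ r) (N : ℕ) :
    ∑ j ∈ Finset.range N, (if 2 ^ j * r ≤ k then (2 ^ j * r) ^ s else 0) ≤
      1 / (1 - 2 ^ s) := by
  set t : ℝ := 2 ^ s with ht
  have ht0 : 0 < t := by positivity
  have ht1 : t < 1 := Real.rpow_lt_one_of_one_lt_of_neg one_lt_two hs
  have hle : ∀ j : ℕ, (if 2 ^ j * r ≤ k then (2 ^ j * r) ^ s else 0) ≤ t ^ j := by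
    intro j
    split_ifs
    · have : ((2 : ℝ) ^ j) ^ s = t ^ j := by
        rw [ht, ← Real.rpow_natCast, ← Real.rpow_mul two_pos.le, mul_comm,
          Real.rpow_mul two_pos.le, Real.rpow_natCast]
      rw [← this]
      refine Real.rpow_le_rpow_of_nonpos (by positivity) ?_ hs.le
      exact le_mul_of_one_le_right (by positivity) hr
    · positivity
  refine (Finset.sum_le_sum fun j _ => hle j).trans ?_
  have := Summable.sum_le_tsum (Finset.range N) (fun j _ => by positivity)
    (summable_geometric_of_lt_one ht0.le ht1)
  rwa [tsum_geometric_of_lt_one ht0.le ht1, ← one_div] at this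

theorem sum_dyadic_tail_le {s : ℝ} (hs : 0 < s) {r k : ℝ} (hr : 0 < r) (hk : 0 < k) (N : ℕ) :
    ∑ j ∈ Finset.range N, (if 2 ^ j * r ≤ k then 0 else (2 ^ j * r) ^ (-s)) ≤
      k ^ (-s) / (1 - 2 ^ (-s)) := by
  set t : ℝ := 2 ^ (-s) with ht
  have ht0 : 0 < t := by positivity
  have ht1 : 0 < 1 - t := by
    have : t < 1 := Real.rpow_lt_one_of_one_lt_of_neg one_lt_two (by linarith)
    linarith
  set q : ℕ → ℝ := fun j => (2 ^ j * r) ^ (-s) with hq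
  have hq0 : ∀ j, 0 < q j := fun j => by positivity
  have hqs : ∀ j, q (j + 1) = q j * t := by
    intro j
    simp only [hq, ht]
    rw [pow_succ, mul_right_comm, Real.mul_rpow (by positivity) (by positivity)]
  -- The maximum with 0 covers the initial range, where no term has been counted and k^(-s) - q N
  -- may be negative.
  suffices h : ∀ N, (∑ j ∈ Finset.range N, (if 2 ^ j * r ≤ k then 0 else q j)) * (1 - t) ≤
      max (k ^ (-s) - q N) 0 by
    rw [le_div_iff₀ ht1]
    refine (h N).trans (max_le ?_ (by positivity))
    linarith [hq0 N]
  intro N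
  induction N with
  | zero => simp
  | succ N ih =>
    rw [Finset.sum_range_succ, add_mul, hqs]
    split_ifs with hc
    · have h3 : k ^ (-s) ≤ q N :=
        Real.rpow_le_rpow_of_nonpos (by positivity) hc (by linarith)
      rw [max_eq_right (by linarith)] at ih
      rw [zero_mul, add_zero]
      exact ih.trans (le_max_right _ _)
    · have h3 : q N ≤ k ^ (-s) :=
        Real.rpow_le_rpow_of_nonpos hk (not_le.1 hc).le (by linarith)
      rw [max_eq_left (by linarith)] at ih
      refine le_trans ?_ (le_max_left _ _)
      nlinarith

end GeometricSums

/-! ### Size of the centred form at one jump length. -/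

section ScaleBounds

variable {d : ℕ} {α C₁ : ℝ} {a : Sym2 (Vertex d) → ℝ}

theorem inv_scale_mul_card_le {r : ℕ} (hr : 0 < r) :
    ((r : ℝ) ^ ((d : ℝ) + α) * (2 * r) ^ d)⁻¹ * ((4 * r + 1) ^ d : ℕ) ≤
      3 ^ d * (r : ℝ) ^ (-((d : ℝ) + α)) := by
  have hr' : (1 : ℝ) ≤ r := by exact_mod_cast hr
  have h0 : (0 : ℝ) < r := by linarith
  rw [inv_mul_le_iff₀ (by positivity), Real.rpow_neg h0.le]
  have e : (r : ℝ) ^ ((d : ℝ) + α) * (2 * r) ^ d * (3 ^ d * ((r : ℝ) ^ ((d : ℝ) + α))⁻¹) =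
      (6 * r) ^ d := by
    have : (r : ℝ) ^ ((d : ℝ) + α) ≠ 0 := by positivity
    field_simp
    rw [← mul_pow]
    ring
  rw [e]
  push_cast
  gcongr
  linarith

theorem card_box_le {ρ r R : ℕ} {m : ℝ} (hm : 1 ≤ m) (hR : 1 ≤ R) (hρ : (ρ : ℝ) ≤ R * m)
    (hr : (r : ℝ) ≤ m) : ((box d (ρ + 4 * r)).card : ℝ) ≤ (11 * R * m) ^ d := by
  have hR' : (1 : ℝ) ≤ R := by exact_mod_cast hR
  rw [card_box]
  push_cast
  gcongr
  nlinarith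

/-- The contribution of the jumps of length about `r ≤ k`, in terms of the energy. -/
theorem BoundedEnv.abs_scale_le_energy (ha : BoundedEnv C₁ a) (hα : 0 < α) (hC : 0 ≤ C₁)
    {k r R : ℕ} (hr : 0 < r) (hrk : r ≤ k) (hR : 1 ≤ R) {Lip : ℝ} (hL : 0 ≤ Lip)
    {G : Vertex d → ℝ} (hGL : ∀ x y, |G x - G y| ≤ Lip / k * eucl (x - y))
    (hG : ∀ x, ((R * k : ℕ) : ℝ) < ‖x‖ → G x = 0)
    (hgood : ∀ c ∈ box d (R * k + 4 * r), GoodCube α C₁ a r c) {v : Vertex d → ℝ}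
    (hv : Summable fun z => v z ^ 2) :
    |∑' p, scaleTerm α a r G v p| ≤
      (3 ^ d * (48 * C₁) * (4 * d * Lip) * √((11 * R) ^ d * (4 * d) ^ ((d : ℝ) + α) * 2)) *
        ((k : ℝ) ^ ((d : ℝ) / 2 - 1) * (r : ℝ) ^ (1 - ((d : ℝ) + α) / 2) * √(energy α a v)) := by
  have hr' : (0 : ℝ) < r := by exact_mod_cast hr
  have hk' : (0 : ℝ) < k := by exact_mod_cast hr.trans_le hrk
  have hk1 : (1 : ℝ) ≤ k := by exact_mod_cast hr.trans_le hrk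
  set β : ℝ := (d : ℝ) + α with hβ
  set T := box d (R * k + 4 * r) with hT
  set n : ℝ := (((4 * r + 1) ^ d : ℕ) : ℝ) with hn
  -- The oscillation of G on a cube: Lipschitz constant Lip/k times the diameter bound 4dr.
  set g₀ : ℝ := Lip / k * (d * (4 * r)) with hg₀
  have hg₀0 : 0 ≤ g₀ := by positivity
  set e := energy α a v with he
  have he0 : 0 ≤ e := ha.energy_nonneg hα v
  set A : Vertex d → ℝ := fun c =>
    ∑ x ∈ cube r c, (v x - (∑ z ∈ cube r c, v z) / (cube r c).card) ^ 2 with hA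
  have hloc : ∀ c ∈ T, |localForm α a r G v c| ≤ 48 * C₁ * n * g₀ * √(A c) := by
    intro c hc
    refine abs_localForm_le (hgood c hc).opNorm hC (G c) _ hg₀0 fun x hx => ?_
    refine (hGL x c).trans ?_
    rw [hg₀]
    gcongr
    exact eucl_sub_le_of_mem_cube hx (mem_cube.2 fun i => ⟨le_rfl, by omega⟩)
  -- Cauchy–Schwarz over the O(k^d) cubes and the summed Poincaré inequality give k^(d/2)
  -- r^((d+α)/2) √E. The prefactors r^(-(d+α)) and r/k then produce k^(d/2-1) r^(1-(d+α)/2).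
  have hsq := sum_sqrt_le_sqrt T A (fun c _ => Finset.sum_nonneg fun _ _ => sq_nonneg _)
    (ha.sum_poincare_le hα (fun c hc => (hgood c hc).poincare) hv)
  rw [tsum_scaleTerm_eq hr hG, abs_mul, abs_of_nonneg (by positivity)]
  have hcard : (T.card : ℝ) ≤ (11 * R * k) ^ d :=
    card_box_le hk1 hR (by push_cast; exact le_rfl) (by exact_mod_cast hrk)
  have hroot : √((T.card : ℝ) * ((d * (4 * r)) ^ β * (2 * e))) ≤
      √((11 * R) ^ d * (4 * d) ^ β * 2) * ((k : ℝ) ^ ((d : ℝ) / 2) * (r : ℝ) ^ (β / 2) * √e) := by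
    have e1 : (k : ℝ) ^ ((d : ℝ) / 2) = √((k : ℝ) ^ d) := by
      rw [Real.sqrt_eq_rpow, ← Real.rpow_natCast, ← Real.rpow_mul hk'.le]
      congr 1; ring
    have e2 : (r : ℝ) ^ (β / 2) = √((r : ℝ) ^ β) := by
      rw [Real.sqrt_eq_rpow, ← Real.rpow_mul hr'.le]
      congr 1; ring
    rw [e1, e2, ← Real.sqrt_mul (by positivity), ← Real.sqrt_mul (by positivity),
      ← Real.sqrt_mul (by positivity)]
    apply Real.sqrt_le_sqrt
    have e3 : ((d : ℝ) * (4 * r)) ^ β = (4 * d) ^ β * (r : ℝ) ^ β := by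
      rw [← Real.mul_rpow (by positivity) (by positivity)]
      congr 1; ring
    rw [e3]
    calc (T.card : ℝ) * ((4 * d) ^ β * (r : ℝ) ^ β * (2 * e))
        ≤ (11 * R * k) ^ d * ((4 * d) ^ β * (r : ℝ) ^ β * (2 * e)) := by gcongr
      _ = _ := by rw [mul_pow]; ring
  calc ((r : ℝ) ^ β * (2 * r) ^ d)⁻¹ * |∑ c ∈ T, localForm α a r G v c|
      ≤ ((r : ℝ) ^ β * (2 * r) ^ d)⁻¹ * ∑ c ∈ T, 48 * C₁ * n * g₀ * √(A c) := by
        gcongr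
        exact (Finset.abs_sum_le_sum_abs _ _).trans (Finset.sum_le_sum hloc)
    _ = (((r : ℝ) ^ β * (2 * r) ^ d)⁻¹ * n) * (48 * C₁) * g₀ * ∑ c ∈ T, √(A c) := by
        rw [← Finset.mul_sum]; ring
    _ ≤ (3 ^ d * (r : ℝ) ^ (-β)) * (48 * C₁) * g₀ *
          (√((11 * R) ^ d * (4 * d) ^ β * 2) *
            ((k : ℝ) ^ ((d : ℝ) / 2) * (r : ℝ) ^ (β / 2) * √e)) := by
        exact mul_le_mul (mul_le_mul_of_nonneg_right (mul_le_mul_of_nonneg_right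
          (inv_scale_mul_card_le hr) (by positivity)) hg₀0) (hsq.trans hroot)
          (Finset.sum_nonneg fun _ _ => Real.sqrt_nonneg _) (by positivity)
    _ = _ := by
        have e1 : (k : ℝ) ^ ((d : ℝ) / 2 - 1) = (k : ℝ) ^ ((d : ℝ) / 2) / k :=
          Real.rpow_sub_one hk'.ne' _
        have e2 : (r : ℝ) ^ (1 - β / 2) = r * ((r : ℝ) ^ (-β) * (r : ℝ) ^ (β / 2)) := by
          nth_rw 2 [← Real.rpow_one (r : ℝ)]
          rw [← Real.rpow_add hr', ← Real.rpow_add hr']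
          congr 1; ring
        rw [e1, e2, hg₀]
        ring

/-- The contribution of the jumps of length about `r ≥ k`, in terms of the `ℓ²` norm. -/
theorem BoundedEnv.abs_scale_le_norm (hC : 0 ≤ C₁)
    {k r R : ℕ} (hr : 0 < r) (hrk : k ≤ r) (hR : 1 ≤ R) {g₀ : ℝ} (hg₀0 : 0 ≤ g₀)
    {G : Vertex d → ℝ} (hGb : ∀ x, |G x| ≤ g₀)
    (hG : ∀ x, ((R * k : ℕ) : ℝ) < ‖x‖ → G x = 0)
    (hgood : ∀ c ∈ box d (R * k + 4 * r), GoodCube α C₁ a r c) {v : Vertex d → ℝ}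
    (hv : Summable fun z => v z ^ 2) :
    |∑' p, scaleTerm α a r G v p| ≤
      (3 ^ d * (48 * C₁) * g₀ * √((55 * R) ^ d)) * ((r : ℝ) ^ (-α) * √(∑' z, v z ^ 2)) := by
  have hr' : (0 : ℝ) < r := by exact_mod_cast hr
  have hr1 : (1 : ℝ) ≤ r := by exact_mod_cast hr
  have hR' : (1 : ℝ) ≤ R := by exact_mod_cast hR
  set β : ℝ := (d : ℝ) + α with hβ
  set T := box d (R * k + 4 * r) with hT
  set n : ℝ := (((4 * r + 1) ^ d : ℕ) : ℝ) with hn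
  set e := ∑' z, v z ^ 2 with he
  have he0 : 0 ≤ e := tsum_nonneg fun _ => sq_nonneg _
  set A : Vertex d → ℝ := fun c => ∑ x ∈ cube r c, v x ^ 2 with hA
  have hloc : ∀ c ∈ T, |localForm α a r G v c| ≤ 48 * C₁ * n * g₀ * √(A c) := by
    intro c hc
    -- At lengths above k the smoothness of G gains nothing, so nothing is subtracted. The number of
    -- cubes and their overlap are both O(r^d), hence r^(-(d+α)) r^d = r^(-α).
    have := abs_localForm_le (hgood c hc).opNorm hC (G := G) (v := v) 0 0 hg₀0
      (fun x hx => by rw [sub_zero]; exact hGb x)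
    simp only [sub_zero] at this
    exact this
  have hsq := sum_sqrt_le_sqrt T A (fun c _ => Finset.sum_nonneg fun _ _ => sq_nonneg _)
    (sum_cubes_single_le (fun x => sq_nonneg (v x)) hv r T)
  rw [tsum_scaleTerm_eq hr hG, abs_mul, abs_of_nonneg (by positivity)]
  have hcard : (T.card : ℝ) ≤ (11 * R * r) ^ d :=
    card_box_le hr1 hR (by push_cast; gcongr) le_rfl
  have hroot : √((T.card : ℝ) * (n * e)) ≤ √((55 * R) ^ d) * ((r : ℝ) ^ (d : ℝ) * √e) := by
    have e1 : (r : ℝ) ^ (d : ℝ) = √(((r : ℝ) ^ d) ^ 2) := by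
      rw [Real.sqrt_sq (by positivity), Real.rpow_natCast]
    rw [e1, ← Real.sqrt_mul (by positivity), ← Real.sqrt_mul (by positivity)]
    apply Real.sqrt_le_sqrt
    have hn5 : n ≤ (5 * r) ^ d := by
      rw [hn]
      push_cast
      gcongr
      linarith
    calc (T.card : ℝ) * (n * e) ≤ (11 * R * r) ^ d * ((5 * r) ^ d * e) := by gcongr
      _ = _ := by
        have h55 : (55 : ℝ) ^ d = 11 ^ d * 5 ^ d := by rw [← mul_pow]; norm_num
        simp only [mul_pow, h55]
        ring
  calc ((r : ℝ) ^ β * (2 * r) ^ d)⁻¹ * |∑ c ∈ T, localForm α a r G v c|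
      ≤ ((r : ℝ) ^ β * (2 * r) ^ d)⁻¹ * ∑ c ∈ T, 48 * C₁ * n * g₀ * √(A c) := by
        gcongr
        exact (Finset.abs_sum_le_sum_abs _ _).trans (Finset.sum_le_sum hloc)
    _ = (((r : ℝ) ^ β * (2 * r) ^ d)⁻¹ * n) * (48 * C₁) * g₀ * ∑ c ∈ T, √(A c) := by
        rw [← Finset.mul_sum]; ring
    _ ≤ (3 ^ d * (r : ℝ) ^ (-β)) * (48 * C₁) * g₀ *
          (√((55 * R) ^ d) * ((r : ℝ) ^ (d : ℝ) * √e)) := by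
        exact mul_le_mul (mul_le_mul_of_nonneg_right (mul_le_mul_of_nonneg_right
          (inv_scale_mul_card_le hr) (by positivity)) hg₀0) (hsq.trans hroot)
          (Finset.sum_nonneg fun _ _ => Real.sqrt_nonneg _) (by positivity)
    _ = _ := by
        have e2 : (r : ℝ) ^ (-α) = (r : ℝ) ^ (-β) * (r : ℝ) ^ (d : ℝ) := by
          rw [← Real.rpow_add hr', hβ]
          congr 1; ring
        rw [e2]
        ring

end ScaleBounds


/-! ### Summation over scales, and the short jumps. -/

section NearFar

variable {d : ℕ} {α C₁ : ℝ} {a : Sym2 (Vertex d) → ℝ}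

/-- The part of the centred bilinear form that comes from jumps of length at least `r`. -/
noncomputable def farTerm (α : ℝ) (a : Sym2 (Vertex d) → ℝ) (r : ℕ) (G v : Vertex d → ℝ)
    (p : Vertex d × Vertex d) : ℝ :=
  if (r : ℝ) ≤ ‖p.1 - p.2‖ then
    (a s(p.1, p.2) - 1) * jumpKernel α (p.1 - p.2) * ((G p.2 - G p.1) * (v p.2 - v p.1))
  else 0

/-- The part of the bilinear form that comes from jumps of length less than `r`. -/
noncomputable def nearTerm (α : ℝ) (a : Sym2 (Vertex d) → ℝ) (r : ℕ) (G v : Vertex d → ℝ)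
    (p : Vertex d × Vertex d) : ℝ :=
  if (r : ℝ) ≤ ‖p.1 - p.2‖ then 0
  else jumpRate α a p.1 p.2 * ((G p.2 - G p.1) * (v p.2 - v p.1))

theorem summable_of_eq_zero_of_lt_norm {ρ : ℕ} {G : Vertex d → ℝ}
    (hG : ∀ x, (ρ : ℝ) < ‖x‖ → G x = 0) : Summable G := by
  refine summable_of_ne_finset_zero (s := box d ρ) fun x hx => ?_
  rw [mem_box_iff_norm, not_le] at hx
  exact hG x hx

theorem summable_sq_of_eq_zero_of_lt_norm {ρ : ℕ} {G : Vertex d → ℝ}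
    (hG : ∀ x, (ρ : ℝ) < ‖x‖ → G x = 0) : Summable fun x => G x ^ 2 :=
  summable_of_eq_zero_of_lt_norm fun x hx => by rw [hG x hx]; simp

theorem BoundedEnv.abs_sub_one_mul_le (ha : BoundedEnv C₁ a) (hα : 0 < α) (hC : 0 ≤ C₁)
    (x y : Vertex d) :
    |(a s(x, y) - 1) * jumpKernel α (x - y)| ≤ (C₁ + 1) * jumpKernel α (x - y) := by
  rcases eq_or_ne x y with rfl | h
  · rw [sub_self, jumpKernel_zero hα, mul_zero, mul_zero, abs_zero]
  · rw [abs_mul, abs_of_nonneg (jumpKernel_nonneg α (x - y))]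
    refine mul_le_mul_of_nonneg_right ?_ (jumpKernel_nonneg _ _)
    have h1 := ha.nonneg x y h
    have h2 := ha.le x y h
    rw [abs_le]
    constructor <;> linarith

theorem abs_sub_mul_sub_le (g₁ g₂ v₁ v₂ : ℝ) :
    |(g₂ - g₁) * (v₂ - v₁)| ≤ g₁ ^ 2 + g₂ ^ 2 + v₁ ^ 2 + v₂ ^ 2 := by
  rw [abs_le]
  constructor <;> nlinarith [sq_nonneg (g₂ - g₁ + (v₂ - v₁)), sq_nonneg (g₂ - g₁ - (v₂ - v₁)),
    sq_nonneg (g₁ + g₂), sq_nonneg (v₁ + v₂)]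

theorem BoundedEnv.abs_farTerm_le (ha : BoundedEnv C₁ a) (hα : 0 < α) (hC : 0 ≤ C₁) (r : ℕ)
    (G v : Vertex d → ℝ) (p : Vertex d × Vertex d) :
    |farTerm α a r G v p| ≤ (C₁ + 1) * ((G p.1 ^ 2 + G p.2 ^ 2 + v p.1 ^ 2 + v p.2 ^ 2) *
      jumpKernel α (p.1 - p.2)) := by
  have hJ := jumpKernel_nonneg α (p.1 - p.2)
  rw [farTerm]
  split_ifs
  · rw [abs_mul]
    calc _ ≤ ((C₁ + 1) * jumpKernel α (p.1 - p.2)) *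
          (G p.1 ^ 2 + G p.2 ^ 2 + v p.1 ^ 2 + v p.2 ^ 2) :=
        mul_le_mul (ha.abs_sub_one_mul_le hα hC _ _) (abs_sub_mul_sub_le _ _ _ _)
          (abs_nonneg _) (by positivity)
      _ = _ := by ring
  · rw [abs_zero]
    positivity

theorem BoundedEnv.summable_farTerm (ha : BoundedEnv C₁ a) (hα : 0 < α) (hC : 0 ≤ C₁) (r : ℕ)
    {G v : Vertex d → ℝ} (hG : Summable fun z => G z ^ 2) (hv : Summable fun z => v z ^ 2) :
    Summable (farTerm α a r G v) :=
  summable_of_kernel_bound hα hG hv (ha.abs_farTerm_le hα hC r G v)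

theorem abs_scaleTerm_le_abs_farTerm (r : ℕ) (G v : Vertex d → ℝ) (p : Vertex d × Vertex d) :
    |scaleTerm α a r G v p| ≤ |farTerm α a r G v p| := by
  rw [scaleTerm, farTerm]
  split_ifs with h1 h2 h2
  · exact le_rfl
  · exact absurd h1.1 h2
  · rw [abs_zero]; exact abs_nonneg _
  · exact le_rfl

theorem sum_scaleTerm_eq (r : ℕ) (G v : Vertex d → ℝ) (p : Vertex d × Vertex d) (N : ℕ) :
    ∑ j ∈ Finset.range N, scaleTerm α a (2 ^ j * r) G v p =
      if ‖p.1 - p.2‖ < 2 ^ N * r then farTerm α a r G v p else 0 := by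
  induction N with
  | zero =>
    rw [Finset.sum_range_zero, farTerm]
    split_ifs with h1 h2
    · exact absurd h1 (not_lt.2 (by simpa using h2))
    · rfl
    · rfl
  | succ N ih =>
    rw [Finset.sum_range_succ, ih, scaleTerm, pow_succ]
    push_cast
    have hr : (r : ℝ) ≤ 2 ^ N * r :=
      le_mul_of_one_le_left (Nat.cast_nonneg r) (one_le_pow₀ one_le_two)
    have hr2 : (2 : ℝ) ^ N * r ≤ 2 ^ N * 2 * r := by nlinarith [Nat.cast_nonneg (α := ℝ) r]
    have e : (2 : ℝ) * (2 ^ N * r) = 2 ^ N * 2 * r := by ring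
    rw [e]
    by_cases h1 : ‖p.1 - p.2‖ < 2 ^ N * r
    · rw [if_pos h1, if_pos (h1.trans_le hr2), if_neg (fun h => absurd h1 (not_lt.2 h.1)),
        add_zero]
    · rw [if_neg h1, zero_add]
      have h1' := not_lt.1 h1
      by_cases h2 : ‖p.1 - p.2‖ < 2 ^ N * 2 * r
      · rw [if_pos h2, if_pos ⟨h1', h2⟩, farTerm, if_pos (hr.trans h1')]
      · rw [if_neg h2, if_neg (fun h => h2 h.2)]

theorem BoundedEnv.tendsto_sum_tsum_scaleTerm (ha : BoundedEnv C₁ a) (hα : 0 < α) (hC : 0 ≤ C₁)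
    {r : ℕ} (hr : 0 < r) {G v : Vertex d → ℝ} (hG : Summable fun z => G z ^ 2)
    (hv : Summable fun z => v z ^ 2) :
    Tendsto (fun N => ∑ j ∈ Finset.range N, ∑' p, scaleTerm α a (2 ^ j * r) G v p) atTop
      (𝓝 (∑' p, farTerm α a r G v p)) := by
  have hs : ∀ r, Summable (scaleTerm α a r G v) := fun r =>
    Summable.of_norm_bounded (ha.summable_farTerm hα hC r hG hv).abs
      fun p => abs_scaleTerm_le_abs_farTerm r G v p
  have e : ∀ N, ∑ j ∈ Finset.range N, ∑' p, scaleTerm α a (2 ^ j * r) G v p =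
      ∑' p, if ‖p.1 - p.2‖ < 2 ^ N * r then farTerm α a r G v p else 0 := by
    intro N
    rw [← Summable.tsum_finsetSum fun j _ => hs _]
    exact tsum_congr fun p => sum_scaleTerm_eq r G v p N
  simp only [e]
  refine tendsto_tsum_of_dominated_convergence (ha.summable_farTerm hα hC r hG hv).abs
    (fun p => ?_) (Eventually.of_forall fun N p => ?_)
  · refine tendsto_const_nhds.congr' ?_
    have h2 : Tendsto (fun N : ℕ => (2 : ℝ) ^ N * r) atTop atTop :=
      (tendsto_pow_atTop_atTop_of_one_lt one_lt_two).atTop_mul_const (by exact_mod_cast hr)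
    filter_upwards [h2.eventually_gt_atTop ‖p.1 - p.2‖] with N hN
    rw [if_pos hN]
  · rw [Real.norm_eq_abs]
    split_ifs
    · exact le_rfl
    · rw [abs_zero]; exact abs_nonneg _

/-- The exponent 1 - (d+α)/2 is never zero. For d = 1 the condition α < d makes it positive, the
largest length k dominates and the result is k^(-α/2); for d ≥ 2 it is negative, the smallest length
dominates and the result is k^(d/2-1). -/
theorem exists_sum_dyadic_le (hd : 0 < d) (hα : 0 < α) (hαd : α < d) :
    ∃ A : ℝ, 0 < A ∧ ∀ (k r : ℕ), 0 < k → 0 < r → ∀ N,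
      (k : ℝ) ^ ((d : ℝ) / 2 - 1) * ∑ j ∈ Finset.range N,
        (if (2 : ℝ) ^ j * r ≤ k then ((2 : ℝ) ^ j * r) ^ (1 - ((d : ℝ) + α) / 2) else 0) ≤
        A * ((k : ℝ) ^ ((d : ℝ) / 2 - 1) + (k : ℝ) ^ (-(α / 2))) := by
  set s : ℝ := 1 - ((d : ℝ) + α) / 2 with hs
  rcases Nat.lt_or_ge d 2 with h1 | h2
  · have hd1 : d = 1 := by omega
    have hs0 : 0 < s := by
      subst hd1
      simp only [Nat.cast_one] at hαd hs
      rw [hs]; linarith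
    have ht : 0 < 1 - (2 : ℝ) ^ (-s) := by
      have : (2 : ℝ) ^ (-s) < 1 := Real.rpow_lt_one_of_one_lt_of_neg one_lt_two (by linarith)
      linarith
    refine ⟨1 / (1 - 2 ^ (-s)), by positivity, fun k r hk hr N => ?_⟩
    have hk' : (0 : ℝ) < k := by exact_mod_cast hk
    calc _ ≤ (k : ℝ) ^ ((d : ℝ) / 2 - 1) * ((k : ℝ) ^ s / (1 - 2 ^ (-s))) := by
          gcongr
          exact sum_dyadic_le_of_pos hs0 (by exact_mod_cast hr) hk' N
      _ = 1 / (1 - 2 ^ (-s)) * (k : ℝ) ^ (-(α / 2)) := by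
          have : (k : ℝ) ^ (-(α / 2)) = (k : ℝ) ^ ((d : ℝ) / 2 - 1) * (k : ℝ) ^ s := by
            rw [← Real.rpow_add hk', hs]
            congr 1; ring
          rw [this]; ring
      _ ≤ _ := by
          gcongr
          exact le_add_of_nonneg_left (by positivity)
  · have h2' : (2 : ℝ) ≤ d := by exact_mod_cast h2
    have hs0 : s < 0 := by rw [hs]; linarith
    have ht : 0 < 1 - (2 : ℝ) ^ s := by
      have : (2 : ℝ) ^ s < 1 := Real.rpow_lt_one_of_one_lt_of_neg one_lt_two hs0
      linarith
    refine ⟨1 / (1 - 2 ^ s), by positivity, fun k r hk hr N => ?_⟩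
    have hk' : (0 : ℝ) < k := by exact_mod_cast hk
    calc _ ≤ (k : ℝ) ^ ((d : ℝ) / 2 - 1) * (1 / (1 - 2 ^ s)) := by
          gcongr
          exact sum_dyadic_le_of_neg hs0 (by exact_mod_cast hr) N
      _ ≤ _ := by
          rw [mul_comm]
          gcongr
          exact le_add_of_nonneg_right (by positivity)

/-- Lengths up to k are charged to the energy and longer ones to the ℓ² norm. The constant is chosen
before the environment, k and r, which is what makes the final constant deterministic. -/
theorem exists_abs_tsum_farTerm_le (hd : 0 < d) (hα : 0 < α) (hαd : α < d) (hC : 0 ≤ C₁) {R : ℕ}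
    (hR : 1 ≤ R) {Lip g₀ : ℝ} (hL : 0 ≤ Lip) (hg₀ : 0 ≤ g₀) :
    ∃ A : ℝ, 0 < A ∧ ∀ a : Sym2 (Vertex d) → ℝ, BoundedEnv C₁ a → ∀ k r : ℕ, 0 < k → 0 < r →
      ∀ G : Vertex d → ℝ, (∀ x y, |G x - G y| ≤ Lip / k * eucl (x - y)) → (∀ x, |G x| ≤ g₀) →
      (∀ x, ((R * k : ℕ) : ℝ) < ‖x‖ → G x = 0) →
      (∀ r' : ℕ, r ≤ r' → ∀ c ∈ box d (R * k + 4 * r'), GoodCube α C₁ a r' c) →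
      ∀ v : Vertex d → ℝ, (Summable fun z => v z ^ 2) →
      |∑' p, farTerm α a r G v p| ≤
        A * ((k : ℝ) ^ ((d : ℝ) / 2 - 1) + (k : ℝ) ^ (-(α / 2))) * √(energy α a v) +
          A * (k : ℝ) ^ (-α) * √(∑' z, v z ^ 2) := by
  obtain ⟨A₁, hA₁, hdy⟩ := exists_sum_dyadic_le hd hα hαd
  set K₁ : ℝ := 3 ^ d * (48 * C₁) * (4 * d * Lip) *
    √((11 * R) ^ d * (4 * d) ^ ((d : ℝ) + α) * 2) with hK₁
  set K₂ : ℝ := 3 ^ d * (48 * C₁) * g₀ * √((55 * R) ^ d) with hK₂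
  have hK₁0 : 0 ≤ K₁ := by positivity
  have hK₂0 : 0 ≤ K₂ := by positivity
  have ht : 0 < 1 - (2 : ℝ) ^ (-α) := by
    have : (2 : ℝ) ^ (-α) < 1 := Real.rpow_lt_one_of_one_lt_of_neg one_lt_two (by linarith)
    linarith
  refine ⟨K₁ * A₁ + K₂ / (1 - 2 ^ (-α)) + 1, by positivity,
    fun a ha k r hk hr G hGL hGb hGs hgood v hv => ?_⟩
  have hk' : (0 : ℝ) < k := by exact_mod_cast hk
  set e := √(energy α a v) with he
  set V := √(∑' z, v z ^ 2) with hV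
  have he0 : 0 ≤ e := Real.sqrt_nonneg _
  have hV0 : 0 ≤ V := Real.sqrt_nonneg _
  refine le_of_tendsto (ha.tendsto_sum_tsum_scaleTerm hα hC hr
    (summable_sq_of_eq_zero_of_lt_norm hGs) hv).abs (Eventually.of_forall fun N => ?_)
  have hj : ∀ j : ℕ, |∑' p, scaleTerm α a (2 ^ j * r) G v p| ≤
      K₁ * e * ((k : ℝ) ^ ((d : ℝ) / 2 - 1) * (if (2 : ℝ) ^ j * r ≤ k then
        ((2 : ℝ) ^ j * r) ^ (1 - ((d : ℝ) + α) / 2) else 0)) +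
      K₂ * V * (if (2 : ℝ) ^ j * r ≤ k then 0 else ((2 : ℝ) ^ j * r) ^ (-α)) := by
    intro j
    have hrj : 0 < 2 ^ j * r := by positivity
    have hle : r ≤ 2 ^ j * r := Nat.le_mul_of_pos_left r (by positivity)
    split_ifs with hjk
    · have h1 := ha.abs_scale_le_energy hα hC hrj
        (by exact_mod_cast hjk : 2 ^ j * r ≤ k) hR hL hGL hGs (hgood _ hle) hv
      push_cast at h1 hGs ⊢
      refine h1.trans (le_of_eq ?_)
      rw [← hK₁, ← he]
      ring
    · have h1 := BoundedEnv.abs_scale_le_norm (α := α) (a := a) hC hrj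
        (by exact_mod_cast (not_le.1 hjk).le : k ≤ 2 ^ j * r) hR hg₀ hGb hGs (hgood _ hle) hv
      push_cast at h1 ⊢
      refine h1.trans (le_of_eq ?_)
      rw [← hK₂, ← hV]
      ring
  refine (Finset.abs_sum_le_sum_abs _ _).trans ((Finset.sum_le_sum fun j _ => hj j).trans ?_)
  rw [Finset.sum_add_distrib, ← Finset.mul_sum, ← Finset.mul_sum, ← Finset.mul_sum]
  have h1 := hdy k r hk hr N
  have h2 := sum_dyadic_tail_le hα (r := r) (k := k) (by exact_mod_cast hr) hk' N
  set X : ℝ := (k : ℝ) ^ ((d : ℝ) / 2 - 1) + (k : ℝ) ^ (-(α / 2)) with hX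
  have hX0 : 0 ≤ X := by positivity
  have hka : 0 ≤ (k : ℝ) ^ (-α) := by positivity
  have hq : 0 ≤ K₂ / (1 - 2 ^ (-α)) := by positivity
  have h3 := mul_le_mul_of_nonneg_left h1 (mul_nonneg hK₁0 he0)
  have h4 := mul_le_mul_of_nonneg_left h2 (mul_nonneg hK₂0 hV0)
  have e4 : K₂ * V * ((k : ℝ) ^ (-α) / (1 - 2 ^ (-α))) =
      K₂ / (1 - 2 ^ (-α)) * ((k : ℝ) ^ (-α) * V) := by ring
  rw [e4] at h4
  have h5 : 0 ≤ (k : ℝ) ^ (-α) * V := by positivity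
  have h6 : 0 ≤ X * e := by positivity
  have h7 : 0 ≤ K₁ * A₁ := by positivity
  nlinarith

theorem hasSum_shear_fst {φ ψ : Vertex d → ℝ} (hφ : Summable φ) (hψ : Summable ψ)
    (hφ0 : ∀ z, 0 ≤ φ z) (hψ0 : ∀ z, 0 ≤ ψ z) :
    HasSum (fun p : Vertex d × Vertex d => φ p.1 * ψ (p.1 - p.2)) ((∑' z, φ z) * ∑' z, ψ z) := by
  have h1 := hφ.hasSum.mul hψ.hasSum (hφ.mul_of_nonneg hψ hφ0 hψ0)
  have h2 := (shearEquiv d).hasSum_iff.2 h1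
  exact h2

theorem hasSum_shear_snd {φ ψ : Vertex d → ℝ} (hφ : Summable φ) (hψ : Summable ψ)
    (hφ0 : ∀ z, 0 ≤ φ z) (hψ0 : ∀ z, 0 ≤ ψ z) (hψe : ∀ x y, ψ (x - y) = ψ (y - x)) :
    HasSum (fun p : Vertex d × Vertex d => φ p.2 * ψ (p.1 - p.2)) ((∑' z, φ z) * ∑' z, ψ z) := by
  have h := (Equiv.prodComm (Vertex d) (Vertex d)).hasSum_iff.2 (hasSum_shear_fst hφ hψ hφ0 hψ0)
  refine h.congr_fun fun p => ?_
  simp [hψe p.1 p.2]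

theorem abs_tsum_mul_le_sqrt {ι : Type*} {b f g : ι → ℝ} (hb : ∀ i, 0 ≤ b i)
    (hf : Summable fun i => b i * f i ^ 2) (hg : Summable fun i => b i * g i ^ 2) :
    |∑' i, b i * (f i * g i)| ≤ √(∑' i, b i * f i ^ 2) * √(∑' i, b i * g i ^ 2) := by
  have e : ∀ i, b i * (f i * g i) = (√(b i) * f i) * (√(b i) * g i) := fun i => by
    have := Real.mul_self_sqrt (hb i)
    calc b i * (f i * g i) = (√(b i) * √(b i)) * (f i * g i) := by rw [this]
      _ = _ := by ring
  have e1 : ∀ (h : ι → ℝ) i, b i * h i ^ 2 = (√(b i) * h i) ^ 2 := fun h i => by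
    rw [mul_pow, Real.sq_sqrt (hb i)]
  have hf' := hf
  have hg' := hg
  simp only [e1 f] at hf'
  simp only [e1 g] at hg'
  have hs := summable_mul_of_sq hf' hg'
  rw [tsum_congr e, tsum_congr (e1 f), tsum_congr (e1 g)]
  refine le_of_tendsto hs.hasSum.abs (Eventually.of_forall fun s => ?_)
  rw [← Real.sqrt_mul (tsum_nonneg fun _ => sq_nonneg _)]
  apply Real.le_sqrt_of_sq_le
  rw [sq_abs]
  refine (Finset.sum_mul_sq_le_sq_mul_sq _ _ _).trans ?_
  exact mul_le_mul (hf'.sum_le_tsum _ fun _ _ => sq_nonneg _)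
    (hg'.sum_le_tsum _ fun _ _ => sq_nonneg _) (Finset.sum_nonneg fun _ _ => sq_nonneg _)
    (tsum_nonneg fun _ => sq_nonneg _)

/-- Below the length r no concentration is available. Cauchy–Schwarz with respect to the jump rates
leaves the short-range energy of G, at most C₁ (Lip/k)² times O(k^d) points times ∑ |z|² J(z) =
O(r^(2-α)), J being the jump kernel. -/
theorem exists_abs_tsum_nearTerm_le (hd : 0 < d) (hα : 0 < α) (hα2 : α < 2) (hC : 0 ≤ C₁) {R : ℕ}
    (hR : 1 ≤ R) {Lip : ℝ} :
    ∃ A : ℝ, 0 < A ∧ ∀ a : Sym2 (Vertex d) → ℝ, BoundedEnv C₁ a → ∀ k r : ℕ, 0 < k → 0 < r →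
      ∀ G : Vertex d → ℝ, (∀ x y, |G x - G y| ≤ Lip / k * eucl (x - y)) →
      (∀ x, ((R * k : ℕ) : ℝ) < ‖x‖ → G x = 0) →
      ∀ v : Vertex d → ℝ, (Summable fun z => v z ^ 2) →
      |∑' p, nearTerm α a r G v p| ≤
        A * ((k : ℝ) ^ ((d : ℝ) / 2 - 1) * (r : ℝ) ^ (1 - α / 2)) * √(energy α a v) := by
  classical
  obtain ⟨C, hC0, hsum⟩ := exists_sum_near_le hd hα hα2
  refine ⟨√(C₁ * (2 * (3 * R) ^ d * Lip ^ 2 * C)) * √2 + 1, by positivity,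
    fun a ha k r hk hr G hGL hGs v hv => ?_⟩
  have hk' : (0 : ℝ) < k := by exact_mod_cast hk
  have hk1 : (1 : ℝ) ≤ k := by exact_mod_cast hk
  have hR1 : (1 : ℝ) ≤ R := by exact_mod_cast hR
  have hr' : (0 : ℝ) < r := by exact_mod_cast hr
  set b : Vertex d × Vertex d → ℝ := fun p =>
    if (r : ℝ) ≤ ‖p.1 - p.2‖ then 0 else jumpRate α a p.1 p.2 with hb
  have hb0 : ∀ p, 0 ≤ b p := fun p => by
    simp only [hb]
    split_ifs
    · exact le_rfl
    · exact ha.jumpRate_nonneg hα _ _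
  have hble : ∀ p, b p ≤ jumpRate α a p.1 p.2 := fun p => by
    simp only [hb]
    split_ifs
    · exact ha.jumpRate_nonneg hα _ _
    · exact le_rfl
  have hen : ∀ {u : Vertex d → ℝ}, (Summable fun z => u z ^ 2) →
      Summable fun p : Vertex d × Vertex d => b p * (u p.2 - u p.1) ^ 2 := fun hu =>
    Summable.of_nonneg_of_le (fun p => mul_nonneg (hb0 p) (sq_nonneg _))
      (fun p => mul_le_mul_of_nonneg_right (hble p) (sq_nonneg _)) (ha.summable_energy hα hu)
  have hGsq := summable_sq_of_eq_zero_of_lt_norm hGs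
  have e1 : ∀ p, nearTerm α a r G v p = b p * ((G p.2 - G p.1) * (v p.2 - v p.1)) := fun p => by
    simp only [nearTerm, hb]
    split_ifs
    · rw [zero_mul]
    · rfl
  rw [tsum_congr e1]
  refine (abs_tsum_mul_le_sqrt hb0 (hen hGsq) (hen hv)).trans ?_
  have h2 : √(∑' p : Vertex d × Vertex d, b p * (v p.2 - v p.1) ^ 2) ≤ √2 * √(energy α a v) := by
    rw [← Real.sqrt_mul (by norm_num)]
    apply Real.sqrt_le_sqrt
    rw [energy, ← mul_assoc]
    norm_num
    exact (hen hv).tsum_le_tsum (fun p => mul_le_mul_of_nonneg_right (hble p) (sq_nonneg _))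
      (ha.summable_energy hα hv)
  -- An increment of G vanishes unless one endpoint lies in the support box. The energy of G is
  -- therefore dominated by products φ ⊗ ψ after a shear, one for each endpoint.
  set φ : Vertex d → ℝ := fun x => if x ∈ box d (R * k) then 1 else 0 with hφ
  set ψ : Vertex d → ℝ := fun z => if z ∈ box d r ∧ ‖z‖ < r then eucl z ^ 2 * jumpKernel α z
    else 0 with hψ
  have hφ0 : ∀ z, 0 ≤ φ z := fun z => by simp only [hφ]; split_ifs <;> norm_num
  have hψ0 : ∀ z, 0 ≤ ψ z := fun z => by
    simp only [hψ]
    split_ifs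
    · exact mul_nonneg (sq_nonneg _) (jumpKernel_nonneg _ _)
    · exact le_rfl
  have hφs : Summable φ := summable_of_ne_finset_zero (s := box d (R * k)) fun x hx => if_neg hx
  have hψs : Summable ψ := summable_of_ne_finset_zero (s := box d r)
    fun x hx => if_neg fun h => hx h.1
  have hφt : ∑' z, φ z ≤ (3 * R * k) ^ d := by
    rw [tsum_eq_sum (s := box d (R * k)) fun x hx => if_neg hx, Finset.sum_congr rfl
      fun x hx => if_pos hx, Finset.sum_const, nsmul_eq_mul, mul_one, card_box]
    push_cast
    gcongr
    nlinarith
  have hψt : ∑' z, ψ z ≤ C * (r : ℝ) ^ (2 - α) := by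
    rw [tsum_eq_sum (s := (box d r).filter fun z => ‖z‖ < r)]
    · refine le_trans (le_of_eq (Finset.sum_congr rfl fun z hz => ?_))
        (hsum r hr' _ fun z hz => (Finset.mem_filter.1 hz).2)
      exact if_pos (Finset.mem_filter.1 hz)
    · intro z hz
      rw [Finset.mem_filter] at hz
      exact if_neg hz
  have hψe : ∀ x y, ψ (x - y) = ψ (y - x) := fun x y => by
    simp only [hψ, mem_box_iff_norm, norm_sub_rev x y, jumpKernel_sub_comm α x y]
    rw [← eucl_neg (x - y), neg_sub]
  have hS := ((hasSum_shear_fst hφs hψs hφ0 hψ0).add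
    (hasSum_shear_snd hφs hψs hφ0 hψ0 hψe)).mul_left (C₁ * (Lip / k) ^ 2)
  have h3 : ∀ p : Vertex d × Vertex d, b p * (G p.2 - G p.1) ^ 2 ≤
      C₁ * (Lip / k) ^ 2 * (φ p.1 * ψ (p.1 - p.2) + φ p.2 * ψ (p.1 - p.2)) := by
    intro p
    have hrhs : 0 ≤ C₁ * (Lip / k) ^ 2 * (φ p.1 * ψ (p.1 - p.2) + φ p.2 * ψ (p.1 - p.2)) :=
      mul_nonneg (by positivity) (add_nonneg (mul_nonneg (hφ0 _) (hψ0 _))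
        (mul_nonneg (hφ0 _) (hψ0 _)))
    by_cases hr1 : (r : ℝ) ≤ ‖p.1 - p.2‖
    · simp only [hb, if_pos hr1, zero_mul]
      exact hrhs
    by_cases hz : G p.1 = 0 ∧ G p.2 = 0
    · rw [hz.1, hz.2, sub_zero]
      simpa using hrhs
    have hmem : 1 ≤ φ p.1 + φ p.2 := by
      have : p.1 ∈ box d (R * k) ∨ p.2 ∈ box d (R * k) := by
        by_contra hcon
        push Not at hcon
        rw [mem_box_iff_norm, mem_box_iff_norm, not_le, not_le] at hcon
        exact hz ⟨hGs _ hcon.1, hGs _ hcon.2⟩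
      rcases this with h | h
      · have h1 : φ p.1 = 1 := if_pos h
        linarith [hφ0 p.2]
      · have h1 : φ p.2 = 1 := if_pos h
        linarith [hφ0 p.1]
    have hψv : ψ (p.1 - p.2) = eucl (p.1 - p.2) ^ 2 * jumpKernel α (p.1 - p.2) :=
      if_pos ⟨mem_box_iff_norm.2 (not_le.1 hr1).le, not_le.1 hr1⟩
    have hG2 : (G p.2 - G p.1) ^ 2 ≤ (Lip / k * eucl (p.1 - p.2)) ^ 2 := by
      rw [← sq_abs, abs_sub_comm]
      exact pow_le_pow_left₀ (abs_nonneg _) (hGL _ _) 2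
    have hJ := jumpKernel_nonneg α (p.1 - p.2)
    calc b p * (G p.2 - G p.1) ^ 2
        ≤ (C₁ * jumpKernel α (p.1 - p.2)) * (Lip / k * eucl (p.1 - p.2)) ^ 2 :=
          mul_le_mul ((hble p).trans (ha.jumpRate_le hα _ _)) hG2 (sq_nonneg _) (by positivity)
      _ = C₁ * (Lip / k) ^ 2 * (1 * ψ (p.1 - p.2)) := by rw [hψv]; ring
      _ ≤ C₁ * (Lip / k) ^ 2 * ((φ p.1 + φ p.2) * ψ (p.1 - p.2)) := by
          have := hψ0 (p.1 - p.2)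
          gcongr
      _ = _ := by ring
  have h4 : ∑' p : Vertex d × Vertex d, b p * (G p.2 - G p.1) ^ 2 ≤
      (C₁ * (2 * (3 * R) ^ d * Lip ^ 2 * C)) *
        ((k : ℝ) ^ ((d : ℝ) / 2 - 1) * (r : ℝ) ^ (1 - α / 2)) ^ 2 := by
    have h5 := (hen hGsq).tsum_le_tsum h3 hS.summable
    rw [hS.tsum_eq] at h5
    refine h5.trans ?_
    have e2 : ((k : ℝ) ^ ((d : ℝ) / 2 - 1)) ^ 2 = (k : ℝ) ^ d / k ^ 2 := by
      rw [← Real.rpow_natCast, ← Real.rpow_mul hk'.le, ← Real.rpow_natCast, ← Real.rpow_natCast,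
        ← Real.rpow_sub hk']
      congr 1
      push_cast
      ring
    have e3 : ((r : ℝ) ^ (1 - α / 2)) ^ 2 = (r : ℝ) ^ (2 - α) := by
      rw [← Real.rpow_natCast, ← Real.rpow_mul hr'.le]
      congr 1
      push_cast
      ring
    rw [mul_pow ((k : ℝ) ^ ((d : ℝ) / 2 - 1)), e2, e3]
    have hψt0 : 0 ≤ ∑' z, ψ z := tsum_nonneg hψ0
    calc C₁ * (Lip / k) ^ 2 * ((∑' z, φ z) * (∑' z, ψ z) + (∑' z, φ z) * ∑' z, ψ z)
        = C₁ * (Lip / k) ^ 2 * (2 * ((∑' z, φ z) * (∑' z, ψ z))) := by ring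
      _ ≤ C₁ * (Lip / k) ^ 2 * (2 * ((3 * R * k) ^ d * (C * (r : ℝ) ^ (2 - α)))) := by
          gcongr
      _ = _ := by
          rw [mul_pow _ (k : ℝ) d, div_pow]
          ring
  have h5 : √(∑' p : Vertex d × Vertex d, b p * (G p.2 - G p.1) ^ 2) ≤
      √(C₁ * (2 * (3 * R) ^ d * Lip ^ 2 * C)) *
        ((k : ℝ) ^ ((d : ℝ) / 2 - 1) * (r : ℝ) ^ (1 - α / 2)) := by
    refine (Real.sqrt_le_sqrt h4).trans (le_of_eq ?_)
    rw [Real.sqrt_mul (by positivity), Real.sqrt_sq (by positivity)]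
  set Y : ℝ := (k : ℝ) ^ ((d : ℝ) / 2 - 1) * (r : ℝ) ^ (1 - α / 2) with hY
  have hY0 : 0 ≤ Y := by positivity
  calc _ ≤ (√(C₁ * (2 * (3 * R) ^ d * Lip ^ 2 * C)) * Y) * (√2 * √(energy α a v)) := by
        gcongr
    _ = (√(C₁ * (2 * (3 * R) ^ d * Lip ^ 2 * C)) * √2) * Y * √(energy α a v) := by ring
    _ ≤ _ := by
        gcongr
        linarith

end NearFar


/-! ### Regularity of test functions. -/

section SecondDifference

variable {d : ℕ} {α : ℝ}

/-- The symmetric second difference of `g` at `x` with increment `z`. -/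
def secondDiff (g : Space d → ℝ) (x z : Space d) : ℝ := g (x + z) + g (x - z) - 2 * g x

/-- Quantitative regularity and support bounds for a test function. -/
structure TestBounds (α : ℝ) (g : Space d → ℝ) (B : ℝ) (R : ℕ) : Prop where
  pos : 0 < B
  one_le : 1 ≤ R
  continuous : Continuous g
  bound : ∀ x, |g x| ≤ B
  lip : ∀ x y, |g x - g y| ≤ B * ‖x - y‖
  secondDiff_le : ∀ x z, |secondDiff g x z| ≤ B * ‖z‖ ^ 2
  secondDiff_sub_le : ∀ (M : ℝ) (x z z' : Space d), ‖z‖ ≤ M → ‖z'‖ ≤ M →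
    |secondDiff g x z - secondDiff g x z'| ≤ B * M ^ (α / 2) * ‖z - z'‖
  support : ∀ x, (R : ℝ) < ‖x‖ → g x = 0

theorem secondDiff_sub_le_of_fderiv {g : Space d → ℝ} (hg : Differentiable ℝ g) {c M : ℝ}
    {x z z' : Space d} (hc : ∀ y, ‖y‖ ≤ M → ‖fderiv ℝ g (x + y) - fderiv ℝ g (x - y)‖ ≤ c)
    (hz : ‖z‖ ≤ M) (hz' : ‖z'‖ ≤ M) :
    |secondDiff g x z - secondDiff g x z'| ≤ c * ‖z - z'‖ := by
  have hder : ∀ y : Space d, HasFDerivAt (secondDiff g x)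
      (fderiv ℝ g (x + y) - fderiv ℝ g (x - y)) y := by
    intro y
    have h1 : HasFDerivAt (fun y => g (x + y)) (fderiv ℝ g (x + y)) y := by
      have := (hg (x + y)).hasFDerivAt.comp y ((hasFDerivAt_id y).const_add x)
      rw [ContinuousLinearMap.comp_id] at this
      exact this
    have h2 : HasFDerivAt (fun y => g (x - y)) (-fderiv ℝ g (x - y)) y := by
      have := (hg (x - y)).hasFDerivAt.comp y ((hasFDerivAt_id y).const_sub x)
      rw [ContinuousLinearMap.comp_neg, ContinuousLinearMap.comp_id] at this
      exact this
    have h3 := (h1.add h2).sub_const (2 * g x)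
    rw [sub_eq_add_neg]
    exact h3
  have := Convex.norm_image_sub_le_of_norm_hasFDerivWithin_le (𝕜 := ℝ)
    (s := Metric.closedBall (0 : Space d) M) (f := secondDiff g x)
    (fun y _ => (hder y).hasFDerivWithinAt) (fun y hy => hc y (by simpa using hy))
    (convex_closedBall _ _) (x := z') (y := z) (by simpa using hz') (by simpa using hz)
  simpa using this

theorem min_le_rpow {M s : ℝ} (hM : 0 ≤ M) (hs0 : 0 < s) (hs1 : s ≤ 1) : min M 1 ≤ M ^ s := by
  rcases le_total M 1 with h | h
  · refine (min_le_left _ _).trans ?_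
    rcases hM.eq_or_lt with rfl | h0
    · rw [Real.zero_rpow hs0.ne']
    · calc M = M ^ (1 : ℝ) := (Real.rpow_one M).symm
        _ ≤ M ^ s := Real.rpow_le_rpow_of_exponent_ge h0 h hs1
  · exact (min_le_right _ _).trans (Real.one_le_rpow h hs0.le)

/-- The derivative in z of the second difference is at most a constant times min(M, 1) on ‖z‖ ≤ M,
by the Lipschitz bounds for the gradient and for g. Interpolation to M^(α/2) provides one power
which, against the kernel, stays integrable at infinity. -/
theorem exists_testBounds (hα : 0 < α) (hα2 : α < 2) {g : Space d → ℝ}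
    (hg : ContDiff ℝ (⊤ : ℕ∞) g) (hc : HasCompactSupport g) : ∃ B R, TestBounds α g B R := by
  have hg1 : ContDiff ℝ (⊤ : ℕ∞) (fderiv ℝ g) := hg.fderiv_right le_rfl
  obtain ⟨b, hb⟩ := hc.exists_bound_of_continuous hg.continuous
  obtain ⟨L, hL⟩ := hg.lipschitzWith_of_hasCompactSupport hc (by simp)
  obtain ⟨H, hH⟩ := hg1.lipschitzWith_of_hasCompactSupport (hc.fderiv ℝ) (by simp)
  obtain ⟨ρ, hρ⟩ := hc.isCompact.isBounded.subset_closedBall (0 : Space d)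
  have hdiff : Differentiable ℝ g := hg.differentiable (by simp)
  have hb0 : 0 ≤ b := (norm_nonneg _).trans (hb 0)
  set B : ℝ := b + 2 * L + 2 * H + 1 with hB
  have hL0 : (0 : ℝ) ≤ L := L.2
  have hH0 : (0 : ℝ) ≤ H := H.2
  have hfd : ∀ x, ‖fderiv ℝ g x‖ ≤ L := fun x => norm_fderiv_le_of_lipschitz ℝ hL
  have h1 : ∀ (M : ℝ) (x y : Space d), ‖y‖ ≤ M →
      ‖fderiv ℝ g (x + y) - fderiv ℝ g (x - y)‖ ≤ 2 * H * M := by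
    intro M x y hy
    have := hH.dist_le_mul (x + y) (x - y)
    rw [dist_eq_norm, dist_eq_norm] at this
    refine this.trans ?_
    have e : x + y - (x - y) = (2 : ℝ) • y := by rw [two_smul]; abel
    rw [e, norm_smul]
    norm_num
    nlinarith
  have h2 : ∀ x y : Space d, ‖fderiv ℝ g (x + y) - fderiv ℝ g (x - y)‖ ≤ 2 * L := fun x y =>
    (norm_sub_le _ _).trans (by linarith [hfd (x + y), hfd (x - y)])
  refine ⟨B, ⌈ρ⌉₊ + 1, by positivity, by omega, hg.continuous, fun x => ?_, fun x y => ?_,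
    fun x z => ?_, fun M x z z' hz hz' => ?_, fun x hx => ?_⟩
  · exact (hb x).trans (by linarith)
  · have := hL.dist_le_mul x y
    rw [Real.dist_eq, dist_eq_norm] at this
    refine this.trans ?_
    gcongr
    linarith
  · have := secondDiff_sub_le_of_fderiv hdiff (z := z) (z' := 0) (h1 ‖z‖ x) le_rfl (by simp)
    have e : secondDiff g x 0 = 0 := by rw [secondDiff, add_zero, sub_zero]; ring
    rw [e, sub_zero, sub_zero] at this
    refine this.trans ?_
    nlinarith [sq_nonneg ‖z‖]
  · have hM : 0 ≤ M := (norm_nonneg z).trans hz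
    refine secondDiff_sub_le_of_fderiv hdiff (M := M) (fun y hy => ?_) hz hz'
    have h3 : ‖fderiv ℝ g (x + y) - fderiv ℝ g (x - y)‖ ≤ B * min M 1 := by
      rcases le_total M 1 with h | h
      · rw [min_eq_left h]
        refine (h1 M x y hy).trans ?_
        gcongr
        linarith
      · rw [min_eq_right h, mul_one]
        exact (h2 x y).trans (by linarith)
    refine h3.trans ?_
    gcongr
    exact min_le_rpow hM (by linarith) (by linarith)
  · by_contra hne
    have := hρ (subset_tsupport g (Function.mem_support.2 hne))
    rw [mem_closedBall_zero_iff] at this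
    have h3 := Nat.le_ceil ρ
    push_cast at hx
    linarith

end SecondDifference

/-! ### Integrable majorants and L² bounds on strips. -/

section KernelBounds

variable {d : ℕ} {α : ℝ}

/-- The integrand of the symmetrised limit operator. -/
noncomputable def fracDensity (α : ℝ) (g : Space d → ℝ) (x ζ : Space d) : ℝ :=
  secondDiff g x ζ * ‖ζ‖ ^ (-((d : ℝ) + α))

/-- The pairs `(x, ζ)` such that one of `x`, `x + ζ`, `x - ζ` is within distance `ρ` of `0`. -/
def reach (d : ℕ) (ρ : ℝ) : Set (Space d × Space d) :=
  {p | ‖p.1‖ ≤ ρ ∨ ‖p.1 + p.2‖ ≤ ρ ∨ ‖p.1 - p.2‖ ≤ ρ}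

theorem measurableSet_reach (ρ : ℝ) : MeasurableSet (reach d ρ) := by
  have h : ∀ f : Space d × Space d → Space d, Continuous f →
      MeasurableSet {p : Space d × Space d | ‖f p‖ ≤ ρ} := fun f hf =>
    (isClosed_le hf.norm continuous_const).measurableSet
  exact (h _ continuous_fst).union ((h _ (continuous_fst.add continuous_snd)).union
    (h _ (continuous_fst.sub continuous_snd)))

theorem TestBounds.secondDiff_eq_zero {g : Space d → ℝ} {B : ℝ} {R : ℕ} (h : TestBounds α g B R)
    {x z : Space d} (hxz : (x, z) ∉ reach d R) : secondDiff g x z = 0 := by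
  have h1 : ¬ (‖x‖ ≤ R ∨ ‖x + z‖ ≤ R ∨ ‖x - z‖ ≤ R) := hxz
  push Not at h1
  rw [secondDiff, h.support _ h1.1, h.support _ h1.2.1, h.support _ h1.2.2]
  ring

/-- The weight `min (‖ζ‖ ^ 2) 1 * ‖ζ‖ ^ (-(d + α))`. -/
noncomputable def levyWeight (α : ℝ) (ζ : Space d) : ℝ :=
  min (‖ζ‖ ^ 2) 1 * ‖ζ‖ ^ (-((d : ℝ) + α))

theorem levyWeight_nonneg (ζ : Space d) : 0 ≤ levyWeight α ζ :=
  mul_nonneg (le_min (sq_nonneg _) zero_le_one) (Real.rpow_nonneg (norm_nonneg _) _)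

theorem measurable_levyWeight : Measurable (levyWeight (d := d) α) := by
  unfold levyWeight
  fun_prop

theorem lintegral_levyWeight_lt_top (hd : 0 < d) (hα : 0 < α) (hα2 : α < 2) :
    ∫⁻ ζ : Space d, ENNReal.ofReal (levyWeight α ζ) < ⊤ := by
  obtain ⟨C, -, hC⟩ := exists_lintegral_near_le hd (β := d + α - 2) (by linarith)
  obtain ⟨C', -, hC'⟩ := exists_lintegral_far_le (d := d) (β := d + α) (by linarith)
  have hm : MeasurableSet {ζ : Space d | ‖ζ‖ < 1} := measurableSet_lt measurable_norm measurable_const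
  have : Nonempty (Fin d) := ⟨⟨0, hd⟩⟩
  have h0 : ∀ᵐ ζ : Space d, ζ ≠ 0 :=
    compl_mem_ae_iff.2 (measure_singleton (μ := (volume : Measure (Space d))) 0)
  rw [← lintegral_add_compl _ hm]
  refine ENNReal.add_lt_top.2 ⟨?_, ?_⟩
  · refine lt_of_le_of_lt ?_ ((hC 1 one_pos).trans_lt ENNReal.ofReal_lt_top)
    refine lintegral_mono_ae (ae_restrict_of_ae ?_)
    filter_upwards [h0] with ζ hζ
    have hζ' : 0 < ‖ζ‖ := norm_pos_iff.2 hζ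
    apply ENNReal.ofReal_le_ofReal
    have e : ‖ζ‖ ^ (-((d : ℝ) + α - 2)) = ‖ζ‖ ^ 2 * ‖ζ‖ ^ (-((d : ℝ) + α)) := by
      rw [← Real.rpow_natCast, ← Real.rpow_add hζ']
      congr 1
      push_cast
      ring
    rw [levyWeight, e]
    gcongr
    exact min_le_left _ _
  · have hcompl : {ζ : Space d | ‖ζ‖ < 1}ᶜ = {ζ | 1 ≤ ‖ζ‖} := by ext; simp
    rw [hcompl]
    refine lt_of_le_of_lt ?_ ((hC' 1 one_pos).trans_lt ENNReal.ofReal_lt_top)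
    refine lintegral_mono fun ζ => ENNReal.ofReal_le_ofReal ?_
    rw [levyWeight]
    exact mul_le_of_le_one_left (by positivity) (min_le_right _ _)

theorem integrable_levyWeight (hd : 0 < d) (hα : 0 < α) (hα2 : α < 2) :
    Integrable (levyWeight (d := d) α) := by
  refine ⟨measurable_levyWeight.aestronglyMeasurable, ?_⟩
  rw [hasFiniteIntegral_iff_ofReal (Eventually.of_forall levyWeight_nonneg)]
  exact lintegral_levyWeight_lt_top hd hα hα2

theorem TestBounds.abs_fracDensity_le {g : Space d → ℝ} {B : ℝ} {R : ℕ} (h : TestBounds α g B R)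
    (x ζ : Space d) : |fracDensity α g x ζ| ≤ 4 * B * levyWeight α ζ := by
  have hB := h.pos
  rw [fracDensity, abs_mul, abs_of_nonneg (Real.rpow_nonneg (norm_nonneg ζ) _), levyWeight,
    ← mul_assoc]
  refine mul_le_mul_of_nonneg_right ?_ (Real.rpow_nonneg (norm_nonneg ζ) _)
  have h1 := h.secondDiff_le x ζ
  have h2 : |secondDiff g x ζ| ≤ 4 * B := by
    have e1 := abs_le.1 (h.bound (x + ζ))
    have e2 := abs_le.1 (h.bound (x - ζ))
    have e3 := abs_le.1 (h.bound x)
    rw [secondDiff, abs_le]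
    constructor <;> linarith
  rcases le_total (‖ζ‖ ^ 2) 1 with h3 | h3
  · rw [min_eq_left h3]
    nlinarith [sq_nonneg ‖ζ‖]
  · rw [min_eq_right h3]
    linarith

theorem TestBounds.enorm_fracDensity_le {g : Space d → ℝ} {B : ℝ} {R : ℕ}
    (h : TestBounds α g B R) (x ζ : Space d) :
    ‖fracDensity α g x ζ‖ₑ ≤
      ENNReal.ofReal (4 * B * levyWeight α ζ) * (reach d R).indicator 1 (x, ζ) := by
  by_cases hx : (x, ζ) ∈ reach d R
  · rw [Set.indicator_of_mem hx, Pi.one_apply, mul_one, Real.enorm_eq_ofReal_abs]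
    exact ENNReal.ofReal_le_ofReal (h.abs_fracDensity_le x ζ)
  · rw [fracDensity, h.secondDiff_eq_zero hx, zero_mul, enorm_zero]
    exact zero_le

theorem TestBounds.measurable_fracDensity {g : Space d → ℝ} {B : ℝ} {R : ℕ}
    (h : TestBounds α g B R) :
    Measurable fun p : Space d × Space d => fracDensity α g p.1 p.2 := by
  have := h.continuous
  have h1 : Continuous fun p : Space d × Space d => secondDiff g p.1 p.2 := by
    unfold secondDiff
    fun_prop
  unfold fracDensity
  exact h1.measurable.mul (by fun_prop)

theorem measurable_mul_indicator_reach {X : Type*} [MeasurableSpace X] {ι : X → Space d}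
    (hι : Measurable ι) {ψ : Space d → ENNReal} (hψ : Measurable ψ) (ρ : ℝ) :
    Measurable fun p : X × Space d => ψ p.2 * (reach d ρ).indicator 1 (ι p.1, p.2) := by
  have hpair : Measurable fun p : X × Space d => (ι p.1, p.2) := by fun_prop
  exact (hψ.comp measurable_snd).mul
    ((measurable_one.indicator (measurableSet_reach ρ)).comp hpair)

theorem lintegral_lintegral_reach_le {X : Type*} [MeasurableSpace X] {μ : Measure X} [SFinite μ]
    {ι : X → Space d} (hι : Measurable ι) {ψ : Space d → ENNReal} (hψ : Measurable ψ) {ρ : ℝ}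
    {m : ENNReal} (hm : ∀ ζ, μ {x | (ι x, ζ) ∈ reach d ρ} ≤ m) :
    ∫⁻ x, (∫⁻ ζ, ψ ζ * (reach d ρ).indicator 1 (ι x, ζ)) ∂μ ≤ m * ∫⁻ ζ, ψ ζ := by
  rw [lintegral_lintegral_swap (measurable_mul_indicator_reach hι hψ ρ).aemeasurable,
    ← lintegral_const_mul _ hψ]
  refine lintegral_mono fun ζ => ?_
  have hms : MeasurableSet {x | (ι x, ζ) ∈ reach d ρ} :=
    (measurableSet_reach ρ).preimage (hι.prodMk measurable_const)
  have e : ∀ x, (reach d ρ).indicator (1 : Space d × Space d → ENNReal) (ι x, ζ) =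
      {x | (ι x, ζ) ∈ reach d ρ}.indicator 1 x := fun x => rfl
  simp only [e]
  rw [lintegral_const_mul _ (measurable_one.indicator hms), lintegral_indicator_one hms, mul_comm]
  gcongr
  exact hm ζ

/-- A Schur-type bound for kernels that are supported near the diagonal strips of `reach`. -/
theorem lintegral_sq_lintegral_reach_le {X : Type*} [MeasurableSpace X] {μ : Measure X} [SFinite μ]
    {ι : X → Space d} (hι : Measurable ι) {ψ : Space d → ENNReal} (hψ : Measurable ψ) {ρ : ℝ}
    {m : ENNReal} (hm : ∀ ζ, μ {x | (ι x, ζ) ∈ reach d ρ} ≤ m) :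
    ∫⁻ x, (∫⁻ ζ, ψ ζ * (reach d ρ).indicator 1 (ι x, ζ)) ^ 2 ∂μ ≤ m * (∫⁻ ζ, ψ ζ) ^ 2 := by
  set T : X → ENNReal := fun x => ∫⁻ ζ, ψ ζ * (reach d ρ).indicator 1 (ι x, ζ) with hT
  have hTm : Measurable T := (measurable_mul_indicator_reach hι hψ ρ).lintegral_prod_right'
  -- Schur's test: T is bounded by ∫ψ and its integral by m ∫ψ. With a general map `ι` the argument
  -- serves both Lebesgue measure and counting measure on the lattice.
  have hT1 : ∀ x, T x ≤ ∫⁻ ζ, ψ ζ := fun x => lintegral_mono fun ζ =>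
    mul_le_of_le_one_right zero_le (Set.indicator_le_self' (fun _ _ => zero_le) _)
  calc ∫⁻ x, T x ^ 2 ∂μ ≤ ∫⁻ x, (∫⁻ ζ, ψ ζ) * T x ∂μ :=
        lintegral_mono fun x => by rw [pow_two]; gcongr; exact hT1 x
    _ = (∫⁻ ζ, ψ ζ) * ∫⁻ x, T x ∂μ := lintegral_const_mul _ hTm
    _ ≤ (∫⁻ ζ, ψ ζ) * (m * ∫⁻ ζ, ψ ζ) := by
        gcongr
        exact lintegral_lintegral_reach_le hι hψ hm
    _ = _ := by ring

theorem volume_reach_le (ρ : ℝ) (ζ : Space d) :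
    volume {x : Space d | (x, ζ) ∈ reach d ρ} ≤
      3 * volume (Metric.closedBall (0 : Space d) ρ) := by
  have hsub : {x : Space d | (x, ζ) ∈ reach d ρ} ⊆ Metric.closedBall 0 ρ ∪
      (Metric.closedBall (-ζ) ρ ∪ Metric.closedBall ζ ρ) := by
    rintro x (h | h | h)
    · left; simpa using h
    · right; left
      simpa [dist_eq_norm] using h
    · right; right
      simpa [dist_eq_norm] using h
  refine (measure_mono hsub).trans ((measure_union_le _ _).trans ?_)
  have e : ∀ y : Space d, volume (Metric.closedBall y ρ) =
      volume (Metric.closedBall (0 : Space d) ρ) := fun y =>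
    Measure.addHaar_closedBall_center volume y ρ
  calc _ ≤ volume (Metric.closedBall (0 : Space d) ρ) +
        (volume (Metric.closedBall (0 : Space d) ρ) +
          volume (Metric.closedBall (0 : Space d) ρ)) := by
        gcongr
        refine (measure_union_le _ _).trans ?_
        rw [e, e ζ]
    _ = _ := by ring

/-- Each lattice point stands for a cell of volume k^(-d), and these cells fit into the same region
thickened by d. -/
theorem count_reach_le {k : ℕ} (hk : 0 < k) (ρ : ℝ) (ζ : Space d) :
    Measure.count {z : Vertex d | (latticePoint k z, ζ) ∈ reach d ρ} ≤
      ENNReal.ofReal ((k : ℝ) ^ d) * (3 * volume (Metric.closedBall (0 : Space d) (ρ + d))) := by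
  have hk' : (0 : ℝ) < k := by exact_mod_cast hk
  have hk1 : (1 : ℝ) ≤ k := by exact_mod_cast hk
  set S : Set (Vertex d) := {z | (latticePoint k z, ζ) ∈ reach d ρ} with hS
  have h1 := lintegral_comp_cellIndex hk (S.indicator 1)
  have h2 : ∑' z, S.indicator (1 : Vertex d → ENNReal) z = Measure.count S := by
    rw [← lintegral_count, lintegral_indicator_one (Set.to_countable S).measurableSet]
  have h3 : ∫⁻ x, S.indicator (1 : Vertex d → ENNReal) (cellIndex k x) ≤
      3 * volume (Metric.closedBall (0 : Space d) (ρ + d)) := by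
    refine le_trans ?_ (volume_reach_le (ρ + d) ζ)
    have e : ∀ x, S.indicator (1 : Vertex d → ENNReal) (cellIndex k x) =
        (cellIndex k ⁻¹' S).indicator 1 x := fun x => rfl
    simp only [e]
    rw [lintegral_indicator_one (measurable_cellIndex k (Set.to_countable S).measurableSet)]
    refine measure_mono fun x hx => ?_
    have hle : ‖x - latticePoint k (cellIndex k x)‖ ≤ d :=
      (norm_sub_latticePoint_cellIndex_le hk x).trans (div_le_self (by positivity) hk1)
    set y := latticePoint k (cellIndex k x) with hy
    have hx' : ‖y‖ ≤ ρ ∨ ‖y + ζ‖ ≤ ρ ∨ ‖y - ζ‖ ≤ ρ := hx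
    change ‖x‖ ≤ ρ + d ∨ ‖x + ζ‖ ≤ ρ + d ∨ ‖x - ζ‖ ≤ ρ + d
    have key : ∀ w : Space d, ‖y + w‖ ≤ ρ → ‖x + w‖ ≤ ρ + d := fun w hw => by
      have e : x + w = (y + w) + (x - y) := by abel
      rw [e]
      exact (norm_add_le _ _).trans (add_le_add hw hle)
    rcases hx' with h | h | h
    · left; simpa using key 0 (by simpa using h)
    · right; left; exact key ζ h
    · right; right
      rw [sub_eq_add_neg] at h ⊢
      exact key _ h
  rw [h1, h2] at h3
  have h4 : ENNReal.ofReal ((k : ℝ) ^ d) * ENNReal.ofReal (((k : ℝ) ^ d)⁻¹) = 1 := by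
    rw [← ENNReal.ofReal_mul (by positivity), mul_inv_cancel₀ (by positivity), ENNReal.ofReal_one]
  calc Measure.count S = ENNReal.ofReal ((k : ℝ) ^ d) *
        (ENNReal.ofReal (((k : ℝ) ^ d)⁻¹) * Measure.count S) := by rw [← mul_assoc, h4, one_mul]
    _ ≤ _ := by gcongr

end KernelBounds


/-! ### The principal value as an absolutely convergent integral. -/

section FractionalLaplacian

variable {d : ℕ} {α B : ℝ} {R : ℕ} {g : Space d → ℝ}

theorem integrableOn_norm_rpow_far {β : ℝ} (hβ : (d : ℝ) < β) {ε : ℝ} (hε : 0 < ε) :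
    IntegrableOn (fun ζ : Space d => ‖ζ‖ ^ (-β)) {ζ | ε ≤ ‖ζ‖} := by
  obtain ⟨C, -, hC⟩ := exists_lintegral_far_le hβ
  refine ⟨Measurable.aestronglyMeasurable (by fun_prop), ?_⟩
  rw [hasFiniteIntegral_iff_ofReal
    (Eventually.of_forall fun ζ => Real.rpow_nonneg (norm_nonneg _) _)]
  exact (hC ε hε).trans_lt ENNReal.ofReal_lt_top

theorem TestBounds.integrable_fracDensity (h : TestBounds α g B R) (hd : 0 < d) (hα : 0 < α)
    (hα2 : α < 2) (x : Space d) : Integrable (fracDensity α g x) := by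
  refine Integrable.mono' ((integrable_levyWeight hd hα hα2).const_mul (4 * B)) ?_
    (Eventually.of_forall fun ζ => h.abs_fracDensity_le x ζ)
  exact (h.measurable_fracDensity.comp measurable_prodMk_left).aestronglyMeasurable

/-- Averaging over ζ and -ζ replaces first differences by second differences; both halves are
integrable because the singularity is cut off. -/
theorem TestBounds.setIntegral_eq (h : TestBounds α g B R) (hα : 0 < α) (x : Space d) {ε : ℝ}
    (hε : 0 < ε) :
    ∫ y in {y : Space d | ε ≤ ‖y - x‖}, (g y - g x) / ‖x - y‖ ^ ((d : ℝ) + α) =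
      1 / 2 * ∫ ζ, {ζ : Space d | ε ≤ ‖ζ‖}.indicator (fracDensity α g x) ζ := by
  have hm : MeasurableSet {ζ : Space d | ε ≤ ‖ζ‖} := measurableSet_le measurable_const measurable_norm
  have hm' : MeasurableSet {y : Space d | ε ≤ ‖y - x‖} :=
    measurableSet_le measurable_const (by fun_prop)
  have hgc := h.continuous
  set H : Space d → ℝ := {ζ : Space d | ε ≤ ‖ζ‖}.indicator
    (fun ζ => (g (x + ζ) - g x) * ‖ζ‖ ^ (-((d : ℝ) + α))) with hH
  have hHi : Integrable H := by
    rw [hH, integrable_indicator_iff hm]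
    refine Integrable.bdd_mul (integrableOn_norm_rpow_far (by linarith) hε)
      (c := 2 * B) (by fun_prop) (Eventually.of_forall fun ζ => ?_)
    rw [Real.norm_eq_abs, abs_le]
    have h1 := abs_le.1 (h.bound (x + ζ))
    have h2 := abs_le.1 (h.bound x)
    constructor <;> linarith
  rw [← integral_indicator hm', ← integral_add_left_eq_self _ x]
  have e1 : ∀ ζ, {y : Space d | ε ≤ ‖y - x‖}.indicator
      (fun y => (g y - g x) / ‖x - y‖ ^ ((d : ℝ) + α)) (x + ζ) = H ζ := by
    intro ζ
    simp only [hH, Set.indicator_apply]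
    change (if ε ≤ ‖x + ζ - x‖ then _ else _) = if ε ≤ ‖ζ‖ then _ else _
    have e2 : x - (x + ζ) = -ζ := by abel
    rw [add_sub_cancel_left, e2, norm_neg, Real.rpow_neg (norm_nonneg _), div_eq_mul_inv]
  simp only [e1]
  have e3 : ∀ ζ, {ζ : Space d | ε ≤ ‖ζ‖}.indicator (fracDensity α g x) ζ = H ζ + H (-ζ) := by
    intro ζ
    simp only [hH, Set.indicator_apply]
    change (if ε ≤ ‖ζ‖ then _ else _) = (if ε ≤ ‖ζ‖ then _ else _) + if ε ≤ ‖-ζ‖ then _ else _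
    rw [norm_neg]
    split_ifs
    · rw [fracDensity, secondDiff, ← sub_eq_add_neg]
      ring
    · simp
  simp only [e3]
  have hneg : ∫ ζ, H (-ζ) = ∫ ζ, H ζ := integral_neg_eq_self H volume
  have h1 : ∫ ζ, (H ζ + H (-ζ)) = 2 * ∫ ζ, H ζ := by
    rw [integral_add hHi hHi.comp_neg, hneg]
    ring
  rw [h1]
  ring

/-- Second differences are O(min(‖ζ‖², 1)), so the symmetrised integrand has the Lévy weight as an
integrable majorant and the cutoff is removed by dominated convergence. -/
theorem TestBounds.fracLap_eq (h : TestBounds α g B R) (hd : 0 < d) (hα : 0 < α) (hα2 : α < 2)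
    (x : Space d) : fracLap α g x = 1 / 2 * ∫ ζ, fracDensity α g x ζ := by
  rw [fracLap]
  refine Tendsto.limUnder_eq ?_
  have hmeas : Measurable (fracDensity α g x) :=
    h.measurable_fracDensity.comp measurable_prodMk_left
  have h1 : Tendsto (fun ε : ℝ => 1 / 2 * ∫ ζ, {ζ : Space d | ε ≤ ‖ζ‖}.indicator
      (fracDensity α g x) ζ) (𝓝[>] 0) (𝓝 (1 / 2 * ∫ ζ, fracDensity α g x ζ)) := by
    refine Tendsto.const_mul _ (tendsto_integral_filter_of_dominated_convergence
      (fun ζ => 4 * B * levyWeight α ζ) (Eventually.of_forall fun ε => ?_)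
      (Eventually.of_forall fun ε => Eventually.of_forall fun ζ => ?_)
      ((integrable_levyWeight hd hα hα2).const_mul _) (Eventually.of_forall fun ζ => ?_))
    · exact (hmeas.indicator
        (measurableSet_le measurable_const measurable_norm)).aestronglyMeasurable
    · exact (norm_indicator_le_norm_self _ _).trans (h.abs_fracDensity_le x ζ)
    · rcases eq_or_ne ζ 0 with rfl | hζ
      · have : fracDensity α g x 0 = 0 := by
          rw [fracDensity, secondDiff, add_zero, sub_zero]
          ring
        rw [this]
        refine tendsto_const_nhds.congr fun ε => ?_
        rw [Set.indicator_apply]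
        split_ifs
        · exact this.symm
        · rfl
      · refine tendsto_const_nhds.congr' ?_
        have hpos : (0 : ℝ) < ‖ζ‖ := norm_pos_iff.2 hζ
        filter_upwards [Ioo_mem_nhdsGT hpos] with ε hε
        rw [Set.indicator_of_mem (show ζ ∈ {ζ : Space d | ε ≤ ‖ζ‖} from hε.2.le)]
  refine h1.congr' ?_
  filter_upwards [self_mem_nhdsWithin] with ε hε
  exact (h.setIntegral_eq hα x hε).symm

theorem TestBounds.enorm_fracLap_le (h : TestBounds α g B R) (hd : 0 < d) (hα : 0 < α)
    (hα2 : α < 2) (x : Space d) :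
    ‖fracLap α g x‖ₑ ≤
      ∫⁻ ζ, ENNReal.ofReal (4 * B * levyWeight α ζ) * (reach d R).indicator 1 (x, ζ) := by
  rw [h.fracLap_eq hd hα hα2, enorm_mul]
  have h2 : ‖(1 / 2 : ℝ)‖ₑ ≤ 1 := by
    rw [Real.enorm_eq_ofReal (by norm_num), ← ENNReal.ofReal_one]
    exact ENNReal.ofReal_le_ofReal (by norm_num)
  calc _ ≤ 1 * ∫⁻ ζ, ‖fracDensity α g x ζ‖ₑ := by
        gcongr
        exact enorm_integral_le_lintegral_enorm _
    _ ≤ _ := by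
        rw [one_mul]
        exact lintegral_mono fun ζ => h.enorm_fracDensity_le x ζ

theorem lintegral_const_mul_levyWeight_lt_top (hd : 0 < d) (hα : 0 < α) (hα2 : α < 2) {c : ℝ}
    (hc : 0 ≤ c) : ∫⁻ ζ : Space d, ENNReal.ofReal (c * levyWeight α ζ) < ⊤ := by
  simp only [ENNReal.ofReal_mul hc]
  rw [lintegral_const_mul _ measurable_levyWeight.ennreal_ofReal]
  exact ENNReal.mul_lt_top ENNReal.ofReal_lt_top (lintegral_levyWeight_lt_top hd hα hα2)

theorem measurable_const_mul_levyWeight (c : ℝ) :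
    Measurable fun ζ : Space d => ENNReal.ofReal (c * levyWeight α ζ) :=
  (measurable_levyWeight.const_mul c).ennreal_ofReal

theorem TestBounds.lintegral_sq_fracLap_lt_top (h : TestBounds α g B R) (hd : 0 < d) (hα : 0 < α)
    (hα2 : α < 2) {X : Type*} [MeasurableSpace X] {μ : Measure X} [SFinite μ] {ι : X → Space d}
    (hι : Measurable ι) {m : ENNReal} (hm : m < ⊤) (hμ : ∀ ζ, μ {x | (ι x, ζ) ∈ reach d R} ≤ m) :
    ∫⁻ x, ‖fracLap α g (ι x)‖ₑ ^ 2 ∂μ < ⊤ := by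
  refine lt_of_le_of_lt (lintegral_mono fun x => pow_le_pow_left' (h.enorm_fracLap_le hd hα hα2 _) 2)
    (lt_of_le_of_lt (lintegral_sq_lintegral_reach_le hι (measurable_const_mul_levyWeight _) hμ) ?_)
  have hB := h.pos
  exact ENNReal.mul_lt_top hm (ENNReal.pow_lt_top
    (lintegral_const_mul_levyWeight_lt_top hd hα hα2 (by positivity)))

theorem TestBounds.stronglyMeasurable_fracLap (h : TestBounds α g B R) (hd : 0 < d) (hα : 0 < α)
    (hα2 : α < 2) : StronglyMeasurable (fracLap α g) := by
  have e : fracLap α g = fun x => 1 / 2 * ∫ ζ, fracDensity α g x ζ :=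
    funext (h.fracLap_eq hd hα hα2)
  rw [e]
  exact (StronglyMeasurable.integral_prod_right (f := fracDensity α g)
    h.measurable_fracDensity.stronglyMeasurable).const_mul _

theorem volume_closedBall_three_lt_top (ρ : ℝ) :
    3 * volume (Metric.closedBall (0 : Space d) ρ) < ⊤ :=
  ENNReal.mul_lt_top (by norm_num) measure_closedBall_lt_top

theorem TestBounds.memLp_fracLap (h : TestBounds α g B R) (hd : 0 < d) (hα : 0 < α)
    (hα2 : α < 2) : MemLp (fracLap α g) 2 volume := by
  have hm := (h.stronglyMeasurable_fracLap hd hα hα2).aestronglyMeasurable (μ := volume)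
  rw [memLp_two_iff_integrable_sq hm]
  refine ⟨hm.pow 2, ?_⟩
  have := h.lintegral_sq_fracLap_lt_top hd hα hα2 measurable_id
    (volume_closedBall_three_lt_top (d := d) R) (volume_reach_le R)
  simpa only [HasFiniteIntegral, enorm_pow, id] using this

theorem measurable_latticePoint (k : ℕ) : Measurable (latticePoint (d := d) k) :=
  measurable_of_countable _

theorem TestBounds.summable_sq_fracLap (h : TestBounds α g B R) (hd : 0 < d) (hα : 0 < α)
    (hα2 : α < 2) {k : ℕ} (hk : 0 < k) :
    Summable fun z => fracLap α g (latticePoint k z) ^ 2 := by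
  have h1 := h.lintegral_sq_fracLap_lt_top hd hα hα2 (measurable_latticePoint (d := d) k)
    (ENNReal.mul_lt_top ENNReal.ofReal_lt_top (volume_closedBall_three_lt_top (d := d) (R + d)))
    (count_reach_le hk R)
  have h2 : Integrable (fun z => fracLap α g (latticePoint k z) ^ 2) Measure.count := by
    refine ⟨(measurable_of_countable _).aestronglyMeasurable, ?_⟩
    simpa only [HasFiniteIntegral, enorm_pow] using h1
  exact (integrable_count_iff.1 h2).of_norm

theorem TestBounds.memLp (h : TestBounds α g B R) : MemLp g 2 volume :=
  h.continuous.memLp_of_hasCompactSupport (HasCompactSupport.intro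
    (isCompact_closedBall (0 : Space d) R) fun x hx =>
      h.support x (not_le.1 fun hle => hx (mem_closedBall_zero_iff.2 hle)))

end FractionalLaplacian

/-! ### The weak formulation and the limit resolvent. -/

section WeakForm

variable {d : ℕ} {α B lam : ℝ} {R : ℕ} {g : Space d → ℝ}

theorem measurePreserving_shear :
    MeasurePreserving (MeasurableEquiv.shearAddRight (Space d))
      (volume : Measure (Space d × Space d)) volume :=
  measurePreserving_prod_add volume volume

theorem TestBounds.sq_sub_le (h : TestBounds α g B R) (x z : Space d) :
    ‖(g x - g (x + z)) ^ 2 / ‖z‖ ^ ((d : ℝ) + α)‖ₑ ≤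
      ENNReal.ofReal (4 * B ^ 2 * levyWeight α z) * (reach d R).indicator 1 (x, z) := by
  have hB := h.pos
  by_cases hx : (x, z) ∈ reach d R
  · rw [Set.indicator_of_mem hx, Pi.one_apply, mul_one, Real.enorm_eq_ofReal (by positivity)]
    refine ENNReal.ofReal_le_ofReal ?_
    rw [levyWeight, ← mul_assoc, Real.rpow_neg (norm_nonneg _), div_eq_mul_inv]
    refine mul_le_mul_of_nonneg_right ?_ (by positivity)
    have h1 : (g x - g (x + z)) ^ 2 ≤ (B * ‖z‖) ^ 2 := by
      have h2 := h.lip x (x + z)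
      rw [show x - (x + z) = -z by abel, norm_neg] at h2
      rw [← sq_abs]
      exact pow_le_pow_left₀ (abs_nonneg _) h2 2
    have h2 : (g x - g (x + z)) ^ 2 ≤ (2 * B) ^ 2 := by
      rw [← sq_abs]
      refine pow_le_pow_left₀ (abs_nonneg _) ?_ 2
      have e1 := abs_le.1 (h.bound x)
      have e2 := abs_le.1 (h.bound (x + z))
      rw [abs_le]
      constructor <;> linarith
    rcases le_total (‖z‖ ^ 2) 1 with h3 | h3
    · rw [min_eq_left h3]
      nlinarith [sq_nonneg (B * ‖z‖)]
    · rw [min_eq_right h3]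
      nlinarith
  · have h1 : ¬ (‖x‖ ≤ R ∨ ‖x + z‖ ≤ R ∨ ‖x - z‖ ≤ R) := hx
    push Not at h1
    rw [h.support _ h1.1, h.support _ h1.2.1]
    simp

theorem TestBounds.inFracDomain (h : TestBounds α g B R) (hd : 0 < d) (hα : 0 < α)
    (hα2 : α < 2) : InFracDomain α g := by
  refine ⟨h.memLp, ?_⟩
  rw [← measurePreserving_shear.integrable_comp_emb (MeasurableEquiv.measurableEmbedding _)]
  have hgc := h.continuous
  have e : ((fun p : Space d × Space d => (g p.1 - g p.2) ^ 2 / ‖p.1 - p.2‖ ^ ((d : ℝ) + α)) ∘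
      MeasurableEquiv.shearAddRight (Space d)) =
      fun p => (g p.1 - g (p.1 + p.2)) ^ 2 / ‖p.2‖ ^ ((d : ℝ) + α) := by
    funext p
    change (g p.1 - g (p.1 + p.2)) ^ 2 / ‖p.1 - (p.1 + p.2)‖ ^ ((d : ℝ) + α) = _
    rw [show p.1 - (p.1 + p.2) = -p.2 by abel, norm_neg]
  rw [e]
  have hmeas : Measurable fun p : Space d × Space d =>
      (g p.1 - g (p.1 + p.2)) ^ 2 / ‖p.2‖ ^ ((d : ℝ) + α) := by
    have h1 : Measurable fun p : Space d × Space d => (g p.1 - g (p.1 + p.2)) ^ 2 :=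
      Continuous.measurable (by fun_prop)
    exact h1.div (by fun_prop)
  refine ⟨hmeas.aestronglyMeasurable, ?_⟩
  have hB := h.pos
  rw [HasFiniteIntegral, Measure.volume_eq_prod, lintegral_prod _ hmeas.enorm.aemeasurable]
  refine lt_of_le_of_lt (lintegral_mono fun x => lintegral_mono fun z => h.sq_sub_le x z)
    (lt_of_le_of_lt (lintegral_lintegral_reach_le measurable_id
      (measurable_const_mul_levyWeight _) (volume_reach_le R)) ?_)
  exact ENNReal.mul_lt_top (volume_closedBall_three_lt_top _)
    (lintegral_const_mul_levyWeight_lt_top hd hα hα2 (by positivity))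

theorem InFracDomain.integrable_mul {u v : Space d → ℝ} (hu : InFracDomain α u)
    (hv : InFracDomain α v) :
    Integrable (fun p : Space d × Space d =>
      (u p.1 - u p.2) * (v p.1 - v p.2) / ‖p.1 - p.2‖ ^ ((d : ℝ) + α)) volume := by
  have hm : ∀ {u : Space d → ℝ}, InFracDomain α u → AEStronglyMeasurable
      (fun p : Space d × Space d => u p.1 - u p.2) volume := fun hu =>
    (hu.1.1.comp_fst (ν := volume)).sub (hu.1.1.comp_snd (μ := volume))
  have hden : Measurable fun p : Space d × Space d => (‖p.1 - p.2‖ ^ ((d : ℝ) + α))⁻¹ := by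
    fun_prop
  have hmeas : AEStronglyMeasurable (fun p : Space d × Space d =>
      (u p.1 - u p.2) * (v p.1 - v p.2) / ‖p.1 - p.2‖ ^ ((d : ℝ) + α)) volume := by
    simp only [div_eq_mul_inv]
    exact ((hm hu).mul (hm hv)).mul hden.aestronglyMeasurable
  refine Integrable.mono' (hu.2.add hv.2) hmeas (Eventually.of_forall fun p => ?_)
  have hpos : 0 ≤ ‖p.1 - p.2‖ ^ ((d : ℝ) + α) := by positivity
  rw [Pi.add_apply, Real.norm_eq_abs, abs_div, abs_of_nonneg hpos, ← add_div]
  refine div_le_div_of_nonneg_right ?_ hpos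
  rw [abs_le]
  constructor <;> nlinarith [sq_nonneg (u p.1 - u p.2 + (v p.1 - v p.2)),
    sq_nonneg (u p.1 - u p.2 - (v p.1 - v p.2))]

theorem InFracDomain.sub {u v : Space d → ℝ} (hu : InFracDomain α u) (hv : InFracDomain α v) :
    InFracDomain α fun x => u x - v x := by
  refine ⟨hu.1.sub hv.1, ?_⟩
  have h := (hu.2.add hv.2).sub ((hu.integrable_mul hv).const_mul 2)
  refine h.congr (Eventually.of_forall fun p => ?_)
  simp only [Pi.add_apply, Pi.sub_apply]
  ring

/-- This is the justification of Fubini's theorem for a test function v that is merely in L². -/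
theorem TestBounds.integrable_mul_fracDensity (h : TestBounds α g B R) (hd : 0 < d) (hα : 0 < α)
    (hα2 : α < 2) {v : Space d → ℝ} (hv : MemLp v 2 volume) :
    Integrable (fun p : Space d × Space d => v p.1 * fracDensity α g p.1 p.2)
      ((volume : Measure (Space d)).prod volume) := by
  have hB := h.pos
  have hm : AEStronglyMeasurable (fun p : Space d × Space d => v p.1 * fracDensity α g p.1 p.2)
      ((volume : Measure (Space d)).prod volume) :=
    (hv.1.comp_fst (ν := volume)).mul h.measurable_fracDensity.aestronglyMeasurable
  refine ⟨hm, ?_⟩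
  set T : Space d → ENNReal := fun x =>
    ∫⁻ ζ, ENNReal.ofReal (4 * B * levyWeight α ζ) * (reach d R).indicator 1 (x, ζ) with hT
  have hT2 : ∫⁻ x, T x ^ 2 < ⊤ :=
    lt_of_le_of_lt (lintegral_sq_lintegral_reach_le measurable_id
      (measurable_const_mul_levyWeight _) (volume_reach_le R))
      (ENNReal.mul_lt_top (volume_closedBall_three_lt_top _) (ENNReal.pow_lt_top
        (lintegral_const_mul_levyWeight_lt_top hd hα hα2 (by positivity))))
  have hv2 : ∫⁻ x, ‖v x‖ₑ ^ 2 < ⊤ := by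
    have := ((memLp_two_iff_integrable_sq hv.1).1 hv).2
    simpa only [HasFiniteIntegral, enorm_pow] using this
  rw [HasFiniteIntegral, lintegral_prod _ hm.enorm]
  have hbound : ∀ x, ∫⁻ ζ, ‖v x * fracDensity α g x ζ‖ₑ ≤ ‖v x‖ₑ ^ 2 + T x ^ 2 := by
    intro x
    have h1 : ∫⁻ ζ, ‖v x * fracDensity α g x ζ‖ₑ ≤ ‖v x‖ₑ * T x := by
      simp only [enorm_mul]
      rw [lintegral_const_mul' _ _ enorm_ne_top]
      gcongr
      exact lintegral_mono fun ζ => h.enorm_fracDensity_le _ _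
    refine h1.trans ?_
    rcases le_total ‖v x‖ₑ (T x) with h2 | h2
    · exact le_add_left (by rw [pow_two]; gcongr)
    · exact le_add_right (by rw [pow_two]; gcongr)
  refine lt_of_le_of_lt (lintegral_mono hbound) ?_
  rw [lintegral_add_left' (hv.1.enorm.pow_const 2)]
  exact ENNReal.add_lt_top.2 ⟨hv2, hT2⟩

theorem TestBounds.integral_shift (h : TestBounds α g B R) {v : Space d → ℝ}
    (hv : MemLp v 2 volume) (z : Space d) :
    ∫ x, (g x - g (x + z)) * (v x - v (x + z)) = -∫ x, v x * secondDiff g x z := by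
  have hsh : ∀ {u : Space d → ℝ}, MemLp u 2 volume → ∀ y : Space d,
      MemLp (fun x => u (x + y)) 2 volume := fun hu y =>
    hu.comp_measurePreserving (measurePreserving_add_right volume y)
  have hg := h.memLp
  have i1 : Integrable fun x => (g x - g (x + z)) * v x := (hg.sub (hsh hg z)).integrable_mul hv
  have i2 : Integrable fun x => (g x - g (x + z)) * v (x + z) :=
    (hg.sub (hsh hg z)).integrable_mul (hsh hv z)
  have i3 : Integrable fun x => (g (x - z) - g x) * v x := by
    refine (((hsh hg (-z)).sub hg).integrable_mul hv).congr (Eventually.of_forall fun x => ?_)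
    simp only [Pi.mul_apply, Pi.sub_apply, ← sub_eq_add_neg]
  have e1 : ∫ x, (g x - g (x + z)) * v (x + z) = ∫ x, (g (x - z) - g x) * v x := by
    rw [← integral_add_right_eq_self (fun x => (g (x - z) - g x) * v x) z]
    simp only [add_sub_cancel_right]
  calc ∫ x, (g x - g (x + z)) * (v x - v (x + z))
      = ∫ x, ((g x - g (x + z)) * v x - (g x - g (x + z)) * v (x + z)) := by
        congr 1; funext x; ring
    _ = (∫ x, (g x - g (x + z)) * v x) - ∫ x, (g (x - z) - g x) * v x := by
        rw [integral_sub i1 i2, e1]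
    _ = ∫ x, ((g x - g (x + z)) * v x - (g (x - z) - g x) * v x) := (integral_sub i1 i3).symm
    _ = _ := by
        rw [← integral_neg]
        congr 1; funext x
        rw [secondDiff]
        ring

/-- In the coordinates (x, z) with y = x + z, translation invariance for each fixed z moves both
differences onto g as a second difference; Fubini then reassembles L̄g. -/
theorem TestBounds.fracForm_eq (h : TestBounds α g B R) (hd : 0 < d) (hα : 0 < α)
    (hα2 : α < 2) {v : Space d → ℝ} (hv : InFracDomain α v) :
    fracForm α g v = -∫ x, fracLap α g x * v x := by
  set N : Space d × Space d → ℝ := fun p =>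
    (g p.1 - g p.2) * (v p.1 - v p.2) / ‖p.1 - p.2‖ ^ ((d : ℝ) + α) with hN
  have hNi : Integrable N volume := (h.inFracDomain hd hα hα2).integrable_mul hv
  have hN' : Integrable (fun p : Space d × Space d =>
      (g p.1 - g (p.1 + p.2)) * (v p.1 - v (p.1 + p.2)) * ‖p.2‖ ^ (-((d : ℝ) + α)))
      ((volume : Measure (Space d)).prod volume) ∧
      ∫ p, N p = ∫ p : Space d × Space d,
        (g p.1 - g (p.1 + p.2)) * (v p.1 - v (p.1 + p.2)) * ‖p.2‖ ^ (-((d : ℝ) + α))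
        ∂((volume : Measure (Space d)).prod volume) := by
    have e : ∀ p, N (MeasurableEquiv.shearAddRight (Space d) p) =
        (g p.1 - g (p.1 + p.2)) * (v p.1 - v (p.1 + p.2)) * ‖p.2‖ ^ (-((d : ℝ) + α)) := by
      intro p
      change (g p.1 - g (p.1 + p.2)) * (v p.1 - v (p.1 + p.2)) /
        ‖p.1 - (p.1 + p.2)‖ ^ ((d : ℝ) + α) = _
      rw [show p.1 - (p.1 + p.2) = -p.2 by abel, norm_neg, Real.rpow_neg (norm_nonneg _),
        div_eq_mul_inv]
    constructor
    · have h1 := (measurePreserving_shear.integrable_comp_emb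
        (MeasurableEquiv.measurableEmbedding _)).2 hNi
      exact h1.congr (Eventually.of_forall e)
    · rw [← measurePreserving_shear.integral_comp' N]
      simp only [e]
      rfl
  have h1 : ∫ p, N p = -∫ z, ∫ x, v x * fracDensity α g x z := by
    rw [hN'.2, integral_prod_symm _ hN'.1, ← integral_neg]
    congr 1
    funext z
    simp only [fracDensity, ← mul_assoc]
    rw [integral_mul_const, integral_mul_const, h.integral_shift hv.1 z]
    ring
  rw [fracForm, h1, ← integral_integral_swap (h.integrable_mul_fracDensity hd hα hα2 hv.1)]
  simp only [integral_const_mul]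
  rw [mul_neg, ← integral_const_mul]
  congr 2
  funext x
  rw [h.fracLap_eq hd hα hα2]
  ring

/-- The limit resolvent is thus known explicitly, and only a comparison with the smooth function g
remains. -/
theorem TestBounds.isFracResolvent (h : TestBounds α g B R) (hd : 0 < d) (hα : 0 < α)
    (hα2 : α < 2) : IsFracResolvent α lam (fun x => lam * g x - fracLap α g x) g := by
  refine ⟨h.inFracDomain hd hα hα2, fun v hv => ?_⟩
  rw [h.fracForm_eq hd hα hα2 hv, ← sub_eq_add_neg]
  have i1 : Integrable fun x => g x * v x := h.memLp.integrable_mul hv.1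
  have i2 : Integrable fun x => fracLap α g x * v x :=
    (h.memLp_fracLap hd hα hα2).integrable_mul hv.1
  rw [← integral_const_mul, ← integral_sub (i1.const_mul lam) i2]
  congr 1
  funext x
  ring

theorem IsFracResolvent.ae_eq (hlam : 0 < lam) {f u v : Space d → ℝ}
    (hu : IsFracResolvent α lam f u) (hv : IsFracResolvent α lam f v) : u =ᵐ[volume] v := by
  have hw := hu.1.sub hv.1
  set w : Space d → ℝ := fun x => u x - v x with hwdef
  have h1 := hu.2 w hw
  have h2 := hv.2 w hw
  have i1 : Integrable fun x => u x * w x := hu.1.1.integrable_mul hw.1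
  have i2 : Integrable fun x => v x * w x := hv.1.1.integrable_mul hw.1
  have e1 : (∫ x, u x * w x) - ∫ x, v x * w x = ∫ x, w x ^ 2 := by
    rw [← integral_sub i1 i2]
    congr 1; funext x
    simp only [hwdef]
    ring
  have e2 : fracForm α u w - fracForm α v w = fracForm α w w := by
    rw [fracForm, fracForm, fracForm, ← mul_sub,
      ← integral_sub (hu.1.integrable_mul hw) (hv.1.integrable_mul hw)]
    congr 2; funext p
    simp only [hwdef]
    ring
  have h3 : 0 ≤ fracForm α w w := by
    rw [fracForm]
    refine mul_nonneg (by norm_num) (integral_nonneg fun p => ?_)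
    exact div_nonneg (mul_self_nonneg _) (by positivity)
  have h4 : ∫ x, w x ^ 2 = 0 := by
    have : 0 ≤ ∫ x, w x ^ 2 := integral_nonneg fun x => sq_nonneg _
    nlinarith
  rw [integral_eq_zero_iff_of_nonneg (fun x => sq_nonneg _)
    ((memLp_two_iff_integrable_sq hw.1.1).1 hw.1)] at h4
  filter_upwards [h4] with x hx
  have hx' : w x ^ 2 = 0 := hx
  exact sub_eq_zero.1 (pow_eq_zero_iff two_ne_zero |>.1 hx')

end WeakForm


/-! ### Discretisation error of the deterministic operator. -/

section Discretization

variable {d : ℕ} {α B : ℝ} {R : ℕ} {g : Space d → ℝ}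

theorem integrable_comp_cellIndex {k : ℕ} (hk : 0 < k) {θ : Vertex d → ℝ} (hθ : Summable θ) :
    Integrable fun x => θ (cellIndex k x) := by
  refine ⟨((measurable_of_countable θ).comp (measurable_cellIndex k)).aestronglyMeasurable, ?_⟩
  have h := (integrable_count_iff.2 hθ.norm).2
  rw [HasFiniteIntegral, lintegral_count] at h
  rw [HasFiniteIntegral, lintegral_comp_cellIndex hk fun z => ‖θ z‖ₑ]
  exact ENNReal.mul_lt_top ENNReal.ofReal_lt_top h

theorem integral_comp_cellIndex {k : ℕ} (hk : 0 < k) {θ : Vertex d → ℝ} (hθ : Summable θ) :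
    ∫ x, θ (cellIndex k x) = ((k : ℝ) ^ d)⁻¹ * ∑' z, θ z := by
  have hm := (measurable_of_countable θ).aestronglyMeasurable
    (μ := Measure.map (cellIndex k) (volume : Measure (Space d)))
  have hi : Integrable θ (Measure.map (cellIndex k) volume) :=
    (integrable_map_measure hm (measurable_cellIndex k).aemeasurable).2
      (integrable_comp_cellIndex hk hθ)
  rw [← integral_map (measurable_cellIndex k).aemeasurable hm, integral_countable hi,
    ← tsum_mul_left]
  refine tsum_congr fun z => ?_
  rw [Measure.real, Measure.map_apply (measurable_cellIndex k) (measurableSet_singleton z),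
    volume_cellIndex_preimage hk, ENNReal.toReal_ofReal (by positivity), smul_eq_mul]

/-- The kernel of the jumps of length at least `r`. -/
noncomputable def farKernel (α : ℝ) (r : ℕ) (z : Vertex d) : ℝ :=
  if (r : ℝ) ≤ ‖z‖ then jumpKernel α z else 0

theorem farKernel_nonneg (r : ℕ) (z : Vertex d) : 0 ≤ farKernel α r z := by
  rw [farKernel]
  split_ifs
  · exact jumpKernel_nonneg α z
  · exact le_rfl

theorem farKernel_le (r : ℕ) (z : Vertex d) : farKernel α r z ≤ jumpKernel α z := by
  rw [farKernel]
  split_ifs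
  · exact le_rfl
  · exact jumpKernel_nonneg α z

theorem farKernel_neg (r : ℕ) (z : Vertex d) : farKernel α r (-z) = farKernel α r z := by
  simp only [farKernel, norm_neg, jumpKernel, eucl_neg]

theorem summable_farKernel (hα : 0 < α) (r : ℕ) : Summable (farKernel (d := d) α r) :=
  Summable.of_nonneg_of_le (farKernel_nonneg r) (farKernel_le r) (summable_jumpKernel hα)

/-- The difference between the truncated discrete operator and the limit operator. -/
noncomputable def discError (α : ℝ) (g : Space d → ℝ) (k r : ℕ) (x : Vertex d) : ℝ :=
  (k : ℝ) ^ α * (∑' y, (g (latticePoint k y) - g (latticePoint k x)) * farKernel α r (x - y)) -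
    fracLap α g (latticePoint k x)

theorem TestBounds.tsum_farKernel_eq (h : TestBounds α g B R) (hα : 0 < α) (k r : ℕ)
    (x : Vertex d) :
    (Summable fun z => secondDiff g (latticePoint k x) (latticePoint k z) * farKernel α r z) ∧
    ∑' y, (g (latticePoint k y) - g (latticePoint k x)) * farKernel α r (x - y) =
      1 / 2 * ∑' z, secondDiff g (latticePoint k x) (latticePoint k z) * farKernel α r z := by
  set X := latticePoint k x with hX
  set H : Vertex d → ℝ := fun z => (g (X - latticePoint k z) - g X) * farKernel α r z with hH
  have hHs : Summable H := by
    refine Summable.of_norm_bounded ((summable_farKernel hα r).mul_left (2 * B)) fun z => ?_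
    rw [Real.norm_eq_abs, hH, abs_mul, abs_of_nonneg (farKernel_nonneg r z)]
    refine mul_le_mul_of_nonneg_right ?_ (farKernel_nonneg r z)
    have h1 := abs_le.1 (h.bound (X - latticePoint k z))
    have h2 := abs_le.1 (h.bound X)
    rw [abs_le]
    constructor <;> linarith
  have hHn : Summable fun z => H (-z) := by
    have := (Equiv.neg (Vertex d)).summable_iff.2 hHs
    exact this
  have hHnt : ∑' z, H (-z) = ∑' z, H z := (Equiv.neg (Vertex d)).tsum_eq H
  have e1 : ∀ z, H z + H (-z) = secondDiff g X (latticePoint k z) * farKernel α r z := by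
    intro z
    have e : latticePoint k (-z) = -latticePoint k z := by
      ext i; simp [latticePoint, neg_div]
    simp only [hH, farKernel_neg, e, sub_neg_eq_add, secondDiff]
    ring
  have e2 : ∑' y, (g (latticePoint k y) - g X) * farKernel α r (x - y) = ∑' z, H z := by
    rw [← (Equiv.subLeft x).tsum_eq H]
    refine tsum_congr fun y => ?_
    simp only [hH, Equiv.subLeft_apply]
    rw [← latticePoint_sub, hX, sub_sub_cancel]
  refine ⟨(hHs.add hHn).congr e1, ?_⟩
  rw [e2, ← tsum_congr e1, hHs.tsum_add hHn, hHnt]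
  ring

/-- The integrand of `discError`. -/
noncomputable def errDensity (α : ℝ) (g : Space d → ℝ) (k r : ℕ) (X ζ : Space d) : ℝ :=
  (if (r : ℝ) ≤ ‖cellIndex k ζ‖ then fracDensity α g X (latticePoint k (cellIndex k ζ)) else 0) -
    fracDensity α g X ζ

/-- The truncated lattice sum is the integral of a function that is constant on cells, so the error
becomes a single integral which can be bounded pointwise. -/
theorem TestBounds.discError_eq (h : TestBounds α g B R) (hd : 0 < d) (hα : 0 < α)
    (hα2 : α < 2) {k : ℕ} (hk : 0 < k) (r : ℕ) (x : Vertex d) :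
    discError α g k r x = 1 / 2 * ∫ ζ, errDensity α g k r (latticePoint k x) ζ := by
  have hk' : (0 : ℝ) < k := by exact_mod_cast hk
  obtain ⟨hs, ht⟩ := h.tsum_farKernel_eq hα k r x
  set X := latticePoint k x with hX
  set θ : Vertex d → ℝ := fun z =>
    if (r : ℝ) ≤ ‖z‖ then fracDensity α g X (latticePoint k z) else 0 with hθ
  have e1 : ∀ z, θ z = (k : ℝ) ^ ((d : ℝ) + α) *
      (secondDiff g X (latticePoint k z) * farKernel α r z) := by
    intro z
    simp only [hθ, farKernel]
    split_ifs
    · rw [fracDensity, norm_latticePoint, Real.rpow_neg (by positivity [eucl_nonneg z]),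
        Real.div_rpow (eucl_nonneg _) hk'.le, jumpKernel, inv_div]
      ring
    · ring
  have hθs : Summable θ := (hs.mul_left _).congr fun z => (e1 z).symm
  have h1 := integral_comp_cellIndex hk hθs
  have h2 : ∑' z, θ z = (k : ℝ) ^ ((d : ℝ) + α) *
      ∑' z, secondDiff g X (latticePoint k z) * farKernel α r z := by
    rw [← tsum_mul_left]
    exact tsum_congr e1
  have h3 : ∫ ζ, errDensity α g k r X ζ =
      (∫ ζ, θ (cellIndex k ζ)) - ∫ ζ, fracDensity α g X ζ :=
    integral_sub (integrable_comp_cellIndex hk hθs) (h.integrable_fracDensity hd hα hα2 X)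
  rw [discError, ht, h.fracLap_eq hd hα hα2, h3, h1, h2, Real.rpow_add hk', Real.rpow_natCast]
  have : (k : ℝ) ^ d ≠ 0 := by positivity
  field_simp
  rfl

theorem abs_rpow_neg_sub_le {β a b m : ℝ} (hβ : 0 ≤ β) (hm : 0 < m) (ha : m ≤ a) (hb : m ≤ b) :
    |a ^ (-β) - b ^ (-β)| ≤ β * m ^ (-β - 1) * |a - b| := by
  have := Convex.norm_image_sub_le_of_norm_hasDerivWithin_le (𝕜 := ℝ) (s := Set.Ici m)
    (f := fun x : ℝ => x ^ (-β)) (f' := fun x => -β * x ^ (-β - 1)) (C := β * m ^ (-β - 1))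
    (fun x hx => (Real.hasDerivAt_rpow_const
      (Or.inl (hm.trans_le hx).ne')).hasDerivWithinAt) (fun x hx => ?_) (convex_Ici m) hb ha
  · simpa [Real.norm_eq_abs] using this
  · have hx' : m ≤ x := hx
    rw [Real.norm_eq_abs, abs_mul, abs_neg, abs_of_nonneg hβ,
      abs_of_nonneg (Real.rpow_nonneg (hm.le.trans hx') _)]
    gcongr ?_ * ?_
    exact Real.rpow_le_rpow_of_nonpos hm hx' (by linarith)

/-- A product rule for second difference times kernel: a displacement δ costs either δ ‖ζ‖^(α/2) in
the first factor or a relative amount δ/‖ζ‖ in the second, where the first is O(‖ζ‖^(1+α/2)). -/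
theorem TestBounds.abs_fracDensity_sub_le (h : TestBounds α g B R) (hα : 0 < α)
    {X ζ ζ' : Space d} {δ : ℝ} (hζ : 0 < ‖ζ‖) (h1 : ‖ζ‖ ≤ 2 * ‖ζ'‖) (h2 : ‖ζ'‖ ≤ 2 * ‖ζ‖)
    (hδ : ‖ζ' - ζ‖ ≤ δ) :
    |fracDensity α g X ζ' - fracDensity α g X ζ| ≤
      (B * 2 ^ (α / 2) * 2 ^ ((d : ℝ) + α) * (1 + 2 * (d + α))) * δ *
        ‖ζ‖ ^ (-((d : ℝ) + α / 2)) := by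
  have hB := h.pos
  set n := ‖ζ‖ with hn
  set n' := ‖ζ'‖ with hn'
  set β : ℝ := d + α with hβ
  have hβ0 : 0 < β := by positivity
  have hδ0 : 0 ≤ δ := (norm_nonneg _).trans hδ
  have hm : 0 < n / 2 := by positivity
  have hn'0 : n / 2 ≤ n' := by linarith
  have s1 : |secondDiff g X ζ' - secondDiff g X ζ| ≤ B * (2 * n) ^ (α / 2) * δ := by
    refine (h.secondDiff_sub_le (2 * n) X ζ' ζ h2 (by linarith)).trans ?_
    gcongr
  have s2 : |secondDiff g X ζ| ≤ B * (2 * n) ^ (α / 2) * n := by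
    have := h.secondDiff_sub_le (2 * n) X ζ 0 (by linarith) (by rw [norm_zero]; positivity)
    have e : secondDiff g X 0 = 0 := by rw [secondDiff, add_zero, sub_zero]; ring
    rwa [e, sub_zero, sub_zero] at this
  have s3 : |n' ^ (-β) - n ^ (-β)| ≤ β * (n / 2) ^ (-β - 1) * δ := by
    refine (abs_rpow_neg_sub_le hβ0.le hm hn'0 (by linarith)).trans ?_
    gcongr
    exact (abs_norm_sub_norm_le ζ' ζ).trans hδ
  have s4 : |n' ^ (-β)| ≤ (n / 2) ^ (-β) := by
    rw [abs_of_nonneg (by positivity)]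
    exact Real.rpow_le_rpow_of_nonpos hm hn'0 (by linarith)
  have e1 : (2 * n) ^ (α / 2) = 2 ^ (α / 2) * n ^ (α / 2) := Real.mul_rpow two_pos.le hζ.le
  have e2 : (n / 2) ^ (-β) = 2 ^ β * n ^ (-β) := by
    rw [Real.div_rpow hζ.le two_pos.le, Real.rpow_neg two_pos.le, div_inv_eq_mul, mul_comm]
  have e3 : (n / 2) ^ (-β - 1) = 2 * 2 ^ β * (n ^ (-β) / n) := by
    rw [Real.rpow_sub_one hm.ne', e2]
    field_simp
  have e4 : n ^ (-((d : ℝ) + α / 2)) = n ^ (α / 2) * n ^ (-β) := by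
    rw [← Real.rpow_add hζ, hβ]
    congr 1; ring
  have e5 : fracDensity α g X ζ' - fracDensity α g X ζ =
      (secondDiff g X ζ' - secondDiff g X ζ) * n' ^ (-β) +
        secondDiff g X ζ * (n' ^ (-β) - n ^ (-β)) := by
    rw [fracDensity, fracDensity]
    ring
  calc |fracDensity α g X ζ' - fracDensity α g X ζ|
      ≤ |secondDiff g X ζ' - secondDiff g X ζ| * |n' ^ (-β)| +
        |secondDiff g X ζ| * |n' ^ (-β) - n ^ (-β)| := by
        rw [e5, ← abs_mul, ← abs_mul]
        exact abs_add_le _ _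
    _ ≤ (B * (2 * n) ^ (α / 2) * δ) * (n / 2) ^ (-β) +
        (B * (2 * n) ^ (α / 2) * n) * (β * (n / 2) ^ (-β - 1) * δ) := by
        gcongr
    _ = _ := by
        rw [e1, e2, e3, e4]
        field_simp

/-- A radial majorant of `errDensity`. -/
noncomputable def errWeight (α B K : ℝ) (k r : ℕ) (ζ : Space d) : ENNReal :=
  {ζ : Space d | ‖ζ‖ < 2 * d * (r / k)}.indicator
      (fun ζ => ENNReal.ofReal (B * ‖ζ‖ ^ (-((d : ℝ) + α - 2)))) ζ +
    {ζ : Space d | (r : ℝ) / k / 2 ≤ ‖ζ‖}.indicator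
      (fun ζ => ENNReal.ofReal (K / k * ‖ζ‖ ^ (-((d : ℝ) + α / 2)))) ζ

theorem measurable_errWeight (K : ℝ) (k r : ℕ) : Measurable (errWeight (d := d) α B K k r) := by
  refine Measurable.add (Measurable.indicator (by fun_prop) ?_)
    (Measurable.indicator (by fun_prop) ?_)
  · exact measurableSet_lt measurable_norm measurable_const
  · exact measurableSet_le measurable_const measurable_norm

theorem mem_reach_of_dist_le {X ζ ζ' : Space d} {ρ c : ℝ} (hc : 0 ≤ c) (h : ‖ζ - ζ'‖ ≤ c)
    (hm : (X, ζ') ∈ reach d ρ) : (X, ζ) ∈ reach d (ρ + c) := by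
  have hm' : ‖X‖ ≤ ρ ∨ ‖X + ζ'‖ ≤ ρ ∨ ‖X - ζ'‖ ≤ ρ := hm
  change ‖X‖ ≤ ρ + c ∨ ‖X + ζ‖ ≤ ρ + c ∨ ‖X - ζ‖ ≤ ρ + c
  rcases hm' with h1 | h1 | h1
  · left; linarith
  · right; left
    rw [show X + ζ = (X + ζ') + (ζ - ζ') by abel]
    exact (norm_add_le _ _).trans (add_le_add h1 h)
  · right; right
    rw [show X - ζ = (X - ζ') - (ζ - ζ') by abel]
    exact (norm_sub_le _ _).trans (add_le_add h1 h)

/-- Cells below the cutoff carry no lattice term, and the missing integrand is O(‖ζ‖^(2-d-α)). On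
the other cells r ≥ 2d makes the lattice point at least twice as long as the cell displacement, so
that ζ and the lattice point have comparable norms. -/
theorem TestBounds.enorm_errDensity_le (h : TestBounds α g B R) (hd : 0 < d) (hα : 0 < α)
    {k r : ℕ} (hk : 0 < k) (hr : 2 * d ≤ r) (X ζ : Space d) :
    ‖errDensity α g k r X ζ‖ₑ ≤
      errWeight α B (B * 2 ^ (α / 2) * 2 ^ ((d : ℝ) + α) * (1 + 2 * (d + α)) * d) k r ζ *
        (reach d ((R : ℝ) + d)).indicator 1 (X, ζ) := by
  have hB := h.pos
  have hk' : (0 : ℝ) < k := by exact_mod_cast hk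
  have hk1 : (1 : ℝ) ≤ k := by exact_mod_cast hk
  have hd' : (1 : ℝ) ≤ d := by exact_mod_cast hd
  have hr' : (2 : ℝ) * d ≤ r := by exact_mod_cast hr
  set c := cellIndex k ζ with hc
  set ζ' := latticePoint k c with hζ'
  have hdist : ‖ζ - ζ'‖ ≤ d / k := norm_sub_latticePoint_cellIndex_le hk ζ
  have hdist1 : ‖ζ - ζ'‖ ≤ d := hdist.trans (div_le_self (by positivity) hk1)
  have hn' : ‖ζ'‖ = eucl c / k := norm_latticePoint k c
  by_cases hmem : (X, ζ) ∈ reach d ((R : ℝ) + d)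
  swap
  · have h1 : (X, ζ) ∉ reach d R := fun hh => hmem (mem_reach_of_dist_le (ζ' := ζ)
      (by positivity) (by rw [sub_self, norm_zero]; positivity) hh)
    have h2 : (X, ζ') ∉ reach d R := fun hh =>
      hmem (mem_reach_of_dist_le (by positivity) hdist1 hh)
    have h3 : errDensity α g k r X ζ = 0 := by
      rw [errDensity, ← hc, ← hζ', fracDensity, fracDensity, h.secondDiff_eq_zero h1,
        h.secondDiff_eq_zero h2]
      simp
    rw [h3, enorm_zero]
    exact zero_le
  rw [Set.indicator_of_mem hmem, Pi.one_apply, mul_one, Real.enorm_eq_ofReal_abs, errDensity, ← hc,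
    ← hζ', errWeight]
  have htri : ‖ζ‖ ≤ ‖ζ'‖ + d / k := by
    have := norm_add_le (ζ - ζ') ζ'
    rw [sub_add_cancel] at this
    linarith
  have htri' : ‖ζ'‖ ≤ ‖ζ‖ + d / k := by
    have := norm_sub_le ζ (ζ - ζ')
    rw [sub_sub_cancel] at this
    linarith
  split_ifs with hcr
  · have h1 : (r : ℝ) / k ≤ ‖ζ'‖ := by
      rw [hn']
      gcongr
      exact hcr.trans (norm_le_eucl c)
    have h2 : 2 * ((d : ℝ) / k) ≤ ‖ζ'‖ := by
      refine le_trans ?_ h1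
      rw [← mul_div_assoc]
      gcongr
    have hdk : 0 < (d : ℝ) / k := by positivity
    have hle := h.abs_fracDensity_sub_le hα (X := X) (ζ := ζ) (ζ' := ζ') (δ := d / k)
      (by linarith) (by linarith) (by linarith) (by rw [norm_sub_rev]; exact hdist)
    rw [Set.indicator_of_mem (s := {ζ : Space d | (r : ℝ) / k / 2 ≤ ‖ζ‖})
      (show (r : ℝ) / k / 2 ≤ ‖ζ‖ by linarith)]
    refine le_add_left (ENNReal.ofReal_le_ofReal (hle.trans (le_of_eq ?_)))
    ring
  · rw [zero_sub, abs_neg]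
    rw [not_le] at hcr
    have h1 : ‖ζ‖ < 2 * d * (r / k) := by
      refine htri.trans_lt ?_
      rw [hn', ← add_div, ← mul_div_assoc]
      gcongr
      have := eucl_le c
      nlinarith
    rw [Set.indicator_of_mem (s := {ζ : Space d | ‖ζ‖ < 2 * d * (r / k)}) h1]
    refine le_add_right (ENNReal.ofReal_le_ofReal ?_)
    rw [fracDensity, abs_mul, abs_of_nonneg (Real.rpow_nonneg (norm_nonneg ζ) _)]
    rcases eq_or_ne ζ 0 with h0 | h0
    · have e : secondDiff g X ζ = 0 := by rw [h0, secondDiff, add_zero, sub_zero]; ring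
      rw [e, abs_zero, zero_mul]
      positivity
    · have hpos : 0 < ‖ζ‖ := norm_pos_iff.2 h0
      have e : ‖ζ‖ ^ (-((d : ℝ) + α - 2)) = ‖ζ‖ ^ 2 * ‖ζ‖ ^ (-((d : ℝ) + α)) := by
        rw [← Real.rpow_natCast, ← Real.rpow_add hpos]
        congr 1
        push_cast
        ring
      rw [e, ← mul_assoc]
      exact mul_le_mul_of_nonneg_right (h.secondDiff_le X ζ) (by positivity)

/-- With q = r/k ≤ 1, the inner part gives q^(2-α) ≤ q^(1-α/2). The outer part gives k⁻¹ q^(-α/2),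
and k⁻¹ ≤ q. -/
theorem exists_lintegral_errWeight_le (hd : 0 < d) (hα : 0 < α) (hα2 : α < 2) (hB : 0 < B) {K : ℝ}
    (hK : 0 < K) :
    ∃ A : ℝ, 0 < A ∧ ∀ k r : ℕ, 0 < r → r ≤ k →
      ∫⁻ ζ : Space d, errWeight α B K k r ζ ≤ ENNReal.ofReal (A * ((r : ℝ) / k) ^ (1 - α / 2)) := by
  obtain ⟨C, hC0, hC⟩ := exists_lintegral_near_le hd (β := d + α - 2) (by linarith)
  obtain ⟨C', hC0', hC'⟩ := exists_lintegral_far_le (d := d) (β := d + α / 2) (by linarith)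
  have hd' : (1 : ℝ) ≤ d := by exact_mod_cast hd
  refine ⟨B * (C * (2 * d) ^ (2 - α)) + K * (C' * 2 ^ (α / 2)), by positivity,
    fun k r hr hrk => ?_⟩
  have hr' : (1 : ℝ) ≤ r := by exact_mod_cast hr
  have hk' : (0 : ℝ) < k := by exact_mod_cast hr.trans_le hrk
  set q : ℝ := (r : ℝ) / k with hq
  have hq0 : 0 < q := by positivity
  have hq1 : q ≤ 1 := by
    rw [hq, div_le_one hk']
    exact_mod_cast hrk
  have hm1 : MeasurableSet {ζ : Space d | ‖ζ‖ < 2 * d * q} :=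
    measurableSet_lt measurable_norm measurable_const
  have hm2 : MeasurableSet {ζ : Space d | q / 2 ≤ ‖ζ‖} :=
    measurableSet_le measurable_const measurable_norm
  unfold errWeight
  rw [lintegral_add_left (Measurable.indicator (by fun_prop) hm1), lintegral_indicator hm1,
    lintegral_indicator hm2]
  simp only [ENNReal.ofReal_mul hB.le, ENNReal.ofReal_mul (show 0 ≤ K / k by positivity)]
  rw [lintegral_const_mul _ (by fun_prop), lintegral_const_mul _ (by fun_prop)]
  have h1 := hC (2 * d * q) (by positivity)
  have h2 := hC' (q / 2) (by positivity)
  calc _ ≤ ENNReal.ofReal B * ENNReal.ofReal (C * (2 * d * q) ^ ((d : ℝ) - (d + α - 2))) +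
        ENNReal.ofReal (K / k) * ENNReal.ofReal (C' * (q / 2) ^ ((d : ℝ) - (d + α / 2))) := by
        gcongr
    _ = ENNReal.ofReal (B * (C * (2 * d * q) ^ (2 - α)) + K / k * (C' * (q / 2) ^ (-(α / 2)))) := by
        rw [ENNReal.ofReal_add (by positivity) (by positivity), ENNReal.ofReal_mul hB.le,
          ENNReal.ofReal_mul (show 0 ≤ K / k by positivity)]
        congr 4 <;> congr 1 <;> ring
    _ ≤ _ := by
        apply ENNReal.ofReal_le_ofReal
        have e1 : (2 * d * q) ^ (2 - α) ≤ (2 * d) ^ (2 - α) * q ^ (1 - α / 2) := by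
          rw [Real.mul_rpow (by positivity) hq0.le]
          refine mul_le_mul_of_nonneg_left ?_ (by positivity)
          exact Real.rpow_le_rpow_of_exponent_ge hq0 hq1 (by linarith)
        have e2 : (k : ℝ)⁻¹ * (q / 2) ^ (-(α / 2)) ≤ 2 ^ (α / 2) * q ^ (1 - α / 2) := by
          have e3 : (q / 2) ^ (-(α / 2)) = 2 ^ (α / 2) * q ^ (-(α / 2)) := by
            rw [Real.div_rpow hq0.le two_pos.le, Real.rpow_neg two_pos.le, div_inv_eq_mul, mul_comm]
          have e4 : q ^ (1 - α / 2) = q * q ^ (-(α / 2)) := by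
            rw [sub_eq_add_neg, Real.rpow_add hq0, Real.rpow_one]
          have e5 : (k : ℝ)⁻¹ ≤ q := by
            rw [hq, div_eq_mul_inv]
            exact le_mul_of_one_le_left (by positivity) hr'
          rw [e3, e4]
          calc (k : ℝ)⁻¹ * (2 ^ (α / 2) * q ^ (-(α / 2)))
              ≤ q * (2 ^ (α / 2) * q ^ (-(α / 2))) := by gcongr
            _ = _ := by ring
        calc B * (C * (2 * d * q) ^ (2 - α)) + K / k * (C' * (q / 2) ^ (-(α / 2)))
            = B * (C * (2 * d * q) ^ (2 - α)) + K * (C' * ((k : ℝ)⁻¹ * (q / 2) ^ (-(α / 2)))) := by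
              ring
          _ ≤ B * (C * ((2 * d) ^ (2 - α) * q ^ (1 - α / 2))) +
              K * (C' * (2 ^ (α / 2) * q ^ (1 - α / 2))) := by gcongr
          _ = _ := by ring

theorem TestBounds.exists_sum_sq_discError_le (h : TestBounds α g B R) (hd : 0 < d) (hα : 0 < α)
    (hα2 : α < 2) :
    ∃ A : ℝ, 0 < A ∧ ∀ k r : ℕ, 2 * d ≤ r → r ≤ k →
      (Summable fun x => discError α g k r x ^ 2) ∧
        ∑' x, discError α g k r x ^ 2 ≤
          A * ((k : ℝ) ^ ((d : ℝ) / 2) * ((r : ℝ) / k) ^ (1 - α / 2)) ^ 2 := by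
  have hB := h.pos
  have hd' : (1 : ℝ) ≤ d := by exact_mod_cast hd
  set K : ℝ := B * 2 ^ (α / 2) * 2 ^ ((d : ℝ) + α) * (1 + 2 * (d + α)) * d with hK
  have hK0 : 0 < K := by positivity
  obtain ⟨A, hA0, hA⟩ := exists_lintegral_errWeight_le (d := d) hd hα hα2 hB hK0
  set m : ENNReal := 3 * volume (Metric.closedBall (0 : Space d) ((R : ℝ) + d + d)) with hm
  have hmt : m < ⊤ := volume_closedBall_three_lt_top _
  refine ⟨m.toReal * A ^ 2 + 1, by positivity, fun k r hr hrk => ?_⟩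
  have hr0 : 0 < r := by omega
  have hk : 0 < k := by omega
  have hk' : (0 : ℝ) < k := by exact_mod_cast hk
  set q : ℝ := ((r : ℝ) / k) ^ (1 - α / 2) with hq
  have hq0 : 0 ≤ q := by positivity
  have h1 : ∀ x, ‖discError α g k r x‖ₑ ≤ ∫⁻ ζ, errWeight α B K k r ζ *
      (reach d ((R : ℝ) + d)).indicator 1 (latticePoint k x, ζ) := by
    intro x
    rw [h.discError_eq hd hα hα2 hk, enorm_mul]
    have h2 : ‖(1 / 2 : ℝ)‖ₑ ≤ 1 := by
      rw [Real.enorm_eq_ofReal (by norm_num), ← ENNReal.ofReal_one]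
      exact ENNReal.ofReal_le_ofReal (by norm_num)
    calc _ ≤ 1 * ∫⁻ ζ, ‖errDensity α g k r (latticePoint k x) ζ‖ₑ := by
          gcongr
          exact enorm_integral_le_lintegral_enorm _
      _ ≤ _ := by
          rw [one_mul]
          exact lintegral_mono fun ζ => h.enorm_errDensity_le hd hα hk hr _ ζ
  have h3 : ∑' x, ENNReal.ofReal (discError α g k r x ^ 2) ≤
      ENNReal.ofReal ((k : ℝ) ^ d * (m.toReal * (A * q) ^ 2)) := by
    have e : ∀ x, ENNReal.ofReal (discError α g k r x ^ 2) = ‖discError α g k r x‖ₑ ^ 2 := by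
      intro x
      rw [← enorm_pow, Real.enorm_eq_ofReal (sq_nonneg _)]
    rw [tsum_congr e, ← lintegral_count]
    refine (lintegral_mono fun x => pow_le_pow_left' (h1 x) 2).trans
      ((lintegral_sq_lintegral_reach_le (measurable_latticePoint k) (measurable_errWeight K k r)
        (count_reach_le hk _)).trans ?_)
    rw [ENNReal.ofReal_mul (by positivity), ENNReal.ofReal_mul (by positivity),
      ENNReal.ofReal_toReal hmt.ne, mul_assoc,
      ENNReal.ofReal_pow (show 0 ≤ A * q by positivity)]
    gcongr
    exact hA k r hr0 hrk
  have hs : Summable fun x => discError α g k r x ^ 2 := by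
    have h4 : ∑' x, ENNReal.ofReal (discError α g k r x ^ 2) ≠ ⊤ :=
      (h3.trans_lt ENNReal.ofReal_lt_top).ne
    have := ENNReal.summable_toReal h4
    simpa only [ENNReal.toReal_ofReal (sq_nonneg _)] using this
  refine ⟨hs, ?_⟩
  rw [← ENNReal.ofReal_tsum_of_nonneg (fun x => sq_nonneg _) hs,
    ENNReal.ofReal_le_ofReal_iff (by positivity)] at h3
  refine h3.trans ?_
  have e2 : ((k : ℝ) ^ ((d : ℝ) / 2)) ^ 2 = (k : ℝ) ^ d := by
    rw [← Real.rpow_natCast, ← Real.rpow_mul hk'.le, ← Real.rpow_natCast]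
    congr 1
    push_cast
    ring
  rw [mul_pow, mul_pow, e2]
  have : 0 ≤ (k : ℝ) ^ d * q ^ 2 := by positivity
  nlinarith

end Discretization


/-! ### The ℓ² estimate for the difference of solutions. -/

section LatticeEstimate

variable {d : ℕ} {α B C₁ lam : ℝ} {R : ℕ} {g : Space d → ℝ} {a : Sym2 (Vertex d) → ℝ}

theorem abs_tsum_mul_le {ι : Type*} {f g : ι → ℝ} (hf : Summable fun i => f i ^ 2)
    (hg : Summable fun i => g i ^ 2) :
    |∑' i, f i * g i| ≤ √(∑' i, f i ^ 2) * √(∑' i, g i ^ 2) := by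
  have := abs_tsum_mul_le_sqrt (b := fun _ : ι => (1 : ℝ)) (fun _ => zero_le_one)
    (by simpa using hf) (by simpa using hg)
  simpa using this

theorem BoundedEnv.summable_form (ha : BoundedEnv C₁ a) (hα : 0 < α) (hC : 0 ≤ C₁)
    {G v : Vertex d → ℝ} (hG : Summable fun z => G z ^ 2) (hv : Summable fun z => v z ^ 2) :
    Summable fun p : Vertex d × Vertex d =>
      jumpRate α a p.1 p.2 * ((G p.2 - G p.1) * (v p.2 - v p.1)) := by
  refine summable_of_kernel_bound (C := C₁) hα hG hv fun p => ?_
  have hJ := jumpKernel_nonneg α (p.1 - p.2)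
  rw [abs_mul]
  calc _ ≤ (C₁ * jumpKernel α (p.1 - p.2)) * (G p.1 ^ 2 + G p.2 ^ 2 + v p.1 ^ 2 + v p.2 ^ 2) :=
        mul_le_mul (ha.abs_jumpRate_le hα _ _) (abs_sub_mul_sub_le _ _ _ _)
          (abs_nonneg _) (by positivity)
    _ = _ := by ring

theorem summable_farKernel_form (hα : 0 < α) (r : ℕ)
    {G v : Vertex d → ℝ} (hG : Summable fun z => G z ^ 2) (hv : Summable fun z => v z ^ 2) :
    Summable fun p : Vertex d × Vertex d =>
      farKernel α r (p.1 - p.2) * ((G p.2 - G p.1) * (v p.2 - v p.1)) := by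
  refine summable_of_kernel_bound (C := 1) hα hG hv fun p => ?_
  rw [abs_mul, abs_of_nonneg (farKernel_nonneg _ _), one_mul, mul_comm]
  exact mul_le_mul (abs_sub_mul_sub_le _ _ _ _) (farKernel_le _ _) (farKernel_nonneg _ _)
    (by positivity)

/-- Only jumps of length at least r are centred; shorter ones keep their full random rate. -/
theorem BoundedEnv.tsum_form_eq (ha : BoundedEnv C₁ a) (hα : 0 < α) (hC : 0 ≤ C₁) (r : ℕ)
    {G v : Vertex d → ℝ} (hG : Summable fun z => G z ^ 2) (hv : Summable fun z => v z ^ 2) :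
    ∑' p : Vertex d × Vertex d, jumpRate α a p.1 p.2 * ((G p.2 - G p.1) * (v p.2 - v p.1)) =
      (∑' p, nearTerm α a r G v p) + (∑' p, farTerm α a r G v p) +
        ∑' p : Vertex d × Vertex d,
          farKernel α r (p.1 - p.2) * ((G p.2 - G p.1) * (v p.2 - v p.1)) := by
  have e : ∀ p : Vertex d × Vertex d,
      jumpRate α a p.1 p.2 * ((G p.2 - G p.1) * (v p.2 - v p.1)) - farTerm α a r G v p -
        farKernel α r (p.1 - p.2) * ((G p.2 - G p.1) * (v p.2 - v p.1)) =
      nearTerm α a r G v p := by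
    intro p
    rw [nearTerm, farTerm, farKernel, jumpRate]
    split_ifs <;> ring
  have s1 := ha.summable_form hα hC hG hv
  have s2 := ha.summable_farTerm hα hC r hG hv
  have s3 := summable_farKernel_form hα r hG hv
  rw [← tsum_congr e, (s1.sub s2).tsum_sub s3, s1.tsum_sub s2]
  ring

theorem TestBounds.lattice_lip (h : TestBounds α g B R) (k : ℕ) (x y : Vertex d) :
    |g (latticePoint k x) - g (latticePoint k y)| ≤ B / k * eucl (x - y) := by
  refine (h.lip _ _).trans (le_of_eq ?_)
  rw [latticePoint_sub, norm_latticePoint]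
  ring

theorem TestBounds.lattice_support (h : TestBounds α g B R) {k : ℕ} (hk : 0 < k) (x : Vertex d)
    (hx : ((R * k : ℕ) : ℝ) < ‖x‖) : g (latticePoint k x) = 0 := by
  have hk' : (0 : ℝ) < k := by exact_mod_cast hk
  refine h.support _ ?_
  rw [norm_latticePoint, lt_div_iff₀ hk']
  push_cast at hx
  exact hx.trans_le (norm_le_eucl x)

/-- Completing the square absorbs the terms in t, which leaves a quadratic inequality in w alone. -/
theorem le_of_quadratic_bound {w t Z E : ℝ} (hlam : 0 < lam) (hw : 0 ≤ w) (hZ : 0 ≤ Z)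
    (hE : 0 ≤ E) (h : lam * w ^ 2 + t ^ 2 ≤ E * Z * (t + w)) : w ≤ (1 + 1 / lam) * E * Z := by
  have h1 : lam * w ^ 2 ≤ E * Z * w + (E * Z) ^ 2 / 4 := by
    nlinarith [sq_nonneg (t - E * Z / 2)]
  set X := E * Z with hX
  have hX0 : 0 ≤ X := mul_nonneg hE hZ
  rw [mul_assoc, ← hX]
  by_contra hcon
  rw [not_le] at hcon
  have h2 : lam * ((1 + 1 / lam) * X) = (lam + 1) * X := by field_simp
  have h3 : (lam + 1) * X ≤ lam * w := by
    rw [← h2]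
    gcongr
  have h4 : X ≤ w := by
    have : 0 ≤ 1 / lam * X := by positivity
    nlinarith
  have h5 : (lam + 1) * X * w ≤ lam * w ^ 2 :=
    (mul_le_mul_of_nonneg_right h3 hw).trans (le_of_eq (by ring))
  have h6 : lam * X * w ≤ X ^ 2 / 4 := by nlinarith
  rcases hX0.eq_or_lt with h0 | h0
  · rw [← h0, mul_zero] at hcon
    rw [← h0] at h1
    have : 0 < lam * w ^ 2 := by positivity
    linarith
  · have h7 : lam * w < X / 2 := by
      have : X * (lam * w) ≤ X * (X / 4) := by linarith
      have := le_of_mul_le_mul_left this h0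
      linarith
    nlinarith [mul_nonneg hlam.le hX0]

theorem quadratic_bound_of_parts {w t Y N F D A₁ A₂ A₃ : ℝ} (hw : 0 ≤ w) (ht : 0 ≤ t)
    (hY : 0 ≤ Y) (hA₁ : 0 ≤ A₁) (hA₂ : 0 ≤ A₂) (hA₃ : 0 ≤ A₃)
    (hid : lam * w ^ 2 + t ^ 2 = -(1 / 2) * N - 1 / 2 * F + D) (hN : |N| ≤ A₁ * Y * t)
    (hF : |F| ≤ A₂ * (Y + 1) * t + A₂ * w) (hD : |D| ≤ w * (A₃ * Y)) :
    lam * w ^ 2 + t ^ 2 ≤ (A₁ + A₂ + A₃) * (Y + 1) * (t + w) := by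
  have b1 := (neg_le_abs N).trans hN
  have b2 := (neg_le_abs F).trans hF
  have b3 := (le_abs_self D).trans hD
  have p1 : 0 ≤ A₁ * Y * t := by positivity
  have p2 : 0 ≤ A₂ * (Y + 1) * t := by positivity
  have p3 : 0 ≤ A₂ * w := by positivity
  have p4 : 0 ≤ A₁ * t := by positivity
  have p5 : 0 ≤ A₂ * Y * w := by positivity
  have p6 : 0 ≤ A₃ * (Y + 1) * t := by positivity
  have p7 : 0 ≤ A₃ * w := by positivity
  have p8 : 0 ≤ A₁ * (Y + 1) * w := by positivity
  have e2 : (A₁ + A₂ + A₃) * (Y + 1) * (t + w) = A₁ * Y * t + A₁ * t + A₁ * (Y + 1) * w +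
      A₂ * (Y + 1) * t + A₂ * Y * w + A₂ * w + A₃ * (Y + 1) * t + w * (A₃ * Y) + A₃ * w := by
    ring
  rw [hid, e2]
  linarith

/-- The energy identity for v = u - G bounds λw² + t² with w = ‖v‖ and t = k^(α/2) √E(v). Short
jumps, centred long jumps and the discretisation error enter through Y = k^(d/2) (r/k)^(1-α/2). The
extra 1 comes from the terms k^(-α/2) √E and k^(-α) ‖v‖ of the far estimate. -/
theorem TestBounds.exists_sqrt_sum_sq_le (h : TestBounds α g B R) (hd : 0 < d) (hα : 0 < α)
    (hα2 : α < 2) (hαd : α < d) (hlam : 0 < lam) (hC : 0 ≤ C₁) :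
    ∃ A : ℝ, 0 < A ∧ ∀ a : Sym2 (Vertex d) → ℝ, BoundedEnv C₁ a → ∀ k r : ℕ, 2 * d ≤ r → r ≤ k →
      (∀ r' : ℕ, r ≤ r' → ∀ c ∈ box d (R * k + 4 * r'), GoodCube α C₁ a r' c) →
      ∀ u : Vertex d → ℝ, IsLatticeResolvent α lam a k (fun x => lam * g x - fracLap α g x) u →
      √(∑' z, (u z - g (latticePoint k z)) ^ 2) ≤
        A * ((k : ℝ) ^ ((d : ℝ) / 2) * ((r : ℝ) / k) ^ (1 - α / 2) + 1) := by
  have hB := h.pos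
  obtain ⟨A₁, hA₁, hnear⟩ := exists_abs_tsum_nearTerm_le (Lip := B) hd hα hα2 hC h.one_le
  obtain ⟨A₂, hA₂, hfar⟩ := exists_abs_tsum_farTerm_le hd hα hαd hC h.one_le hB.le hB.le
  obtain ⟨A₃, hA₃, hdisc⟩ := h.exists_sum_sq_discError_le hd hα hα2
  set E := A₁ + A₂ + √A₃ with hE
  have hE0 : 0 < E := by positivity
  refine ⟨(1 + 1 / lam) * E, by positivity, fun a ha k r hr hrk hgood u hu => ?_⟩
  have hr0 : 0 < r := by omega
  have hk : 0 < k := by omega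
  have hk' : (0 : ℝ) < k := by exact_mod_cast hk
  have hr1 : (1 : ℝ) ≤ r := by exact_mod_cast hr0
  set G : Vertex d → ℝ := fun z => g (latticePoint k z) with hG
  set v : Vertex d → ℝ := fun z => u z - G z with hv
  have hGL : ∀ x y, |G x - G y| ≤ B / k * eucl (x - y) := h.lattice_lip k
  have hGs : ∀ x, ((R * k : ℕ) : ℝ) < ‖x‖ → G x = 0 := h.lattice_support hk
  have hG2 := summable_sq_of_eq_zero_of_lt_norm hGs
  have hv2 : Summable fun z => v z ^ 2 := summable_sq_sub hu.1 hG2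
  have hF2 := h.summable_sq_fracLap hd hα hα2 hk
  obtain ⟨hD2, hDle⟩ := hdisc k r hr hrk
  have hN := hnear a ha k r hk hr0 G hGL hGs v hv2
  have hFa := hfar a ha k r hk hr0 G hGL (fun x => h.bound _) hGs hgood v hv2
  set N := ∑' p, nearTerm α a r G v p
  set F := ∑' p, farTerm α a r G v p
  set D := ∑' p : Vertex d × Vertex d,
    farKernel α r (p.1 - p.2) * ((G p.2 - G p.1) * (v p.2 - v p.1)) with hDdef
  set w := √(∑' z, v z ^ 2) with hw
  have hw0 : 0 ≤ w := Real.sqrt_nonneg _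
  have hw2 : w ^ 2 = ∑' z, v z ^ 2 := Real.sq_sqrt (tsum_nonneg fun _ => sq_nonneg _)
  set s := √(energy α a v) with hs
  have hs0 : 0 ≤ s := Real.sqrt_nonneg _
  have hs2 : s ^ 2 = energy α a v := Real.sq_sqrt (ha.energy_nonneg hα v)
  have hid := ha.resolvent_identity hα (lam := lam) hk (u := v)
    (h := fun z => latticeOp α a k G z - fracLap α g (latticePoint k z)) hv2 (fun z => by
      have h1 := hu.2 z
      rw [hv, ha.latticeOp_sub hα hk hu.1 hG2]
      simp only [hG] at h1 ⊢
      linarith)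
  have hop := ha.hasSum_mul_latticeOp hα hk hG2 hv2
  rw [ha.tsum_form_eq hα hC r hG2 hv2] at hop
  have hdet := (tsum_mul_tsum_sub_eq hα (b := fun x y => farKernel α r (x - y)) (C := 1)
    (fun x y => by rw [abs_of_nonneg (farKernel_nonneg _ _), one_mul]; exact farKernel_le _ _)
    (fun x y => by rw [← farKernel_neg, neg_sub]) hG2 hv2).mul_left ((k : ℝ) ^ α)
  have hLs := (summable_mul_of_sq hv2 hF2).hasSum
  set L := ∑' z, v z * fracLap α g (latticePoint k z)
  have hdisc' : HasSum (fun z => v z * discError α g k r z)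
      ((k : ℝ) ^ α * (-(1 / 2) * D) - L) := by
    refine (hdet.sub hLs).congr_fun fun z => ?_
    rw [discError]
    ring
  have hid2 : lam * w ^ 2 + (k : ℝ) ^ α * s ^ 2 =
      (k : ℝ) ^ α * (-(1 / 2) * (N + F + D)) - L := by
    rw [hw2, hs2]
    refine hid.unique ((hop.sub hLs).congr_fun fun z => ?_)
    ring
  have hDb : |(k : ℝ) ^ α * (-(1 / 2) * D) - L| ≤ w * √(∑' x, discError α g k r x ^ 2) := by
    rw [← hdisc'.tsum_eq]
    exact abs_tsum_mul_le hv2 hD2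
  set q : ℝ := ((r : ℝ) / k) ^ (1 - α / 2) with hq
  set Y : ℝ := (k : ℝ) ^ ((d : ℝ) / 2) * q with hY
  have hY0 : 0 ≤ Y := by positivity
  have hDr : √(∑' x, discError α g k r x ^ 2) ≤ √A₃ * Y := by
    refine (Real.sqrt_le_sqrt hDle).trans (le_of_eq ?_)
    rw [Real.sqrt_mul hA₃.le, Real.sqrt_sq hY0]
  set κ : ℝ := (k : ℝ) ^ (α / 2) with hκ
  have hκ0 : 0 < κ := by positivity
  have hκ2 : (k : ℝ) ^ α = κ ^ 2 := by
    rw [hκ, ← Real.rpow_natCast, ← Real.rpow_mul hk'.le]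
    congr 1
    push_cast
    ring
  -- The short jumps and the discretisation error have the same order Y; both are governed by the
  -- cutoff r.
  have hYeq : κ * ((k : ℝ) ^ ((d : ℝ) / 2 - 1) * (r : ℝ) ^ (1 - α / 2)) = Y := by
    rw [hY, hq, Real.div_rpow (by positivity) hk'.le, hκ, ← mul_assoc, ← Real.rpow_add hk',
      mul_div_assoc', mul_comm _ ((r : ℝ) ^ (1 - α / 2)), mul_comm ((k : ℝ) ^ ((d : ℝ) / 2)),
      mul_div_assoc, ← Real.rpow_sub hk']
    congr 2
    ring
  have hYle : κ * (k : ℝ) ^ ((d : ℝ) / 2 - 1) ≤ Y := by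
    rw [← hYeq]
    gcongr
    exact le_mul_of_one_le_right (by positivity) (Real.one_le_rpow hr1 (by linarith))
  have hκi : κ * (k : ℝ) ^ (-(α / 2)) = 1 := by
    rw [hκ, ← Real.rpow_add hk', add_neg_cancel, Real.rpow_zero]
  have hκi2 : κ ^ 2 * (k : ℝ) ^ (-α) = 1 := by
    rw [← hκ2, ← Real.rpow_add hk', add_neg_cancel, Real.rpow_zero]
  set t := κ * s with ht
  have ht0 : 0 ≤ t := by positivity
  have hN' : κ ^ 2 * |N| ≤ A₁ * Y * t := by
    calc κ ^ 2 * |N| ≤ κ ^ 2 * (A₁ * ((k : ℝ) ^ ((d : ℝ) / 2 - 1) * (r : ℝ) ^ (1 - α / 2)) * s) := by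
          gcongr
      _ = A₁ * (κ * ((k : ℝ) ^ ((d : ℝ) / 2 - 1) * (r : ℝ) ^ (1 - α / 2))) * t := by
          rw [ht]; ring
      _ = _ := by rw [hYeq]
  have hF' : κ ^ 2 * |F| ≤ A₂ * (Y + 1) * t + A₂ * w := by
    calc κ ^ 2 * |F| ≤ κ ^ 2 * (A₂ * ((k : ℝ) ^ ((d : ℝ) / 2 - 1) + (k : ℝ) ^ (-(α / 2))) * s +
          A₂ * (k : ℝ) ^ (-α) * w) := by gcongr
      _ = A₂ * (κ * (k : ℝ) ^ ((d : ℝ) / 2 - 1) + κ * (k : ℝ) ^ (-(α / 2))) * t +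
          A₂ * (κ ^ 2 * (k : ℝ) ^ (-α)) * w := by rw [ht]; ring
      _ ≤ _ := by
          rw [hκi, hκi2, mul_one]
          gcongr
  rw [hκ2] at hid2 hDb
  have hfin : lam * w ^ 2 + t ^ 2 ≤ E * (Y + 1) * (t + w) := by
    have hκ2' : |κ ^ 2| = κ ^ 2 := abs_of_nonneg (sq_nonneg κ)
    refine quadratic_bound_of_parts (N := κ ^ 2 * N) (F := κ ^ 2 * F) hw0 ht0 hY0 hA₁.le hA₂.le
      (Real.sqrt_nonneg A₃) ?_ (by rw [abs_mul, hκ2']; exact hN')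
      (by rw [abs_mul, hκ2']; exact hF') (hDb.trans (mul_le_mul_of_nonneg_left hDr hw0))
    rw [ht, mul_pow, hid2]
    ring
  have := le_of_quadratic_bound hlam hw0 (by positivity) hE0.le hfin
  exact this

/-- The a priori bound for the resolvent. -/
theorem BoundedEnv.sqrt_sum_sq_le (ha : BoundedEnv C₁ a) (hα : 0 < α) (hlam : 0 < lam) {k : ℕ}
    (hk : 0 < k) {f : Space d → ℝ} (hf : Summable fun z => f (latticePoint k z) ^ 2)
    {u : Vertex d → ℝ} (hu : IsLatticeResolvent α lam a k f u) :
    √(∑' z, u z ^ 2) ≤ √(∑' z, f (latticePoint k z) ^ 2) / lam := by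
  have h1 := ha.resolvent_identity hα hk hu.1 hu.2
  have h2 := abs_tsum_mul_le hf hu.1
  rw [h1.tsum_eq] at h2
  set w := √(∑' z, u z ^ 2) with hw
  have hw2 : ∑' z, u z ^ 2 = w ^ 2 := (Real.sq_sqrt (tsum_nonneg fun _ => sq_nonneg _)).symm
  have hw0 : 0 ≤ w := Real.sqrt_nonneg _
  have h3 : 0 ≤ (k : ℝ) ^ α * energy α a u := mul_nonneg (by positivity) (ha.energy_nonneg hα u)
  have h4 := (le_abs_self _).trans h2
  rw [hw2] at h4
  rw [le_div_iff₀ hlam]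
  rcases hw0.eq_or_lt with h0 | h0
  · rw [← h0, zero_mul]; exact Real.sqrt_nonneg _
  · refine le_of_mul_le_mul_right ?_ h0
    nlinarith

end LatticeEstimate

/-! ### From lattice norms to L² norms on space. -/

section CellNorm

variable {d : ℕ} {α B : ℝ} {R : ℕ} {g : Space d → ℝ}

theorem eLpNorm_two_le_of_lintegral_le {X : Type*} [MeasurableSpace X] {μ : Measure X} {f : X → ℝ}
    {c : ℝ} (hc : 0 ≤ c) (h : ∫⁻ x, ‖f x‖ₑ ^ 2 ∂μ ≤ ENNReal.ofReal (c ^ 2)) :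
    eLpNorm f 2 μ ≤ ENNReal.ofReal c := by
  rw [eLpNorm_eq_lintegral_rpow_enorm_toReal two_ne_zero ENNReal.ofNat_ne_top]
  have e : (ENNReal.toReal 2) = ((2 : ℕ) : ℝ) := by simp
  simp only [e, ENNReal.rpow_natCast]
  refine (ENNReal.rpow_le_rpow h (by positivity)).trans (le_of_eq ?_)
  rw [ENNReal.ofReal_pow hc, ← ENNReal.rpow_natCast, ← ENNReal.rpow_mul]
  simp

theorem eLpNorm_cellExtend_le {k : ℕ} (hk : 0 < k) {u : Vertex d → ℝ}
    (hu : Summable fun z => u z ^ 2) :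
    eLpNorm (cellExtend k u) 2 volume ≤
      ENNReal.ofReal ((k : ℝ) ^ (-((d : ℝ) / 2)) * √(∑' z, u z ^ 2)) := by
  have hk' : (0 : ℝ) < k := by exact_mod_cast hk
  refine eLpNorm_two_le_of_lintegral_le (by positivity) ?_
  have h1 := lintegral_comp_cellIndex hk fun z => ‖u z‖ₑ ^ 2
  have e : ∀ z, ‖u z‖ₑ ^ 2 = ENNReal.ofReal (u z ^ 2) := fun z => by
    rw [← enorm_pow, Real.enorm_eq_ofReal (sq_nonneg _)]
  refine le_of_eq (h1.trans ?_)
  rw [tsum_congr e, ← ENNReal.ofReal_tsum_of_nonneg (fun _ => sq_nonneg _) hu,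
    ← ENNReal.ofReal_mul (by positivity), mul_pow, Real.sq_sqrt (tsum_nonneg fun _ => sq_nonneg _)]
  congr 2
  rw [← Real.rpow_natCast, ← Real.rpow_natCast, ← Real.rpow_mul hk'.le, ← Real.rpow_neg hk'.le]
  congr 1
  push_cast
  ring

/-- Lipschitz continuity on cells of diameter at most d/k, supported in a fixed ball. -/
theorem TestBounds.exists_eLpNorm_cellExtend_sub_le (h : TestBounds α g B R) :
    ∃ A : ℝ, 0 < A ∧ ∀ k : ℕ, 0 < k →
      eLpNorm (fun x => cellExtend k (fun z => g (latticePoint k z)) x - g x) 2 volume ≤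
        ENNReal.ofReal (A / k) := by
  have hB := h.pos
  set S := Metric.closedBall (0 : Space d) ((R : ℝ) + d) with hS
  have hSt : volume S < ⊤ := measure_closedBall_lt_top
  refine ⟨B * d * √(volume S).toReal + 1, by positivity, fun k hk => ?_⟩
  have hk' : (0 : ℝ) < k := by exact_mod_cast hk
  have hk1 : (1 : ℝ) ≤ k := by exact_mod_cast hk
  have hle : ENNReal.ofReal (B * d * √(volume S).toReal / k) ≤
      ENNReal.ofReal ((B * d * √(volume S).toReal + 1) / k) := by
    apply ENNReal.ofReal_le_ofReal
    gcongr
    linarith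
  refine le_trans (eLpNorm_two_le_of_lintegral_le (by positivity) ?_) hle
  have hpt : ∀ x : Space d, ‖cellExtend k (fun z => g (latticePoint k z)) x - g x‖ₑ ^ 2 ≤
      S.indicator (fun _ => ENNReal.ofReal ((B * d / k) ^ 2)) x := by
    intro x
    set y := latticePoint k (cellIndex k x) with hy
    have hxy : ‖x - y‖ ≤ d / k := norm_sub_latticePoint_cellIndex_le hk x
    have hxy1 : ‖x - y‖ ≤ d := hxy.trans (div_le_self (by positivity) hk1)
    change ‖g y - g x‖ₑ ^ 2 ≤ _
    by_cases hx : x ∈ S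
    · rw [Set.indicator_of_mem hx, ← enorm_pow, Real.enorm_eq_ofReal (sq_nonneg _)]
      apply ENNReal.ofReal_le_ofReal
      rw [← sq_abs]
      refine pow_le_pow_left₀ (abs_nonneg _) ((h.lip y x).trans ?_) 2
      rw [norm_sub_rev, mul_div_assoc]
      gcongr
    · rw [Set.indicator_of_notMem hx]
      have hx' : (R : ℝ) + d < ‖x‖ := by simpa [hS] using hx
      have hy' : (R : ℝ) < ‖y‖ := by
        have := norm_add_le (x - y) y
        rw [sub_add_cancel] at this
        linarith
      have hd0 : (0 : ℝ) ≤ d := Nat.cast_nonneg d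
      rw [h.support _ hy', h.support _ (by linarith)]
      simp
  refine (lintegral_mono hpt).trans ?_
  rw [lintegral_indicator_const Metric.isClosed_closedBall.measurableSet,
    ← ENNReal.ofReal_toReal hSt.ne, ← ENNReal.ofReal_mul (by positivity)]
  apply ENNReal.ofReal_le_ofReal
  have e : (B * d * √(volume S).toReal / k) ^ 2 = (B * d / k) ^ 2 * √(volume S).toReal ^ 2 := by
    ring
  rw [ENNReal.toReal_ofReal ENNReal.toReal_nonneg, e, Real.sq_sqrt ENNReal.toReal_nonneg]

end CellNorm


/-! ### Comparison of the error with the claimed rate. -/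

section RateComparison

theorem one_le_log {k : ℕ} (hk : 3 ≤ k) : 1 ≤ Real.log k := by
  have hk' : (3 : ℝ) ≤ k := by exact_mod_cast hk
  rw [Real.le_log_iff_exp_le (by linarith)]
  exact Real.exp_one_lt_three.le.trans hk'

theorem exists_rpow_neg_mul_log_le {s m : ℝ} (hs : 0 < s) (hm : 0 ≤ m) :
    ∃ C : ℝ, 0 < C ∧ ∀ x : ℝ, 1 ≤ x → x ^ (-s) * Real.log x ^ m ≤ C := by
  set ε := s / (m + 1) with hε
  have hε0 : 0 < ε := by positivity
  refine ⟨(ε ^ m)⁻¹, by positivity, fun x hx => ?_⟩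
  have hx0 : 0 < x := by linarith
  have h1 : Real.log x ^ m ≤ (x ^ ε / ε) ^ m :=
    Real.rpow_le_rpow (Real.log_nonneg hx) (Real.log_le_rpow_div hx0.le hε0) hm
  have h2 : (x ^ ε / ε) ^ m = x ^ (ε * m) * (ε ^ m)⁻¹ := by
    rw [Real.div_rpow (by positivity) hε0.le, ← Real.rpow_mul hx0.le, div_eq_mul_inv]
  have h3 : x ^ (-s) * x ^ (ε * m) ≤ 1 := by
    rw [← Real.rpow_add hx0]
    apply Real.rpow_le_one_of_one_le_of_nonpos hx
    have : ε * (m + 1) = s := by rw [hε]; field_simp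
    nlinarith
  calc x ^ (-s) * Real.log x ^ m ≤ x ^ (-s) * (x ^ (ε * m) * (ε ^ m)⁻¹) := by
        rw [← h2]; gcongr
    _ = (x ^ (-s) * x ^ (ε * m)) * (ε ^ m)⁻¹ := by ring
    _ ≤ 1 * (ε ^ m)⁻¹ := by gcongr
    _ = _ := one_mul _

/-- Either the power of k is strictly better and absorbs any logarithm, or the powers agree and the
logarithmic exponents are compared. -/
theorem exists_error_le {σ m τ p D : ℝ} (hm : 0 ≤ m) (hp : 0 ≤ p) (hτD : τ ≤ D)
    (h : τ < σ ∨ τ = σ ∧ m ≤ p) :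
    ∃ C : ℝ, 0 < C ∧ ∀ k : ℕ, 3 ≤ k →
      (k : ℝ) ^ (-σ) * Real.log k ^ m + (k : ℝ) ^ (-D) ≤ C * ((k : ℝ) ^ (-τ) * Real.log k ^ p) := by
  have hmain : ∃ C : ℝ, 0 < C ∧ ∀ k : ℕ, 3 ≤ k →
      (k : ℝ) ^ (-σ) * Real.log k ^ m ≤ C * ((k : ℝ) ^ (-τ) * Real.log k ^ p) := by
    rcases h with h | ⟨rfl, h⟩
    · obtain ⟨C, hC, hb⟩ := exists_rpow_neg_mul_log_le (sub_pos.2 h) hm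
      refine ⟨C, hC, fun k hk => ?_⟩
      have hk' : (3 : ℝ) ≤ k := by exact_mod_cast hk
      have hk0 : (0 : ℝ) < k := by linarith
      have hl := one_le_log hk
      have e : (k : ℝ) ^ (-σ) = (k : ℝ) ^ (-τ) * (k : ℝ) ^ (-(σ - τ)) := by
        rw [← Real.rpow_add hk0]
        congr 1; ring
      calc _ = (k : ℝ) ^ (-τ) * ((k : ℝ) ^ (-(σ - τ)) * Real.log k ^ m) := by rw [e]; ring
        _ ≤ (k : ℝ) ^ (-τ) * (C * Real.log k ^ p) := by
            refine mul_le_mul_of_nonneg_left ((hb k (by linarith)).trans ?_) (by positivity)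
            exact le_mul_of_one_le_right hC.le (Real.one_le_rpow hl hp)
        _ = _ := by ring
    · refine ⟨1, one_pos, fun k hk => ?_⟩
      rw [one_mul]
      gcongr
      exact one_le_log hk
  obtain ⟨C, hC, hb⟩ := hmain
  refine ⟨C + 1, by positivity, fun k hk => ?_⟩
  have hk' : (3 : ℝ) ≤ k := by exact_mod_cast hk
  rw [add_mul, one_mul]
  refine add_le_add (hb k hk) ?_
  calc (k : ℝ) ^ (-D) ≤ (k : ℝ) ^ (-τ) :=
        Real.rpow_le_rpow_of_exponent_le (by linarith) (by linarith)
    _ ≤ _ := le_mul_of_one_le_right (by positivity) (Real.one_le_rpow (one_le_log hk) hp)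

theorem rate_pos {d : ℕ} {α γ : ℝ} {k : ℕ} (hk : 2 ≤ k) : 0 < rate d α γ k := by
  have hk' : (2 : ℝ) ≤ k := by exact_mod_cast hk
  have hk0 : (0 : ℝ) < k := by linarith
  have hl : 0 < Real.log k := Real.log_pos (by linarith)
  rw [rate]
  split_ifs
  · exact lt_min (by positivity) (by positivity)
  · positivity
  · positivity

/-- For α < 1 the exponent 1 - α/2 strictly exceeds both α/2 and 1 - α. For α ≥ 1 the powers agree
and only logarithms matter: (1/2)/d ≤ 1 when α = 1, and for α > 1 the bound min ≤ 2d reduces the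
claim to 2 - α ≤ α(1 + γ). -/
theorem exists_error_le_rate {d : ℕ} {α γ : ℝ} (hα : 0 < α) (hα2 : α < 2) (hαd : α < d)
    (hγ : 0 < γ) :
    ∃ C : ℝ, 0 < C ∧ ∀ k : ℕ, 3 ≤ k →
      (k : ℝ) ^ (-(1 - α / 2)) * Real.log k ^ ((1 - α / 2) / d) + (k : ℝ) ^ (-((d : ℝ) / 2)) ≤
        C * rate d α γ k := by
  have hd0 : (0 : ℝ) < d := hα.trans hαd
  have hd1 : (1 : ℝ) ≤ d := by
    have : 0 < d := by exact_mod_cast hd0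
    exact_mod_cast this
  have hm : 0 ≤ (1 - α / 2) / (d : ℝ) := div_nonneg (by linarith) hd0.le
  have hmin : 0 < min (4 * ((d : ℝ) - α)) (2 * (d : ℝ)) := lt_min (by linarith) (by linarith)
  rcases lt_trichotomy α 1 with h1 | h1 | h1
  · obtain ⟨C, hC, hb⟩ := exists_error_le (σ := 1 - α / 2) (τ := α / 2) (D := (d : ℝ) / 2)
      (p := α * (1 + γ) / min (4 * ((d : ℝ) - α)) (2 * (d : ℝ))) hm (by positivity)
      (by linarith) (Or.inl (by linarith))
    obtain ⟨C', hC', hb'⟩ := exists_error_le (σ := 1 - α / 2) (τ := min (1 - α) ((d : ℝ) / 2))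
      (D := (d : ℝ) / 2) (p := (1 / 2 : ℝ)) hm (by norm_num) (min_le_right _ _)
      (Or.inl ((min_le_left _ _).trans_lt (by linarith)))
    refine ⟨C + C', by positivity, fun k hk => ?_⟩
    have hr := rate_pos (d := d) (α := α) (γ := γ) (show 2 ≤ k by omega)
    have h2 := hb k hk
    have h3 := hb' k hk
    rw [rate, if_pos h1] at hr ⊢
    rw [lt_min_iff] at hr
    rcases min_cases ((k : ℝ) ^ (-(α / 2)) *
          Real.log k ^ (α * (1 + γ) / min (4 * ((d : ℝ) - α)) (2 * (d : ℝ))))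
        ((k : ℝ) ^ (-(min (1 - α) ((d : ℝ) / 2))) * Real.log k ^ (1 / 2 : ℝ)) with h4 | h4
    · rw [h4.1, add_mul]
      exact h2.trans (le_add_of_nonneg_right (mul_nonneg hC'.le hr.1.le))
    · rw [h4.1, add_mul]
      exact h3.trans (le_add_of_nonneg_left (mul_nonneg hC.le hr.2.le))
  · subst h1
    have hp : 0 ≤ (1 + γ) / min (4 * ((d : ℝ) - 1)) (2 * (d : ℝ)) := by positivity
    obtain ⟨C, hC, hb⟩ := exists_error_le (σ := 1 - 1 / 2) (τ := 1 / 2) (D := (d : ℝ) / 2)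
      (p := 1 + (1 + γ) / min (4 * ((d : ℝ) - 1)) (2 * (d : ℝ))) hm (by positivity)
      (by linarith) (Or.inr ⟨by norm_num, by
        have : (1 - 1 / 2) / (d : ℝ) ≤ 1 := by
          rw [div_le_one hd0]; linarith
        linarith⟩)
    refine ⟨C, hC, fun k hk => ?_⟩
    rw [rate, if_neg (lt_irrefl _), if_pos rfl]
    exact hb k hk
  · have hle : (1 - α / 2) / (d : ℝ) ≤ α * (1 + γ) / min (4 * ((d : ℝ) - α)) (2 * (d : ℝ)) := by
      rw [div_le_div_iff₀ hd0 hmin]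
      have h2 := min_le_right (4 * ((d : ℝ) - α)) (2 * (d : ℝ))
      calc (1 - α / 2) * min (4 * ((d : ℝ) - α)) (2 * (d : ℝ)) ≤ (1 - α / 2) * (2 * d) := by
            refine mul_le_mul_of_nonneg_left h2 (by linarith)
        _ = (2 - α) * d := by ring
        _ ≤ α * (1 + γ) * d := by
            refine mul_le_mul_of_nonneg_right ?_ hd0.le
            nlinarith
    obtain ⟨C, hC, hb⟩ := exists_error_le (σ := 1 - α / 2) (τ := (2 - α) / 2) (D := (d : ℝ) / 2)
      (p := α * (1 + γ) / min (4 * ((d : ℝ) - α)) (2 * (d : ℝ))) hm (by positivity)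
      (by linarith) (Or.inr ⟨by ring, hle⟩)
    refine ⟨C, hC, fun k hk => ?_⟩
    rw [rate, if_neg (by linarith), if_neg (by linarith)]
    exact hb k hk

end RateComparison

/-! ### The logarithmic cutoff length. -/

section Cutoff

variable {d : ℕ} {α C₁ : ℝ} {a : Sym2 (Vertex d) → ℝ}

/-- The length, of order `(log k) ^ (1 / d)`, above which all scales are well behaved. -/
noncomputable def cutoff (d : ℕ) (C₁ : ℝ) (k : ℕ) : ℕ :=
  ⌈(256 * C₁ ^ 2 * d * Real.log k) ^ (1 / (d : ℝ))⌉₊ + 2 * d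

theorem le_cutoff (k : ℕ) : (256 * C₁ ^ 2 * d * Real.log k) ^ (1 / (d : ℝ)) ≤ cutoff d C₁ k := by
  rw [cutoff]
  push_cast
  have := Nat.le_ceil ((256 * C₁ ^ 2 * d * Real.log k) ^ (1 / (d : ℝ)))
  have h2 : (0 : ℝ) ≤ 2 * d := by positivity
  linarith

/-- The constant 256 = 2 * 128 makes the box radius in `GoodFrom` at least exp(2 log k) = k², which
exceeds R k as soon as k ≥ R. The support radius R of g, the only trace of f, is thereby absorbed
without changing the random scale L. -/
theorem GoodFrom.goodCube (hd : 0 < d) (hC : 1 ≤ C₁) {L : ℕ} (hgood : GoodFrom α C₁ a L) {k R : ℕ}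
    (hk : 1 ≤ k) (hR : R ≤ k) (hL : L ≤ cutoff d C₁ k) {r : ℕ} (hr : cutoff d C₁ k ≤ r)
    {c : Vertex d} (hc : c ∈ box d (R * k + 4 * r)) : GoodCube α C₁ a r c := by
  refine hgood r (hL.trans hr) c fun i => ?_
  have hk' : (1 : ℝ) ≤ k := by exact_mod_cast hk
  have hk0 : (0 : ℝ) < k := by linarith
  have hR' : (R : ℝ) ≤ k := by exact_mod_cast hR
  have hd' : (0 : ℝ) < d := by exact_mod_cast hd
  have hl : 0 ≤ Real.log k := Real.log_nonneg hk'
  have h1 : |(c i : ℝ)| ≤ R * k + 4 * r := by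
    have := mem_box.1 hc i
    exact_mod_cast this
  refine h1.trans ?_
  gcongr
  have h2 : 256 * C₁ ^ 2 * d * Real.log k ≤ (r : ℝ) ^ d := by
    have h3 : (256 * C₁ ^ 2 * d * Real.log k) ^ (1 / (d : ℝ)) ≤ r :=
      (le_cutoff k).trans (by exact_mod_cast hr)
    have h4 := pow_le_pow_left₀ (by positivity) h3 d
    rwa [← Real.rpow_natCast, ← Real.rpow_mul (by positivity), one_div_mul_cancel hd'.ne',
      Real.rpow_one] at h4
  have h3 : 2 * Real.log k ≤ (r : ℝ) ^ d / (128 * C₁ ^ 2 * d) := by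
    rw [le_div_iff₀ (by positivity)]
    linarith
  calc (R : ℝ) * k ≤ k * k := by gcongr
    _ = Real.exp (2 * Real.log k) := by
        rw [two_mul, Real.exp_add, Real.exp_log hk0]
    _ ≤ _ := Real.exp_le_exp.2 h3

theorem tendsto_cutoff (hd : 0 < d) (hC : 1 ≤ C₁) : Tendsto (cutoff d C₁) atTop atTop := by
  have hd' : (0 : ℝ) < d := by exact_mod_cast hd
  have h1 : Tendsto (fun k : ℕ => (256 * C₁ ^ 2 * d * Real.log k) ^ (1 / (d : ℝ))) atTop atTop :=
    (tendsto_rpow_atTop (by positivity)).comp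
      ((Real.tendsto_log_atTop.comp tendsto_natCast_atTop_atTop).const_mul_atTop (by positivity))
  exact tendsto_natCast_atTop_iff.1 (tendsto_atTop_mono (fun k => le_cutoff k) h1)

theorem cutoff_le (hd : 0 < d) {k : ℕ} (hk : 3 ≤ k) :
    (cutoff d C₁ k : ℝ) ≤
      ((256 * C₁ ^ 2 * d) ^ (1 / (d : ℝ)) + 1 + 2 * d) * Real.log k ^ (1 / (d : ℝ)) := by
  have hl := one_le_log hk
  have hl0 : 0 ≤ Real.log k := by linarith
  have hl1 : 1 ≤ Real.log k ^ (1 / (d : ℝ)) := Real.one_le_rpow hl (by positivity)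
  have h1 := (Nat.ceil_lt_add_one (a := (256 * C₁ ^ 2 * d * Real.log k) ^ (1 / (d : ℝ)))
    (by positivity)).le
  rw [Real.mul_rpow (by positivity) hl0] at h1
  rw [cutoff]
  push_cast
  rw [Real.mul_rpow (by positivity) hl0]
  have hd0 : (0 : ℝ) ≤ d := Nat.cast_nonneg d
  nlinarith

theorem eventually_cutoff_le (hd : 0 < d) : ∀ᶠ k in atTop, cutoff d C₁ k ≤ k := by
  set c : ℝ := (256 * C₁ ^ 2 * d) ^ (1 / (d : ℝ)) + 1 + 2 * d with hc
  have hc0 : 0 < c := by positivity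
  have hd' : (1 : ℝ) ≤ d := by exact_mod_cast hd
  have h1 := (Real.isLittleO_log_id_atTop.bound (inv_pos.2 hc0))
  have h2 := tendsto_natCast_atTop_atTop.eventually h1
  filter_upwards [h2, eventually_ge_atTop 3] with k hk hk3
  have hl := one_le_log hk3
  rw [Real.norm_eq_abs, abs_of_nonneg (by linarith), id, Real.norm_natCast] at hk
  have h3 : Real.log k ^ (1 / (d : ℝ)) ≤ Real.log k := by
    have : 1 / (d : ℝ) ≤ 1 := by rw [div_le_one (by linarith)]; exact hd'
    calc _ ≤ Real.log k ^ (1 : ℝ) := Real.rpow_le_rpow_of_exponent_le hl this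
      _ = _ := Real.rpow_one _
  have h4 : c * Real.log k ≤ k := by
    calc c * Real.log k ≤ c * (c⁻¹ * k) := by gcongr
      _ = k := by rw [← mul_assoc, mul_inv_cancel₀ hc0.ne', one_mul]
  have h5 : (cutoff d C₁ k : ℝ) ≤ k := (cutoff_le hd hk3).trans (le_trans (by gcongr) h4)
  exact_mod_cast h5

end Cutoff

/-! ### Assembly of the convergence rate. -/

section Convergence

variable {d : ℕ} {α B C₁ lam γ : ℝ} {R : ℕ} {g : Space d → ℝ}

theorem measurable_cellExtend (k : ℕ) (u : Vertex d → ℝ) : Measurable (cellExtend k u) :=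
  (measurable_of_countable u).comp (measurable_cellIndex k)

theorem TestBounds.summable_sq_lattice (h : TestBounds α g B R) (hd : 0 < d) (hα : 0 < α)
    (hα2 : α < 2) {k : ℕ} (hk : 0 < k) {f : Space d → ℝ}
    (hf : f = fun x => lam * g x - fracLap α g x) :
    Summable fun z => f (latticePoint k z) ^ 2 := by
  subst hf
  refine summable_sq_sub ?_ (h.summable_sq_fracLap hd hα hα2 hk)
  have h1 := (summable_sq_of_eq_zero_of_lt_norm (h.lattice_support hk)).mul_left (lam ^ 2)
  exact h1.congr fun z => (mul_pow _ _ _).symm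

/-- The threshold K depends on g through its support radius; the next two results remove it. -/
theorem TestBounds.exists_eLpNorm_le_of_large (h : TestBounds α g B R) (hd : 0 < d) (hα : 0 < α)
    (hα2 : α < 2) (hαd : α < d) (hlam : 0 < lam) (hγ : 0 < γ) (hC : 1 ≤ C₁) :
    ∃ (C : ℝ) (K : ℕ), 0 < C ∧ ∀ a : Sym2 (Vertex d) → ℝ, BoundedEnv C₁ a → ∀ L,
      GoodFrom α C₁ a L → ∀ k : ℕ, K ≤ k → L ≤ cutoff d C₁ k → ∀ u : Vertex d → ℝ,
      IsLatticeResolvent α lam a k (fun x => lam * g x - fracLap α g x) u →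
      eLpNorm (fun x => cellExtend k u x - g x) 2 volume ≤ ENNReal.ofReal (C * rate d α γ k) := by
  have hd' : (0 : ℝ) < d := by exact_mod_cast hd
  obtain ⟨A, hA, hmain⟩ := h.exists_sqrt_sum_sq_le hd hα hα2 hαd hlam (show 0 ≤ C₁ by linarith)
  obtain ⟨A', hA', hcell⟩ := h.exists_eLpNorm_cellExtend_sub_le
  obtain ⟨C, hC0, hrate⟩ := exists_error_le_rate hα hα2 hαd hγ
  obtain ⟨K, hK⟩ := eventually_atTop.1 (eventually_cutoff_le (d := d) (C₁ := C₁) hd)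
  set c : ℝ := (256 * C₁ ^ 2 * d) ^ (1 / (d : ℝ)) + 1 + 2 * d with hc
  have hc1 : 1 ≤ c := by
    have : 0 ≤ (256 * C₁ ^ 2 * d : ℝ) ^ (1 / (d : ℝ)) := by positivity
    linarith
  have hc0 : 0 < c := by linarith
  refine ⟨(A + A') * (c ^ (1 - α / 2) + 1) * C, max K (max R 3), by positivity,
    fun a ha L hgood k hk hL u hu => ?_⟩
  have hkK : K ≤ k := (le_max_left _ _).trans hk
  have hkR : R ≤ k := (le_max_left _ _).trans ((le_max_right _ _).trans hk)
  have hk3 : 3 ≤ k := (le_max_right _ _).trans ((le_max_right _ _).trans hk)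
  have hk0 : 0 < k := by omega
  have hk' : (0 : ℝ) < k := by exact_mod_cast hk0
  have hk1 : (1 : ℝ) ≤ k := by exact_mod_cast hk0
  set r := cutoff d C₁ k with hr
  have hrk : r ≤ k := hK k hkK
  have hr2 : 2 * d ≤ r := by rw [hr, cutoff]; omega
  have hr1 : (1 : ℝ) ≤ r := by
    have : 1 ≤ r := by omega
    exact_mod_cast this
  have h1 := hmain a ha k r hr2 hrk
    (fun r' hr' c hc => hgood.goodCube hd hC (by omega) hkR hL hr' hc) u hu
  set G : Vertex d → ℝ := fun z => g (latticePoint k z) with hG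
  have hv2 : Summable fun z => (u z - G z) ^ 2 :=
    summable_sq_sub hu.1 (summable_sq_of_eq_zero_of_lt_norm (h.lattice_support hk0))
  have h2 := eLpNorm_cellExtend_le hk0 hv2
  have h3 := hcell k hk0
  have e : (fun x => cellExtend k u x - g x) =
      cellExtend k (fun z => u z - G z) + fun x => cellExtend k G x - g x := by
    funext x
    simp only [Pi.add_apply, cellExtend]
    ring
  have hgm : Measurable g := h.continuous.measurable
  rw [e]
  refine (eLpNorm_add_le (measurable_cellExtend k _).aestronglyMeasurable
    ((measurable_cellExtend k _).sub hgm).aestronglyMeasurable (by norm_num)).trans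
    ((add_le_add h2 h3).trans ?_)
  rw [← ENNReal.ofReal_add (by positivity) (by positivity)]
  apply ENNReal.ofReal_le_ofReal
  set q : ℝ := ((r : ℝ) / k) ^ (1 - α / 2) with hq
  have hq0 : 0 ≤ q := by positivity
  set δ : ℝ := (k : ℝ) ^ (-((d : ℝ) / 2)) with hδ
  have hδ0 : 0 < δ := by positivity
  have hδ1 : δ * (k : ℝ) ^ ((d : ℝ) / 2) = 1 := by
    rw [hδ, ← Real.rpow_add hk', neg_add_cancel, Real.rpow_zero]
  have b1 : δ * √(∑' z, (u z - G z) ^ 2) ≤ A * (q + δ) := by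
    calc _ ≤ δ * (A * ((k : ℝ) ^ ((d : ℝ) / 2) * q + 1)) := by gcongr
      _ = A * ((δ * (k : ℝ) ^ ((d : ℝ) / 2)) * q + δ) := by ring
      _ = _ := by rw [hδ1, one_mul]
  have b2 : A' / k ≤ A' * q := by
    rw [div_eq_mul_inv]
    gcongr
    calc (k : ℝ)⁻¹ ≤ (r : ℝ) / k := by
          rw [div_eq_mul_inv]
          exact le_mul_of_one_le_left (by positivity) hr1
      _ = ((r : ℝ) / k) ^ (1 : ℝ) := (Real.rpow_one _).symm
      _ ≤ q := Real.rpow_le_rpow_of_exponent_ge (by positivity)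
          (by rw [div_le_one hk']; exact_mod_cast hrk) (by linarith)
  have hl := one_le_log hk3
  have b3 : q ≤ c ^ (1 - α / 2) *
      ((k : ℝ) ^ (-(1 - α / 2)) * Real.log k ^ ((1 - α / 2) / d)) := by
    have hl0 : 0 ≤ Real.log k := by linarith
    have h4 : (r : ℝ) / k ≤ c * Real.log k ^ (1 / (d : ℝ)) / k := by
      gcongr
      exact cutoff_le hd hk3
    refine (Real.rpow_le_rpow (by positivity) h4 (by linarith)).trans (le_of_eq ?_)
    rw [Real.div_rpow (by positivity) hk'.le, Real.mul_rpow hc0.le (by positivity),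
      ← Real.rpow_mul hl0, Real.rpow_neg hk'.le, one_div_mul_eq_div, div_eq_mul_inv]
    ring
  set M : ℝ := (k : ℝ) ^ (-(1 - α / 2)) * Real.log k ^ ((1 - α / 2) / d) with hM
  have hM0 : 0 ≤ M := by positivity
  set c' : ℝ := c ^ (1 - α / 2) with hc'
  have hc'0 : 0 ≤ c' := by positivity
  calc _ ≤ A * (q + δ) + A' * q := add_le_add b1 b2
    _ ≤ (A + A') * (q + δ) := by nlinarith
    _ ≤ (A + A') * (c' * M + δ) := by gcongr
    _ ≤ (A + A') * ((c' + 1) * (M + δ)) := by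
        gcongr
        nlinarith
    _ ≤ (A + A') * ((c' + 1) * (C * rate d α γ k)) := by
        gcongr
        exact hrate k hk3
    _ = _ := by ring

/-- The a priori bound ‖u‖ ≤ ‖f‖/λ is uniform over bounded environments, so each single k admits a
deterministic constant. -/
theorem TestBounds.exists_eLpNorm_le_of_fixed (h : TestBounds α g B R) (hd : 0 < d) (hα : 0 < α)
    (hα2 : α < 2) (hlam : 0 < lam) {k : ℕ} (hk : 0 < k) :
    ∃ C : ℝ, 0 < C ∧ ∀ a : Sym2 (Vertex d) → ℝ, BoundedEnv C₁ a → ∀ u : Vertex d → ℝ,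
      IsLatticeResolvent α lam a k (fun x => lam * g x - fracLap α g x) u →
      eLpNorm (fun x => cellExtend k u x - g x) 2 volume ≤ ENNReal.ofReal C := by
  generalize hf : (fun x => lam * g x - fracLap α g x) = f
  have hs := h.summable_sq_lattice hd hα hα2 hk hf.symm
  set F : ℝ := √(∑' z, f (latticePoint k z) ^ 2) with hF
  refine ⟨(k : ℝ) ^ (-((d : ℝ) / 2)) * (F / lam) + (eLpNorm g 2 volume).toReal + 1, by positivity,
    fun a ha u hu => ?_⟩
  have h1 := ha.sqrt_sum_sq_le hα hlam hk hs hu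
  refine (eLpNorm_sub_le (measurable_cellExtend k _).aestronglyMeasurable
    h.continuous.measurable.aestronglyMeasurable (by norm_num)).trans ?_
  calc _ ≤ ENNReal.ofReal ((k : ℝ) ^ (-((d : ℝ) / 2)) * (F / lam)) +
        ENNReal.ofReal (eLpNorm g 2 volume).toReal := by
        gcongr
        · exact (eLpNorm_cellExtend_le hk hu.1).trans (ENNReal.ofReal_le_ofReal (by gcongr))
        · rw [ENNReal.ofReal_toReal h.memLp.2.ne]
    _ = ENNReal.ofReal ((k : ℝ) ^ (-((d : ℝ) / 2)) * (F / lam) + (eLpNorm g 2 volume).toReal) :=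
        (ENNReal.ofReal_add (by positivity) (by positivity)).symm
    _ ≤ _ := ENNReal.ofReal_le_ofReal (by linarith)

/-- As k₀ must not depend on f, the finitely many k below the threshold are absorbed into the
constant. This needs a positive rate, hence k ≥ 2, since the rate vanishes at k = 1. -/
theorem TestBounds.exists_eLpNorm_le (h : TestBounds α g B R) (hd : 0 < d) (hα : 0 < α)
    (hα2 : α < 2) (hαd : α < d) (hlam : 0 < lam) (hγ : 0 < γ) (hC : 1 ≤ C₁) :
    ∃ C : ℝ, 0 < C ∧ ∀ a : Sym2 (Vertex d) → ℝ, BoundedEnv C₁ a → ∀ L,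
      GoodFrom α C₁ a L → ∀ k : ℕ, 2 ≤ k → L ≤ cutoff d C₁ k → ∀ u : Vertex d → ℝ,
      IsLatticeResolvent α lam a k (fun x => lam * g x - fracLap α g x) u →
      eLpNorm (fun x => cellExtend k u x - g x) 2 volume ≤ ENNReal.ofReal (C * rate d α γ k) := by
  obtain ⟨C, K, hC0, hlarge⟩ := h.exists_eLpNorm_le_of_large hd hα hα2 hαd hlam hγ hC
  have hfix : ∀ k : ℕ, ∃ C : ℝ, 0 < C ∧ (0 < k → ∀ a : Sym2 (Vertex d) → ℝ, BoundedEnv C₁ a →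
      ∀ u : Vertex d → ℝ, IsLatticeResolvent α lam a k (fun x => lam * g x - fracLap α g x) u →
      eLpNorm (fun x => cellExtend k u x - g x) 2 volume ≤ ENNReal.ofReal C) := by
    intro k
    rcases Nat.eq_zero_or_pos k with rfl | hk
    · exact ⟨1, one_pos, fun h => absurd h (lt_irrefl 0)⟩
    · obtain ⟨C, hC0, hb⟩ := h.exists_eLpNorm_le_of_fixed (C₁ := C₁) hd hα hα2 hlam hk
      exact ⟨C, hC0, fun _ => hb⟩
  choose S hS0 hS using hfix
  have hsum0 : 0 ≤ ∑ k ∈ Finset.Ico 2 K, S k / rate d α γ k :=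
    Finset.sum_nonneg fun k hk => div_nonneg (hS0 k).le (rate_pos (Finset.mem_Ico.1 hk).1).le
  refine ⟨C + ∑ k ∈ Finset.Ico 2 K, S k / rate d α γ k, by positivity,
    fun a ha L hgood k hk hL u hu => ?_⟩
  have hr := rate_pos (d := d) (α := α) (γ := γ) hk
  rcases le_or_gt K k with hKk | hKk
  · refine (hlarge a ha L hgood k hKk hL u hu).trans (ENNReal.ofReal_le_ofReal ?_)
    gcongr
    linarith
  · refine (hS k (by omega) a ha u hu).trans (ENNReal.ofReal_le_ofReal ?_)
    have h1 : S k / rate d α γ k ≤ ∑ k ∈ Finset.Ico 2 K, S k / rate d α γ k :=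
      Finset.single_le_sum (f := fun k => S k / rate d α γ k)
        (fun k hk => div_nonneg (hS0 k).le (rate_pos (Finset.mem_Ico.1 hk).1).le)
        (Finset.mem_Ico.2 ⟨hk, hKk⟩)
    rw [← div_le_iff₀ hr]
    linarith

/-- Almost every environment is bounded. -/
theorem AssumptionH1.ae_boundedEnv {Ω : Type*} [MeasurableSpace Ω] {P : Measure Ω}
    {w : Sym2 (Vertex d) → Ω → ℝ} (h : AssumptionH1 P C₁ w) :
    ∀ᵐ ω ∂P, BoundedEnv C₁ fun e => w e ω := by
  have h1 : ∀ᵐ ω ∂P, ∀ e : Edge d, 0 ≤ w e ω := ae_all_iff.2 h.nonneg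
  have h2 : ∀ᵐ ω ∂P, ∀ e : Edge d, w e ω ≤ C₁ := ae_all_iff.2 h.bounded
  filter_upwards [h1, h2] with ω hω1 hω2
  exact ⟨fun x y hxy => hω1 ⟨s(x, y), by rwa [Sym2.mk_isDiag_iff]⟩,
    fun x y hxy => hω2 ⟨s(x, y), by rwa [Sym2.mk_isDiag_iff]⟩⟩

theorem fracResolvent_spec (hd : 0 < d) (hα : 0 < α) (hα2 : α < 2) {f : Space d → ℝ}
    (hf : f ∈ testClass d α lam) : IsFracResolvent α lam f (fracResolvent α lam f) := by
  obtain ⟨g, hg, hc, rfl⟩ := hf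
  obtain ⟨B, R, h⟩ := exists_testBounds hα hα2 hg hc
  exact Classical.epsilon_spec ⟨g, h.isFracResolvent hd hα hα2⟩

theorem BoundedEnv.latticeResolvent_spec {a : Sym2 (Vertex d) → ℝ} (ha : BoundedEnv C₁ a)
    (hd : 0 < d) (hα : 0 < α) (hα2 : α < 2) (hlam : 0 < lam) {f : Space d → ℝ}
    (hf : f ∈ testClass d α lam) {k : ℕ} (hk : 0 < k) :
    IsLatticeResolvent α lam a k f (latticeResolvent α lam a k f) := by
  obtain ⟨g, hg, hc, hfg⟩ := hf
  obtain ⟨B, R, h⟩ := exists_testBounds hα hα2 hg hc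
  exact Classical.epsilon_spec (ha.exists_isLatticeResolvent hα hlam hk
    (h.summable_sq_lattice hd hα hα2 hk hfg))

theorem exists_eLpNorm_resolvent_sub_le (hd : 0 < d) (hα : 0 < α) (hα2 : α < 2) (hαd : α < d)
    (hlam : 0 < lam) (hγ : 0 < γ) (hC : 1 ≤ C₁) {f : Space d → ℝ} (hf : f ∈ testClass d α lam) :
    ∃ C : ℝ, 0 < C ∧ ∀ a : Sym2 (Vertex d) → ℝ, BoundedEnv C₁ a → ∀ L,
      GoodFrom α C₁ a L → ∀ k : ℕ, 2 ≤ k → L ≤ cutoff d C₁ k →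
      eLpNorm (fun x => cellExtend k (latticeResolvent α lam a k f) x - fracResolvent α lam f x) 2
        volume ≤ ENNReal.ofReal (C * rate d α γ k) := by
  have hf' := hf
  obtain ⟨g, hg, hc, rfl⟩ := hf
  obtain ⟨B, R, h⟩ := exists_testBounds hα hα2 hg hc
  obtain ⟨C, hC0, hb⟩ := h.exists_eLpNorm_le hd hα hα2 hαd hlam hγ hC
  refine ⟨C, hC0, fun a ha L hgood k hk hL => ?_⟩
  have hae := (fracResolvent_spec hd hα hα2 hf').ae_eq hlam (h.isFracResolvent hd hα hα2)
  refine le_trans (le_of_eq (eLpNorm_congr_ae ?_)) (hb a ha L hgood k hk hL _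
    (ha.latticeResolvent_spec hd hα hα2 hlam hf' (by omega)))
  filter_upwards [hae] with x hx
  rw [hx]

end Convergence

theorem theorem1p1 (d : ℕ) (α lam γ C₁ : ℝ) (hα : 0 < α) (hα2 : α < 2) (hd : α < (d : ℝ))
    (hlam : 0 < lam) (hγ : 0 < γ) :
    -- `R̄_lam f` is well defined for every `f` in the class
    (∀ f ∈ testClass d α lam, IsFracResolvent α lam f (fracResolvent α lam f) ∧
      ∀ v, IsFracResolvent α lam f v → v =ᵐ[volume] fracResolvent α lam f) ∧
    ∃ C₀ : (Space d → ℝ) → ℝ, (∀ f, 0 < C₀ f) ∧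
      ∀ (Ω : Type*) [MeasurableSpace Ω] (P : Measure Ω) [IsProbabilityMeasure P]
        (w : Sym2 (Vertex d) → Ω → ℝ), AssumptionH1 P C₁ w →
        -- `R_lam^{k,ω} f` is well defined
        (∀ᵐ ω ∂P, ∀ f ∈ testClass d α lam, ∀ k : ℕ, 1 ≤ k →
          IsLatticeResolvent α lam (fun e => w e ω) k f
              (latticeResolvent α lam (fun e => w e ω) k f) ∧
            ∀ v, IsLatticeResolvent α lam (fun e => w e ω) k f v →
              v = latticeResolvent α lam (fun e => w e ω) k f) ∧
        ∃ k₀ : Ω → ℕ, Measurable k₀ ∧ (∀ ω, 1 ≤ k₀ ω) ∧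
          ∀ᵐ ω ∂P, ∀ f ∈ testClass d α lam, ∀ k : ℕ, k₀ ω < k →
            eLpNorm (fun x => cellExtend k (latticeResolvent α lam (fun e => w e ω) k f) x -
                fracResolvent α lam f x) 2 volume ≤
              ENNReal.ofReal (C₀ f * rate d α γ k) := by
  have hd0 : 0 < d := by
    have : (0 : ℝ) < d := hα.trans hd
    exact_mod_cast this
  refine ⟨fun f hf => ⟨fracResolvent_spec hd0 hα hα2 hf, fun v hv =>
    hv.ae_eq hlam (fracResolvent_spec hd0 hα hα2 hf)⟩, ?_⟩
  -- The constants are chosen before the probability space. The value 1 serves functions outside the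
  -- class, and the case C₁ < 1, which mean one excludes.
  have hconst : ∀ f : Space d → ℝ, ∃ C : ℝ, 0 < C ∧ (f ∈ testClass d α lam → 1 ≤ C₁ →
      ∀ a : Sym2 (Vertex d) → ℝ, BoundedEnv C₁ a → ∀ L, GoodFrom α C₁ a L → ∀ k : ℕ, 2 ≤ k →
      L ≤ cutoff d C₁ k → eLpNorm (fun x => cellExtend k (latticeResolvent α lam a k f) x -
        fracResolvent α lam f x) 2 volume ≤ ENNReal.ofReal (C * rate d α γ k)) := by
    intro f
    by_cases hf : f ∈ testClass d α lam ∧ 1 ≤ C₁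
    · obtain ⟨C, hC0, hb⟩ := exists_eLpNorm_resolvent_sub_le hd0 hα hα2 hd hlam hγ hf.2 hf.1
      exact ⟨C, hC0, fun _ _ => hb⟩
    · exact ⟨1, one_pos, fun h1 h2 => absurd ⟨h1, h2⟩ hf⟩
  choose C₀ hC₀ hbound using hconst
  refine ⟨C₀, hC₀, fun Ω _ P _ w hw => ⟨?_, ?_⟩⟩
  · filter_upwards [hw.ae_boundedEnv] with ω hω f hf k hk
    have hspec := hω.latticeResolvent_spec hd0 hα hα2 hlam hf hk
    exact ⟨hspec, fun v hv => hω.isLatticeResolvent_unique hα hlam hk hv hspec⟩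
  · have hC := hw.one_le_bound hd0
    obtain ⟨L, hLm, hL⟩ := hw.exists_goodFrom hd0 hα
    have hN : ∀ l : ℕ, ∃ N : ℕ, ∀ k, N ≤ k → l ≤ cutoff d C₁ k := fun l =>
      eventually_atTop.1 ((tendsto_cutoff hd0 hC).eventually_ge_atTop l)
    choose N hN using hN
    -- A deterministic function of the random scale alone: beyond it the cutoff exceeds L, and the
    -- added 1 ensures k ≥ 2.
    refine ⟨fun ω => N (L ω) + 1, (measurable_of_countable fun l => N l + 1).comp hLm,
      fun ω => Nat.le_add_left _ _, ?_⟩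
    filter_upwards [hw.ae_boundedEnv, hL] with ω hω hLω f hf k hk
    have hk' : N (L ω) + 1 < k := hk
    exact hbound f hf hC _ hω (L ω) hLω k (by omega) (hN (L ω) k (by omega))
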